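/- Let $\mathcal A=\mathbb Z[a_1,a_2,a_3,a_4,a_6]$, let $K$ be an algebraic closure of $\operatorname{Frac}\mathcal A$, and let $E$ be the elliptic curve over $K$ given in $\mathbb P^2_K$ by $$y^2z+a_1xyz+a_3yz^2=x^3+a_2x^2z+a_4xz^2+a_6z^3,$$ with its usual group law with neutral element $0=(0:1:0)$. Put $X=x/z$, $Y=y/z$ in the function field $K(E)$. For $f\in K(E)\setminus\{0\}$ let $\operatorname{ord}_0 f$ be its order at $0$; its leading coefficient is the value at $0$ of $(X/Y)^{-\operatorname{ord}_0 f}f$. For $n\in\mathbb Z\setminus\{0\}$ let $\Psi_n\in K(E)$ be the rational function with divisor $\sum_{P\in E[n]\setminus\{0\}}(P)-(n^2-1)(0)$ and leading coefficient $n$, and let $\Psi_0=0$. For $n \in \mathbb Z$ put $\Phi_n=X\Psi_n^2-\Psi_{n-1}\Psi_{n+1}$, $\Omega_0=1$, and $$\Omega_n=\frac{1}{2\Psi_n}\left(\Psi_{2n}-\Psi_n^2(a_1\Phi_n+a_3\Psi_n^2)\right)\qquad(n\neq 0).$$ Let $A_n,B_n,C_n\in\mathcal A[X,Y]$ be the representatives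 of $\Psi_n\Phi_n$, $\Omega_n$, $\Psi_n^3$, respectively, of degree at most $2$ in $X$, and put $$\alpha_n=z^{n^2}A_n(x/z,y/z),\quad \beta_n=z^{n^2}B_n(x/z,y/z),\quad \gamma_n=z^{n^2}C_n(x/z,y/z).$$ Proposition. For every $n\in\mathbb Z$ these objects are well defined: $\Psi_n$ exists and is unique, the representatives $A_n,B_n,C_n$ exist in $\mathcal A[X,Y]$ and are unique, and they have total degree at most $n^2$, so that $\alpha_n,\beta_n,\gamma_n$ are homogeneous polynomials of degree $n^2$ in $\mathcal A[x,y,z]$ (or zero). Moreover, for every point $P=(x:y:z)\in E(K)$, including the point at infinity, $$nP=\bigl(\alpha_n(x,y,z):\beta_n(x,y,z):\gamma_n(x,y,z)\bigr).$$ -/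

import Mathlib

noncomputable section

namespace GenericCurve

open MvPolynomial

/-! ### The generic Weierstrass curve -/

/-- The polynomial ring `ℤ[a₁, a₂, a₃, a₄, a₆]`; the five variables `X 0, …, X 4` are
`a₁, a₂, a₃, a₄, a₆` in this order. -/
abbrev CoeffRing : Type := MvPolynomial (Fin 5) ℤ

/-- The Weierstrass curve over `ℤ[a₁, a₂, a₃, a₄, a₆]` with coefficients `a₁, a₂, a₃, a₄, a₆`. -/
def universalCurve : WeierstrassCurve CoeffRing where
  a₁ := X 0
  a₂ := X 1
  a₃ := X 2
  a₄ := X 3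
  a₆ := X 4

/-- An algebraic closure of the field of fractions of `ℤ[a₁, a₂, a₃, a₄, a₆]`. -/
abbrev K : Type := AlgebraicClosure (FractionRing CoeffRing)

/-- The inclusion of `ℤ[a₁, a₂, a₃, a₄, a₆]` into `K`. -/
abbrev coeffHom : CoeffRing →+* K := algebraMap CoeffRing K

/-- The generic Weierstrass curve, over the field `K`. -/
def E : WeierstrassCurve K := universalCurve.map coeffHom

lemma coeffHom_injective : Function.Injective coeffHom := by
  have h : coeffHom = (algebraMap (FractionRing CoeffRing) K).comp
      (algebraMap CoeffRing (FractionRing CoeffRing)) :=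
    IsScalarTower.algebraMap_eq CoeffRing (FractionRing CoeffRing) K
  rw [h, RingHom.coe_comp]
  exact (algebraMap (FractionRing CoeffRing) K).injective.comp
    (IsFractionRing.injective CoeffRing (FractionRing CoeffRing))

lemma universalCurve_Δ_ne_zero : universalCurve.Δ ≠ 0 := by
  intro h
  have h' := congrArg (MvPolynomial.eval (![0, 0, 0, 0, 1] : Fin 5 → ℤ)) h
  rw [← WeierstrassCurve.map_Δ] at h'
  simp [WeierstrassCurve.Δ, WeierstrassCurve.b₂, WeierstrassCurve.b₄, WeierstrassCurve.b₆,
    WeierstrassCurve.b₈, universalCurve, WeierstrassCurve.map] at h'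

lemma E_Δ_ne_zero : E.Δ ≠ 0 := by
  rw [E, WeierstrassCurve.map_Δ]
  exact (map_ne_zero_iff _ coeffHom_injective).mpr universalCurve_Δ_ne_zero

/-- The generic Weierstrass curve is smooth: every nonzero solution of the homogeneous
Weierstrass equation is nonsingular. -/
lemma nonsingular_of_equation {v : Fin 3 → K} (hv : v ≠ 0) (h : E.toProjective.Equation v) :
    E.toProjective.Nonsingular v := by
  by_cases hz : v 2 = 0
  · have hx : v 0 = 0 := by
      simpa using (WeierstrassCurve.Projective.equation_of_Z_eq_zero hz).mp h
    have hy : v 1 ≠ 0 := by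
      intro hy
      apply hv
      ext i
      fin_cases i <;> simp [hx, hy, hz]
    refine (WeierstrassCurve.Projective.nonsingular_of_Z_eq_zero hz).mpr ⟨h, ?_⟩
    simp [hx, hy]
  · refine (WeierstrassCurve.Projective.nonsingular_of_Z_ne_zero hz).mpr ?_
    exact (WeierstrassCurve.Affine.equation_iff_nonsingular_of_Δ_ne_zero E_Δ_ne_zero).mp
      ((WeierstrassCurve.Projective.equation_of_Z_ne_zero hz).mp h)

/-- The point `(v 0 : v 1 : v 2)` of `E(K)`, an element of the group of points of `E`. -/
def point (v : Fin 3 → K) (hv : v ≠ 0) (h : E.toProjective.Equation v) : E.toProjective.Point :=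
  ⟨(WeierstrassCurve.Projective.nonsingularLift_iff v).mpr (nonsingular_of_equation hv h)⟩

/-- The class `(v 0 : v 1 : v 2)` of a coordinate vector up to multiplication by units of `K`. -/
def projClass (v : Fin 3 → K) : WeierstrassCurve.Projective.PointClass K :=
  Quotient.mk (MulAction.orbitRel Kˣ (Fin 3 → K)) v

/-! ### Rational functions on the curve, their values and their orders -/

/-- The function field `K(E)`. -/
abbrev FunField : Type := E.toAffine.FunctionField

/-- The rational function `X = x / z`. -/
def funX : FunField :=
  algebraMap E.toAffine.CoordinateRing FunField
    (WeierstrassCurve.Affine.CoordinateRing.mk E.toAffine (Polynomial.C Polynomial.X))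

/-- The rational function `Y = y / z`. -/
def funY : FunField :=
  algebraMap E.toAffine.CoordinateRing FunField
    (WeierstrassCurve.Affine.CoordinateRing.mk E.toAffine Polynomial.X)

/-- The inclusion of the constants `K` into `K(E)`. -/
def const : K →+* FunField :=
  (algebraMap E.toAffine.CoordinateRing FunField).comp
    (algebraMap K E.toAffine.CoordinateRing)

/-- The rational function `F(X, Y, 1)`, that is `F(x, y, z) / z ^ d` for `F` homogeneous of
degree `d`. -/
def dehomogenize (F : MvPolynomial (Fin 3) K) : FunField :=
  eval₂ const ![funX, funY, 1] F

/-- `HasValueAt v f c`: the rational function `f` is regular at the point `P = (v 0 : v 1 : v 2)`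
of the curve, with value `c` there. That is, `f` is a quotient `F / G` of two homogeneous
polynomials of the same degree with `G(P) ≠ 0`, and `c = F(P) / G(P)`. -/
def HasValueAt (v : Fin 3 → K) (f : FunField) (c : K) : Prop :=
  ∃ (d : ℕ) (F G : MvPolynomial (Fin 3) K), F.IsHomogeneous d ∧ G.IsHomogeneous d ∧
    eval v G ≠ 0 ∧ f = dehomogenize F / dehomogenize G ∧ c = eval v F / eval v G

/-- `t` generates the maximal ideal of the local ring at the point `(v 0 : v 1 : v 2)`. -/
def IsUniformizerAt (v : Fin 3 → K) (t : FunField) : Prop :=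
  HasValueAt v t 0 ∧
    ∀ g, HasValueAt v g 0 → ∃ (h : FunField) (c : K), HasValueAt v h c ∧ g = t * h

/-- `HasOrderAt v f k`: the rational function `f` is nonzero and vanishes to order `k` at the point
`(v 0 : v 1 : v 2)` of the curve. That is, `f = t ^ k * u` with `t` a uniformizer and `u` a unit of
the local ring. -/
def HasOrderAt (v : Fin 3 → K) (f : FunField) (k : ℤ) : Prop :=
  ∃ (t u : FunField) (c : K), IsUniformizerAt v t ∧ HasValueAt v u c ∧ c ≠ 0 ∧ f = t ^ k * u

/-- `HasLeadingCoeff f c`: the function `(X / Y) ^ (-k) * f`, where `k` is the order of `f` at the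
point at infinity `(0 : 1 : 0)`, takes the value `c` at that point. -/
def HasLeadingCoeff (f : FunField) (c : K) : Prop :=
  ∃ k : ℤ, HasOrderAt ![0, 1, 0] f k ∧ HasValueAt ![0, 1, 0] ((funX / funY) ^ (-k) * f) c

/-! ### Division polynomials -/

open scoped Classical in
/-- The order at `P` prescribed by the divisor `∑_{Q ∈ E[n] - 0} (Q) - (n² - 1) (0)`. -/
def divisionDivisor (n : ℤ) (P : E.toProjective.Point) : ℤ :=
  if P = 0 then -(n ^ 2 - 1) else if n • P = 0 then 1 else 0

/-- The defining property of the `n`-th division polynomial: for `n ≠ 0`, a rational function with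
divisor `∑_{Q ∈ E[n] - 0} (Q) - (n² - 1) (0)` and leading coefficient `n`; for `n = 0`, zero. -/
def IsDivisionPolynomial (n : ℤ) (f : FunField) : Prop :=
  (n = 0 → f = 0) ∧
  (n ≠ 0 → (∀ (v : Fin 3 → K) (hv : v ≠ 0) (h : E.toProjective.Equation v),
      HasOrderAt v f (divisionDivisor n (point v hv h))) ∧
    HasLeadingCoeff f (n : K))

/-- The `n`-th division polynomial `Ψ_n`. -/
def Psi (n : ℤ) : FunField := Classical.epsilon (IsDivisionPolynomial n)

/-- `Φ_n = X Ψ_n² - Ψ_{n-1} Ψ_{n+1}`. -/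
def Phi (n : ℤ) : FunField := funX * Psi n ^ 2 - Psi (n - 1) * Psi (n + 1)

/-- `Ω_n = (Ψ_{2n} - Ψ_n² (a₁ Φ_n + a₃ Ψ_n²)) / (2 Ψ_n)` for `n ≠ 0`, and `Ω_0 = 1`. -/
def Omega (n : ℤ) : FunField :=
  if n = 0 then 1 else
    (Psi (2 * n) - Psi n ^ 2 * (const E.a₁ * Phi n + const E.a₃ * Psi n ^ 2)) / (2 * Psi n)

/-! ### The homogeneous polynomials `α_n`, `β_n`, `γ_n` -/

/-- `A ∈ ℤ[a₁, a₂, a₃, a₄, a₆][X, Y]` has degree at most `2` in `X` and represents the rational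
function `f` on the curve. -/
def IsReducedRepresentative (f : FunField) (A : MvPolynomial (Fin 2) CoeffRing) : Prop :=
  A.degreeOf 0 ≤ 2 ∧ eval₂ (const.comp coeffHom) ![funX, funY] A = f

/-- The representative of `f` in `ℤ[a₁, a₂, a₃, a₄, a₆][X, Y]` of degree at most `2` in `X`. -/
def reducedRepresentative (f : FunField) : MvPolynomial (Fin 2) CoeffRing :=
  Classical.epsilon (IsReducedRepresentative f)

/-- `A_n`, the reduced representative of `Ψ_n Φ_n`. -/
def polyA (n : ℤ) : MvPolynomial (Fin 2) CoeffRing := reducedRepresentative (Psi n * Phi n)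

/-- `B_n`, the reduced representative of `Ω_n`. -/
def polyB (n : ℤ) : MvPolynomial (Fin 2) CoeffRing := reducedRepresentative (Omega n)

/-- `C_n`, the reduced representative of `Ψ_n³`. -/
def polyC (n : ℤ) : MvPolynomial (Fin 2) CoeffRing := reducedRepresentative (Psi n ^ 3)

/-- The homogeneous polynomial `A(x / z, y / z) z ^ d` of degree `d`, for `A` of total degree at
most `d`. -/
def homogenize (d : ℕ) (A : MvPolynomial (Fin 2) CoeffRing) : MvPolynomial (Fin 3) CoeffRing :=
  ∑ m ∈ A.support, C (A.coeff m) * (X 0 ^ m 0 * X 1 ^ m 1 * X 2 ^ (d - (m 0 + m 1)))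

/-- `α_n = A_n z ^ (n²)`. -/
def alpha (n : ℤ) : MvPolynomial (Fin 3) CoeffRing := homogenize (n.natAbs ^ 2) (polyA n)

/-- `β_n = B_n z ^ (n²)`. -/
def beta (n : ℤ) : MvPolynomial (Fin 3) CoeffRing := homogenize (n.natAbs ^ 2) (polyB n)

/-- `γ_n = C_n z ^ (n²)`. -/
def gamma (n : ℤ) : MvPolynomial (Fin 3) CoeffRing := homogenize (n.natAbs ^ 2) (polyC n)

/-- The polynomials `α_n`, `β_n`, `γ_n` are well defined: there is exactly one `n`-th division
polynomial, the functions `Ψ_n Φ_n`, `Ω_n`, `Ψ_n³` have exactly one reduced representative each,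
and these have total degree at most `n²`. -/
def WellDefined (n : ℤ) : Prop :=
  (∃! f, IsDivisionPolynomial n f) ∧
  ((∃! A, IsReducedRepresentative (Psi n * Phi n) A) ∧ (polyA n).totalDegree ≤ n.natAbs ^ 2) ∧
  ((∃! B, IsReducedRepresentative (Omega n) B) ∧ (polyB n).totalDegree ≤ n.natAbs ^ 2) ∧
  ((∃! C, IsReducedRepresentative (Psi n ^ 3) C) ∧ (polyC n).totalDegree ≤ n.natAbs ^ 2)

end GenericCurve

end

noncomputable section

namespace GenericCurve

open WeierstrassCurve

/-! ### Multiples of a point at which no division polynomial vanishes -/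

section Multiples

/-! The function `Ψ_n` is identified with the elliptic divisibility sequence `psiVal`, evaluated at
the generic point `(X, Y)` of the curve over its own function field. There no `Ψ_n` with `n ≠ 0`
vanishes, so division is harmless: the group law and the recursions for indices `2n` and `2n + 1`
show by induction that `nP` has affine coordinates `(Φ_n/Ψ_n², Ω_n/Ψ_n³)` (`mulXEq_of_pos`,
`zsmul_some_eq`). In weighted (Jacobian) coordinates the vectors `(Φ_n, Ω_n, Ψ_n)` then satisfy the
duplication and addition formulas exactly, not merely up to scaling (`dblXYZ_jacVal`,
`addXYZ_jacVal`).

The formulas have to reach every point, including torsion points, where the generic argument divides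
by zero. This requires them to live in a ring that maps to the field at every point. The universal
coordinate ring serves: solving the Weierstrass equation for `a₆` makes it a polynomial ring over
`ℤ`, so it is integrally closed, and `Ω_n`, a root of the monic quadratic given by the curve
equation, lies in it despite the denominator `2Ψ_n` (`exists_omegaU`). The exact identities
specialize, and a second induction gives `nP = (Φ_n : Ω_n : Ψ_n)` in Jacobian coordinates at every
affine point (`zsmul_specialize`). In projective coordinates this is `(Φ_nΨ_n : Ω_n : Ψ_n³)`.

That this sequence has the prescribed divisor rests on three facts. The affine zeros of `Ψ_n` are
the nonzero points killed by `n`, by the formula just described. They are simple, because the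
invariant derivation `D` multiplies by `n` under `[n]`, which gives `Ψ_n DΦ_n - 2Φ_n DΨ_n = n(2Ω_n +
a₁Φ_nΨ_n + a₃Ψ_n³)`; at a zero of `Ψ_n` the right side is `2nΩ_n ≠ 0` (`hasOrderAt_psiF_one`). The
order and the leading coefficient at infinity come from the degree and leading coefficient of `preΨ`
(`hasValueAt_infinity_psiF`). Uniqueness holds since a function without affine zeros or poles is a
unit of the coordinate ring, hence constant, and the leading coefficient fixes the constant.

Finally, the monomials `X^i Y^j` with `i ≤ 2` have pairwise distinct pole orders `2i + 3j` at
infinity. So reduced representatives are unique and their degrees are read off from pole orders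
(`exists_weight_eq`). Since `Ω_n` has pole order exactly `3n²` while `Ψ_nΦ_n` and `Ψ_n³` have less,
the homogeneous forms take the point at infinity to itself. -/

/-- The value at `(x, y)` of the `n`-th division polynomial of `W`. -/
def psiVal {R : Type*} [CommRing R] (W : WeierstrassCurve R) (x y : R) (n : ℤ) : R :=
  normEDS (2 * y + W.a₁ * x + W.a₃) (W.Ψ₃.eval x) (W.preΨ₄.eval x) n

lemma map_psiVal {R S : Type*} [CommRing R] [CommRing S] (f : R →+* S) (W : WeierstrassCurve R)
    (x y : R) (n : ℤ) : psiVal (W.map f) (f x) (f y) n = f (psiVal W x y n) := by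
  rw [psiVal, psiVal, map_normEDS, map_Ψ₃, map_preΨ₄]
  simp only [map_a₁, map_a₃, map_add, map_mul, map_ofNat, Polynomial.eval_map,
    Polynomial.eval₂_at_apply]

variable {F : Type*} [Field F] (W : WeierstrassCurve F) (x y : F)

/-- The quotient `Φ_n / Ψ_n²` at `(x, y)`. -/
def mulX (n : ℤ) : F := x - psiVal W x y (n + 1) * psiVal W x y (n - 1) / psiVal W x y n ^ 2

variable {W x y}

lemma psiVal_zero : psiVal W x y 0 = 0 := by simp [psiVal]

lemma psiVal_one : psiVal W x y 1 = 1 := by simp [psiVal]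

lemma psiVal_two : psiVal W x y 2 = 2 * y + W.a₁ * x + W.a₃ := by simp [psiVal]

lemma psiVal_neg (n : ℤ) : psiVal W x y (-n) = -psiVal W x y n := by simp [psiVal]

lemma sub_negY (x y : F) : y - W.toAffine.negY x y = 2 * y + W.a₁ * x + W.a₃ := by
  rw [Affine.negY]; ring

lemma mulX_one : mulX W x y 1 = x := by simp [mulX, psiVal_zero]

lemma psiVal_even (n : ℤ) : psiVal W x y (2 * n) * psiVal W x y 2 =
    psiVal W x y (n - 1) ^ 2 * psiVal W x y n * psiVal W x y (n + 2) -
      psiVal W x y (n - 2) * psiVal W x y n * psiVal W x y (n + 1) ^ 2 := by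
  rw [psiVal_two]
  exact normEDS_even ..

lemma psiVal_odd (n : ℤ) : psiVal W x y (2 * n + 1) =
    psiVal W x y (n + 2) * psiVal W x y n ^ 3 -
      psiVal W x y (n - 1) * psiVal W x y (n + 1) ^ 3 :=
  normEDS_odd ..

lemma sub_mulX (hψ : ∀ n : ℤ, n ≠ 0 → psiVal W x y n ≠ 0) {n : ℤ} (hn : 1 ≤ n) :
    (x - mulX W x y n) * psiVal W x y n ^ 2 = psiVal W x y (n + 1) * psiVal W x y (n - 1) := by
  rw [mulX, sub_sub_cancel, div_mul_cancel₀ _ (pow_ne_zero 2 (hψ n (by lia)))]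

/-- Over the common denominator the numerator is the right-hand side of the odd recursion. -/
lemma mulX_sub_mulX_succ (hψ : ∀ n : ℤ, n ≠ 0 → psiVal W x y n ≠ 0) {n : ℤ} (hn : 1 ≤ n) :
    mulX W x y n - mulX W x y (n + 1) =
      psiVal W x y (2 * n + 1) / (psiVal W x y n ^ 2 * psiVal W x y (n + 1) ^ 2) := by
  have h0 := hψ n (by lia)
  have h1 := hψ (n + 1) (by lia)
  rw [psiVal_odd, mulX, mulX, show n + 1 + 1 = n + 2 by ring, show n + 1 - 1 = n by ring]
  field_simp
  ring

lemma mulX_ne_mulX_succ (hψ : ∀ n : ℤ, n ≠ 0 → psiVal W x y n ≠ 0) {n : ℤ} (hn : 1 ≤ n) :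
    mulX W x y n ≠ mulX W x y (n + 1) := by
  rw [← sub_ne_zero, mulX_sub_mulX_succ hψ hn]
  exact div_ne_zero (hψ _ (by lia)) (mul_ne_zero (pow_ne_zero _ (hψ _ (by lia)))
    (pow_ne_zero _ (hψ _ (by lia))))

lemma mulX_ne (hψ : ∀ n : ℤ, n ≠ 0 → psiVal W x y n ≠ 0) {n : ℤ} (hn : 2 ≤ n) :
    mulX W x y n ≠ x := by
  intro h
  have := sub_mulX hψ (n := n) (by lia)
  rw [h, sub_self, zero_mul] at this
  exact mul_ne_zero (hψ _ (by lia)) (hψ _ (by lia)) this.symm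

variable [DecidableEq F]

/-- With `P = (x, y)` and `Q = (q, s)`, both sides, as functions of `P`, have divisor `(2Q) + (-2Q)
- 2(0)`: the zeros of `x - q` cancel the poles of `x(Q ± P)`. It yields the X-coordinate of `2Q`
from those of `Q + P` and `Q - P`. The proof is a direct computation. -/
lemma X_sub_addX_self {q s : F} (h : W.toAffine.Equation x y) (h' : W.toAffine.Equation q s)
    (hx : q ≠ x) (hη : s ≠ W.toAffine.negY q s) :
    x - W.toAffine.addX q q (W.toAffine.slope q q s s) =
      (q - W.toAffine.addX q x (W.toAffine.slope q x s y)) *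
      (W.toAffine.addX q x (W.toAffine.slope q x s (W.toAffine.negY x y)) - q) * (x - q) ^ 2 /
        (s - W.toAffine.negY q s) ^ 2 := by
  rw [Affine.slope_of_X_ne hx, Affine.slope_of_X_ne hx, Affine.slope_of_Y_ne rfl hη]
  rw [Affine.equation_iff] at h h'
  have h1 : q - x ≠ 0 := sub_ne_zero.mpr hx
  have h2 : s - W.toAffine.negY q s ≠ 0 := sub_ne_zero.mpr hη
  obtain ⟨l, hl⟩ : ∃ l, l = (s - y) / (q - x) := ⟨_, rfl⟩
  obtain ⟨k, hk⟩ : ∃ k, k = (s - W.toAffine.negY x y) / (q - x) := ⟨_, rfl⟩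
  rw [← hl, ← hk]
  rw [eq_div_iff h1] at hl hk
  -- With the slope cleared, the right side is linear in `y`. Replacing `y` by `negY x y` gives `hB`
  -- up to sign, so the product of the two is invariant under `P ↦ -P`.
  have hA : (q - W.toAffine.addX q x l) * (x - q) ^ 2 =
      ((2 * q + x + W.a₂) * (x - q) ^ 2 - (x ^ 3 + W.a₂ * x ^ 2 + W.a₄ * x + W.a₆)
        - (q ^ 3 + W.a₂ * q ^ 2 + W.a₄ * q + W.a₆)) + (W.a₁ * x + W.a₃) * s +
        (s - W.toAffine.negY q s) * y := by
    simp only [Affine.addX, Affine.negY]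
    linear_combination -h - h' - (l * (q - x) + (s - y) + W.a₁ * (q - x)) * hl
  have hB : (W.toAffine.addX q x k - q) * (x - q) ^ 2 =
      -(((2 * q + x + W.a₂) * (x - q) ^ 2 - (x ^ 3 + W.a₂ * x ^ 2 + W.a₄ * x + W.a₆)
        - (q ^ 3 + W.a₂ * q ^ 2 + W.a₄ * q + W.a₆)) + (W.a₁ * x + W.a₃) * s +
        (s - W.toAffine.negY q s) * W.toAffine.negY x y) := by
    simp only [Affine.addX, Affine.negY] at hk ⊢
    linear_combination h + h' + (k * (q - x) + (s - (-y - W.a₁ * x - W.a₃)) +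
      W.a₁ * (q - x)) * hk
  have hC : (x - W.toAffine.addX q q ((3 * q ^ 2 + 2 * W.a₂ * q + W.a₄ - W.a₁ * s) /
      (s - W.toAffine.negY q s))) * (s - W.toAffine.negY q s) ^ 2 =
      (x + W.a₂ + 2 * q) * (4 * (q ^ 3 + W.a₂ * q ^ 2 + W.a₄ * q + W.a₆) +
        (W.a₁ * q + W.a₃) ^ 2) - (3 * q ^ 2 + 2 * W.a₂ * q + W.a₄) ^ 2 -
        W.a₁ * (W.a₁ * q + W.a₃) * (3 * q ^ 2 + 2 * W.a₂ * q + W.a₄) +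
        W.a₁ ^ 2 * (q ^ 3 + W.a₂ * q ^ 2 + W.a₄ * q + W.a₆) := by
    simp only [Affine.addX]
    field_simp
    simp only [Affine.negY]
    linear_combination (4 * (x + W.a₂ + 2 * q) + W.a₁ ^ 2) * h'
  rw [eq_div_iff (pow_ne_zero 2 h2), hC]
  have h3 : (x - q) ^ 2 ≠ 0 := pow_ne_zero 2 (by rw [← neg_sub]; exact neg_ne_zero.mpr h1)
  apply mul_right_cancel₀ h3
  rw [mul_assoc _ ((x - q) ^ 2), mul_mul_mul_comm, hA, hB]
  simp only [Affine.negY]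
  generalize hg : (2 * q + x + W.a₂) * (x - q) ^ 2 - (x ^ 3 + W.a₂ * x ^ 2 + W.a₄ * x + W.a₆)
        - (q ^ 3 + W.a₂ * q ^ 2 + W.a₄ * q + W.a₆) = g
  -- After the curve equations eliminate `y` and `s`, an identity of polynomials in `x` and `q`
  -- remains.
  have e : g ^ 2 - g * (W.a₁ * x + W.a₃) * (W.a₁ * q + W.a₃) - (W.a₁ * x + W.a₃) ^ 2 *
      (q ^ 3 + W.a₂ * q ^ 2 + W.a₄ * q + W.a₆) - (4 * (q ^ 3 + W.a₂ * q ^ 2 + W.a₄ * q + W.a₆) +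
        (W.a₁ * q + W.a₃) ^ 2) * (x ^ 3 + W.a₂ * x ^ 2 + W.a₄ * x + W.a₆) =
      -(x - q) ^ 2 * ((x + W.a₂ + 2 * q) * (4 * (q ^ 3 + W.a₂ * q ^ 2 + W.a₄ * q + W.a₆) +
        (W.a₁ * q + W.a₃) ^ 2) - (3 * q ^ 2 + 2 * W.a₂ * q + W.a₄) ^ 2 -
        W.a₁ * (W.a₁ * q + W.a₃) * (3 * q ^ 2 + 2 * W.a₂ * q + W.a₄) +
        W.a₁ ^ 2 * (q ^ 3 + W.a₂ * q ^ 2 + W.a₄ * q + W.a₆)) := by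
    rw [← hg]; ring
  linear_combination e - (4 * s ^ 2 + 4 * (W.a₁ * q + W.a₃) * s + (W.a₁ * q + W.a₃) ^ 2) * h
    - ((W.a₁ * x + W.a₃) ^ 2 + 4 * (x ^ 3 + W.a₂ * x ^ 2 + W.a₄ * x + W.a₆)) * h'

lemma X_sub_addX_self_eq (h : W.toAffine.Equation x y) (hη : psiVal W x y 2 ≠ 0) :
    W.toAffine.addX x x (W.toAffine.slope x x y y) = mulX W x y 2 := by
  have hη' : y - W.toAffine.negY x y ≠ 0 := by rwa [sub_negY, ← psiVal_two]
  rw [Affine.slope_of_Y_ne rfl (sub_ne_zero.mp hη')]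
  rw [Affine.equation_iff] at h
  obtain ⟨l, hl⟩ : ∃ l, l = (3 * x ^ 2 + 2 * W.a₂ * x + W.a₄ - W.a₁ * y) /
    (y - W.toAffine.negY x y) := ⟨_, rfl⟩
  rw [← hl]
  rw [eq_div_iff hη', sub_negY] at hl
  have h3 : psiVal W x y 3 = W.Ψ₃.eval x := by simp [psiVal]
  rw [mulX, eq_sub_iff_add_eq, ← eq_sub_iff_add_eq', div_eq_iff (pow_ne_zero 2 hη)]
  norm_num [psiVal_one, h3, psiVal_two, Affine.addX]
  simp only [Ψ₃, b₂, b₄, b₆, b₈]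
  simp
  linear_combination (-W.a₁ ^ 2 - 4 * W.a₂ - 12 * x) * h + (l * (2 * y + W.a₁ * x + W.a₃) +
    (3 * x ^ 2 + 2 * W.a₂ * x + W.a₄ - W.a₁ * y) + W.a₁ * (2 * y + W.a₁ * x + W.a₃)) * hl

/-- The duplication formula is expanded directly: for `n = 2` the general argument
`mulYEq_of_mulXEq` would need the X-coordinate of `3P`, which itself depends on this value. -/
lemma addY_self_sub_negY (h : W.toAffine.Equation x y) (hη : psiVal W x y 2 ≠ 0) :
    W.toAffine.addY x x y (W.toAffine.slope x x y y) - W.toAffine.negY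
      (W.toAffine.addX x x (W.toAffine.slope x x y y))
      (W.toAffine.addY x x y (W.toAffine.slope x x y y)) = psiVal W x y 4 / psiVal W x y 2 ^ 4 := by
  have h2 := X_sub_addX_self_eq h hη
  have hη' : y - W.toAffine.negY x y ≠ 0 := by rwa [sub_negY, ← psiVal_two]
  rw [Affine.addY, Affine.negAddY, h2]
  rw [Affine.slope_of_Y_ne rfl (sub_ne_zero.mp hη')]
  rw [Affine.equation_iff] at h
  obtain ⟨l, hl⟩ : ∃ l, l = (3 * x ^ 2 + 2 * W.a₂ * x + W.a₄ - W.a₁ * y) /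
    (y - W.toAffine.negY x y) := ⟨_, rfl⟩
  rw [← hl]
  rw [eq_div_iff hη', sub_negY] at hl
  have h3 : psiVal W x y 3 = W.Ψ₃.eval x := by simp [psiVal]
  have h4 : psiVal W x y 4 = W.preΨ₄.eval x * (2 * y + W.a₁ * x + W.a₃) := by simp [psiVal]
  obtain ⟨m, hm⟩ : ∃ m, m = mulX W x y 2 := ⟨_, rfl⟩
  have hm' : (x - m) * (2 * y + W.a₁ * x + W.a₃) ^ 2 = W.Ψ₃.eval x := by
    rw [psiVal_two] at hη
    rw [hm, mulX, psiVal_two, sub_sub_cancel, div_mul_cancel₀ _ (pow_ne_zero 2 hη)]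
    norm_num [h3, psiVal_one]
  rw [← hm, eq_div_iff (pow_ne_zero 4 hη), h4, psiVal_two]
  -- This relation between `Ψ₃`, `preΨ₄` and `ψ₂` holds modulo the curve equation, using `4b₈ = b₂b₆
  -- - b₄²`.
  have e : W.Ψ₃.eval x * (6 * x ^ 2 + W.b₂ * x + W.b₄) - (2 * y + W.a₁ * x + W.a₃) ^ 4 =
      W.preΨ₄.eval x := by
    have e1 : (2 * y + W.a₁ * x + W.a₃) ^ 2 = 4 * x ^ 3 + W.b₂ * x ^ 2 + 2 * W.b₄ * x + W.b₆ := by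
      simp only [b₂, b₄, b₆]; linear_combination 4 * h
    rw [show (2 * y + W.a₁ * x + W.a₃) ^ 4 = ((2 * y + W.a₁ * x + W.a₃) ^ 2) ^ 2 by ring, e1]
    simp only [Ψ₃, preΨ₄]
    simp
    linear_combination -x ^ 2 * W.b_relation
  rw [← e, ← hm']
  simp only [b₂, b₄, Affine.negY]
  linear_combination 2 * (x - m) * (2 * y + W.a₁ * x + W.a₃) ^ 3 * hl

/-- The `n`-th multiple of `(x, y)` is an affine point with `X`-coordinate `mulX n`. -/
def MulXEq (h : W.toAffine.Nonsingular x y) (n : ℤ) : Prop :=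
  ∃ (y' : F) (h' : W.toAffine.Nonsingular (mulX W x y n) y'),
    n • Affine.Point.some x y h = .some (mulX W x y n) y' h'

/-- The `Y`-coordinate of the `n`-th multiple of `(x, y)` is given by `Ψ_{2 * n} / Ψ_n⁴`. -/
def MulYEq (h : W.toAffine.Nonsingular x y) (n : ℤ) : Prop :=
  ∀ (y' : F) (h' : W.toAffine.Nonsingular (mulX W x y n) y'),
    n • Affine.Point.some x y h = .some (mulX W x y n) y' h' →
    y' - W.toAffine.negY (mulX W x y n) y' = psiVal W x y (2 * n) / psiVal W x y n ^ 4

lemma MulXEq.one (h : W.toAffine.Nonsingular x y) : MulXEq h 1 :=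
  ⟨y, by rwa [mulX_one], by simp [mulX_one]⟩

lemma MulYEq.one (h : W.toAffine.Nonsingular x y) : MulYEq h 1 := by
  intro y' h' e
  rw [one_smul] at e
  simp only [Affine.Point.some.injEq] at e
  rw [mulX_one, ← e.2, sub_negY, mul_one, psiVal_two, psiVal_one, one_pow, div_one]

variable (hψ : ∀ n : ℤ, n ≠ 0 → psiVal W x y n ≠ 0)
include hψ

omit [DecidableEq F] in
lemma ne_negY_self : y ≠ W.toAffine.negY x y := by
  rw [← sub_ne_zero, sub_negY, ← psiVal_two]
  exact hψ 2 two_ne_zero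

lemma MulXEq.two (h : W.toAffine.Nonsingular x y) : MulXEq h 2 := by
  have hX := X_sub_addX_self_eq h.1 (hψ 2 two_ne_zero)
  have hn := Affine.nonsingular_add h h (fun hxy ↦ ne_negY_self hψ hxy.2)
  refine ⟨_, hX ▸ hn, ?_⟩
  rw [two_zsmul, Affine.Point.add_self_of_Y_ne (ne_negY_self hψ)]
  simp only [hX]

lemma MulYEq.two (h : W.toAffine.Nonsingular x y) : MulYEq h 2 := by
  intro y' h' e
  rw [two_zsmul, Affine.Point.add_self_of_Y_ne (ne_negY_self hψ)] at e
  simp only [Affine.Point.some.injEq] at e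
  have := addY_self_sub_negY h.1 (hψ 2 two_ne_zero)
  rwa [e.2, e.1] at this

lemma addX_eq_of_mulXEq {h : W.toAffine.Nonsingular x y} {n : ℤ} (hn : 2 ≤ n)
    (h1 : MulXEq h (n + 1)) {y' : F} {h' : W.toAffine.Nonsingular (mulX W x y n) y'}
    (e : n • Affine.Point.some x y h = .some (mulX W x y n) y' h') :
    W.toAffine.addX (mulX W x y n) x (W.toAffine.slope (mulX W x y n) x y' y) =
      mulX W x y (n + 1) := by
  obtain ⟨z, hz, ez⟩ := h1
  rw [add_smul, one_smul, e, Affine.Point.add_of_X_ne (mulX_ne hψ hn)] at ez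
  simp only [Affine.Point.some.injEq] at ez
  exact ez.1

lemma addX_negY_eq_of_mulXEq {h : W.toAffine.Nonsingular x y} {n : ℤ} (hn : 2 ≤ n)
    (h1 : MulXEq h (n - 1)) {y' : F} {h' : W.toAffine.Nonsingular (mulX W x y n) y'}
    (e : n • Affine.Point.some x y h = .some (mulX W x y n) y' h') :
    W.toAffine.addX (mulX W x y n) x
      (W.toAffine.slope (mulX W x y n) x y' (W.toAffine.negY x y)) = mulX W x y (n - 1) := by
  obtain ⟨z, hz, ez⟩ := h1
  rw [sub_smul, one_smul, e, sub_eq_add_neg, Affine.Point.neg_some,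
    Affine.Point.add_of_X_ne (mulX_ne hψ hn)] at ez
  simp only [Affine.Point.some.injEq] at ez
  exact ez.1

/-- Write `η = 2Y + a₁X + a₃`. Since `x(Q - P) - x(Q + P) = η(Q)η(P)/(x(P) - x(Q))²`, the
X-coordinates of the neighbours `(n ± 1)P` determine `η(nP)`. The even recursion turns the result
into `Ψ_{2n}`. -/
lemma mulYEq_of_mulXEq {h : W.toAffine.Nonsingular x y} {n : ℤ} (hn : 2 ≤ n)
    (h0 : MulXEq h (n - 1)) (h1 : MulXEq h (n + 1)) : MulYEq h n := by
  intro y' h' e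
  have e0 := addX_negY_eq_of_mulXEq hψ hn h0 e
  have e1 := addX_eq_of_mulXEq hψ hn h1 e
  have key := W.toAffine.addX_eq_addX_negY_sub y' y (mulX_ne hψ hn)
  have hx : x - mulX W x y n ≠ 0 := sub_ne_zero.mpr (mulX_ne hψ hn).symm
  rw [e0, e1, sub_negY x, ← psiVal_two] at key
  rw [eq_div_iff (pow_ne_zero 4 (hψ n (by lia)))]
  apply mul_right_cancel₀ (hψ 2 two_ne_zero)
  rw [psiVal_even]
  have s0 := sub_mulX hψ (n := n - 1) (by lia)
  have s1 := sub_mulX hψ (n := n + 1) (by lia)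
  have s := sub_mulX hψ (n := n) (by lia)
  rw [show n - 1 + 1 = n by ring, show n - 1 - 1 = n - 2 by ring] at s0
  rw [show n + 1 + 1 = n + 2 by ring, show n + 1 - 1 = n by ring] at s1
  have key' : (y' - W.toAffine.negY (mulX W x y n) y') * psiVal W x y 2 =
      (mulX W x y (n - 1) - mulX W x y (n + 1)) * (x - mulX W x y n) ^ 2 := by
    rw [key]; field_simp; ring
  linear_combination psiVal W x y n ^ 4 * key' - psiVal W x y (n + 1) ^ 2 * s0 +
    psiVal W x y (n - 1) ^ 2 * s1 + (mulX W x y (n - 1) - mulX W x y (n + 1)) *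
    ((x - mulX W x y n) * psiVal W x y n ^ 2 + psiVal W x y (n + 1) * psiVal W x y (n - 1)) * s

/-- The difference formula is applied to `(n + 1)P` and `nP`: their difference is `P`, with known
X-coordinate, and their sum is `(2n + 1)P`. -/
lemma mulXEq_odd {h : W.toAffine.Nonsingular x y} {n : ℤ} (hn : 1 ≤ n)
    (h0 : MulXEq h n) (h1 : MulXEq h (n + 1)) (k0 : MulYEq h n) (k1 : MulYEq h (n + 1)) :
    MulXEq h (2 * n + 1) := by
  obtain ⟨y₀, n₀, e₀⟩ := h0
  obtain ⟨y₁, n₁, e₁⟩ := h1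
  have hne := mulX_ne_mulX_succ hψ hn
  have es : (2 * n + 1) • Affine.Point.some x y h = .some _ _ n₁ + .some _ _ n₀ := by
    rw [← e₀, ← e₁, ← add_smul]; congr 1; ring
  have ed : Affine.Point.some x y h = .some _ _ n₁ + -.some _ _ n₀ := by
    rw [← e₀, ← e₁, ← sub_eq_add_neg, ← sub_smul, add_sub_cancel_left, one_smul]
  rw [Affine.Point.add_of_X_ne hne.symm] at es
  rw [Affine.Point.neg_some, Affine.Point.add_of_X_ne hne.symm] at ed
  simp only [Affine.Point.some.injEq] at ed
  have key := W.toAffine.addX_eq_addX_negY_sub y₁ y₀ hne.symm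
  have hX : W.toAffine.addX (mulX W x y (n + 1)) (mulX W x y n) (W.toAffine.slope
      (mulX W x y (n + 1)) (mulX W x y n) y₁ y₀) = mulX W x y (2 * n + 1) := by
    rw [key, ← ed.1, k0 _ _ e₀, k1 _ _ e₁, mulX_sub_mulX_succ hψ hn, mulX]
    have := hψ n (by lia)
    have := hψ (n + 1) (by lia)
    have := hψ (2 * n + 1) (by lia)
    rw [show 2 * n + 1 + 1 = 2 * (n + 1) by ring, show 2 * n + 1 - 1 = 2 * n by ring]
    field_simp
  refine ⟨_, hX ▸ Affine.nonsingular_add n₁ n₀ (fun hxy ↦ hne hxy.1.symm), ?_⟩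
  rw [es]
  simp only [hX]

/-- This is `X_sub_addX_self` for `Q = nP`: the X-coordinates of `Q ± P` and the value `η(Q)` are
known, and the factors recombine to `Ψ_{2n+1}Ψ_{2n-1}/Ψ_{2n}²`. -/
lemma mulXEq_even {h : W.toAffine.Nonsingular x y} {n : ℤ} (hn : 2 ≤ n)
    (h0 : MulXEq h (n - 1)) (h1 : MulXEq h n) (h2 : MulXEq h (n + 1)) :
    MulXEq h (2 * n) := by
  have hy := mulYEq_of_mulXEq hψ hn h0 h2
  obtain ⟨y', h', e⟩ := h1
  have e0 := addX_negY_eq_of_mulXEq hψ hn h0 e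
  have e1 := addX_eq_of_mulXEq hψ hn h2 e
  have hη := hy _ _ e
  have hη' : y' ≠ W.toAffine.negY (mulX W x y n) y' := by
    rw [← sub_ne_zero, hη]
    exact div_ne_zero (hψ _ (by lia)) (pow_ne_zero _ (hψ _ (by lia)))
  have key := X_sub_addX_self h.1 h'.1 (mulX_ne hψ hn) hη'
  have d0 := mulX_sub_mulX_succ hψ (n := n - 1) (by lia)
  rw [show n - 1 + 1 = n by ring, show 2 * (n - 1) + 1 = 2 * n - 1 by ring] at d0
  have hX : W.toAffine.addX (mulX W x y n) (mulX W x y n) (W.toAffine.slope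
      (mulX W x y n) (mulX W x y n) y' y') = mulX W x y (2 * n) := by
    rw [e0, e1, hη, mulX_sub_mulX_succ hψ (by lia), d0] at key
    rw [← sub_sub_cancel x (W.toAffine.addX _ _ _), key, mulX.eq_def W x y (2 * n), sub_right_inj]
    have p0 := hψ n (by lia)
    have p1 := hψ (n + 1) (by lia)
    have p2 := hψ (n - 1) (by lia)
    have p3 := hψ (2 * n) (by lia)
    have s := sub_mulX hψ (n := n) (by lia)
    rw [← eq_div_iff (pow_ne_zero 2 p0)] at s
    rw [s]
    field_simp
  have es : (2 * n) • Affine.Point.some x y h = .some _ _ h' + .some _ _ h' := by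
    rw [← e, ← two_zsmul, mul_smul]
  rw [Affine.Point.add_self_of_Y_ne hη'] at es
  refine ⟨_, hX ▸ Affine.nonsingular_add h' h' (fun hxy ↦ hη' hxy.2), ?_⟩
  rw [es]
  simp only [hX]

lemma mulXEq_of_pos (h : W.toAffine.Nonsingular x y) {n : ℤ} (hn : 1 ≤ n) : MulXEq h n := by
  suffices ∀ k : ℕ, ∀ n : ℤ, 1 ≤ n → n ≤ k → MulXEq h n from this n.toNat n hn (by lia)
  intro k
  induction k with
  | zero => intro n h1 h2; lia
  | succ k ih =>
    intro n h1 h2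
    obtain ⟨m, rfl | rfl⟩ := Int.even_or_odd' n
    · obtain rfl | hm : m = 1 ∨ 2 ≤ m := by lia
      · exact .two hψ h
      · exact mulXEq_even hψ hm (ih _ (by lia) (by lia)) (ih _ (by lia) (by lia))
          (ih _ (by lia) (by lia))
    · obtain rfl | rfl | hm : m = 0 ∨ m = 1 ∨ 2 ≤ m := by lia
      · exact .one h
      -- For `3P`, the Y-coordinate of `2P` comes from the duplication formula, as the general
      -- argument would be circular.
      · exact mulXEq_odd hψ le_rfl (.one h) (.two hψ h) (.one h) (.two hψ h)
      -- The Y-coordinates of `mP` and `(m + 1)P` use the X-coordinates up to index `m + 2`, which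
      -- is below `2m + 1` exactly because `2 ≤ m`.
      · have a := ih (m - 1) (by lia) (by lia)
        have b := ih m (by lia) (by lia)
        have c := ih (m + 1) (by lia) (by lia)
        have d := ih (m + 1 + 1) (by lia) (by lia)
        exact mulXEq_odd hψ (by lia) b c (mulYEq_of_mulXEq hψ (by lia) a c)
          (mulYEq_of_mulXEq hψ (by lia) (by rwa [add_sub_cancel_right]) d)

lemma mulYEq_of_pos (h : W.toAffine.Nonsingular x y) {n : ℤ} (hn : 1 ≤ n) : MulYEq h n := by
  obtain rfl | hn : n = 1 ∨ 2 ≤ n := by lia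
  · exact .one h
  · exact mulYEq_of_mulXEq hψ hn (mulXEq_of_pos hψ h (by lia)) (mulXEq_of_pos hψ h (by lia))

end Multiples

end GenericCurve

end

noncomputable section

namespace GenericCurve

open WeierstrassCurve

/-! ### Exact duplication and addition formulas in Jacobian coordinates -/

section Jacobian

open scoped Jacobian

/-- The value at `(x, y)` of the polynomial `Φ_n` of `W`. -/
def phiVal {R : Type*} [CommRing R] (W : WeierstrassCurve R) (x y : R) (n : ℤ) : R :=
  x * psiVal W x y n ^ 2 - psiVal W x y (n - 1) * psiVal W x y (n + 1)

lemma map_phiVal {R S : Type*} [CommRing R] [CommRing S] (f : R →+* S) (W : WeierstrassCurve R)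
    (x y : R) (n : ℤ) : phiVal (W.map f) (f x) (f y) n = f (phiVal W x y n) := by
  simp only [phiVal, map_psiVal, map_sub, map_mul, map_pow]

variable {F : Type*} [Field F] (W : WeierstrassCurve F) (x y : F)

/-- The value at `(x, y)` of the polynomial `Ω_n` of `W`. -/
def omegaVal (n : ℤ) : F :=
  if n = 0 then 1 else (psiVal W x y (2 * n) - psiVal W x y n ^ 2 *
    (W.a₁ * phiVal W x y n + W.a₃ * psiVal W x y n ^ 2)) / (2 * psiVal W x y n)

/-- The Jacobian coordinates `(Φ_n, Ω_n, Ψ_n)` at `(x, y)`. -/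
def jacVal (n : ℤ) : Fin 3 → F := ![phiVal W x y n, omegaVal W x y n, psiVal W x y n]

variable {W x y}

lemma phiVal_neg (n : ℤ) : phiVal W x y (-n) = phiVal W x y n := by
  rw [phiVal, phiVal, psiVal_neg, show -n - 1 = -(n + 1) by ring, psiVal_neg,
    show -n + 1 = -(n - 1) by ring, psiVal_neg]
  ring

lemma omegaVal_zero : omegaVal W x y 0 = 1 := if_pos rfl

lemma jacVal_zero : jacVal W x y 0 = ![1, 1, 0] := by
  simp [jacVal, phiVal, omegaVal_zero, psiVal_zero, psiVal_neg, psiVal_one]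

/-- `Ω_n` is defined so that the Z-coordinate of the duplication formula becomes `Ψ_{2n}`. -/
lemma dblZ_jacVal_eq (h2 : (2 : F) ≠ 0) {n : ℤ} (hψ : psiVal W x y n ≠ 0) (hn : n ≠ 0) :
    psiVal W x y n * (2 * omegaVal W x y n + W.a₁ * phiVal W x y n * psiVal W x y n +
      W.a₃ * psiVal W x y n ^ 3) = psiVal W x y (2 * n) := by
  rw [omegaVal, if_neg hn]
  field_simp
  ring

/-- The scaling unit acts on `Z` with weight one, so a common nonzero `Z` forces it to be `1`. -/
lemma Jacobian_eq_of_equiv {P Q : Fin 3 → F} (h : P ≈ Q) (hz : P 2 = Q 2) (h0 : Q 2 ≠ 0) :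
    P = Q := by
  obtain ⟨u, rfl⟩ := h
  have hz' : (u : F) * Q 2 = Q 2 := hz
  have : (u : F) = 1 := mul_right_cancel₀ h0 (by rw [hz', one_mul])
  rw [Units.val_eq_one] at this
  rw [this]
  exact one_smul _ _

variable [DecidableEq F] (hψ : ∀ n : ℤ, n ≠ 0 → psiVal W x y n ≠ 0) (h2 : (2 : F) ≠ 0)
include hψ h2

lemma zsmul_some_eq (h : W.toAffine.Nonsingular x y) {n : ℤ} (hn : 1 ≤ n) :
    ∃ h' : W.toAffine.Nonsingular (phiVal W x y n / psiVal W x y n ^ 2)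
      (omegaVal W x y n / psiVal W x y n ^ 3),
    n • Affine.Point.some x y h = .some _ _ h' := by
  obtain ⟨y', h', e⟩ := mulXEq_of_pos hψ h hn
  have hy := mulYEq_of_pos hψ h hn y' h' e
  have h0 := hψ n (by lia)
  have ex : mulX W x y n = phiVal W x y n / psiVal W x y n ^ 2 := by
    rw [mulX, phiVal]
    field_simp
  have ey : y' = omegaVal W x y n / psiVal W x y n ^ 3 := by
    rw [← dblZ_jacVal_eq h2 h0 (by lia), ex, sub_negY] at hy
    field_simp at hy ⊢
    apply mul_left_cancel₀ h2
    linear_combination hy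
  subst ey
  rw [ex] at h'
  refine ⟨h', ?_⟩
  rw [e]
  simp only [ex]

lemma zsmul_jacVal_of_pos (h : W.toAffine.Nonsingular x y) {n : ℤ} (hn : 1 ≤ n) :
    (n • Jacobian.Point.fromAffine (Affine.Point.some x y h)).point = ⟦jacVal W x y n⟧ := by
  obtain ⟨h', e⟩ := zsmul_some_eq hψ h2 h hn
  have : n • Jacobian.Point.fromAffine (Affine.Point.some x y h) =
      Jacobian.Point.fromAffine (n • Affine.Point.some x y h) :=
    (map_zsmul (Jacobian.Point.toAffineAddEquiv W.toJacobian).symm n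
      (Affine.Point.some x y h)).symm
  rw [this, e, Jacobian.Point.fromAffine_some]
  exact Quotient.sound (Setoid.symm (Jacobian.equiv_some_of_Z_ne_zero (P := jacVal W x y n)
    (hψ n (by lia))))

lemma equation_jacVal (h : W.toAffine.Nonsingular x y) {n : ℤ} (hn : 1 ≤ n) :
    W.toJacobian.Equation (jacVal W x y n) := by
  obtain ⟨h', e⟩ := zsmul_some_eq hψ h2 h hn
  exact (Jacobian.equation_of_Z_ne_zero (P := jacVal W x y n) (hψ n (by lia))).mpr h'.1

/-- Both vectors represent `2nP` and their Z-coordinates agree. An equality of vectors, unlike an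
equivalence, is a polynomial identity and can be specialized. -/
lemma dblXYZ_jacVal (h : W.toAffine.Nonsingular x y) {n : ℤ} (hn : 1 ≤ n) :
    W.toJacobian.dblXYZ (jacVal W x y n) = jacVal W x y (2 * n) := by
  have e := zsmul_jacVal_of_pos hψ h2 h hn
  have e2 := zsmul_jacVal_of_pos hψ h2 h (n := 2 * n) (by lia)
  rw [mul_smul, two_zsmul, Jacobian.Point.add_point, e, Jacobian.addMap_eq,
    Jacobian.add_self] at e2
  refine Jacobian_eq_of_equiv (Quotient.exact e2) ?_ (hψ (2 * n) (by lia))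
  refine Eq.trans ?_ (dblZ_jacVal_eq h2 (hψ n (by lia)) (by lia))
  simp only [Jacobian.dblXYZ, Jacobian.dblZ, Jacobian.negY, jacVal, Matrix.cons_val]
  ring

/-- The addition formula applies because `nP = (n + 1)P` would give `P = 0`. Its Z-coordinate is the
odd recursion for `Ψ_{2n+1}`, so the vectors agree exactly. -/
lemma addXYZ_jacVal (h : W.toAffine.Nonsingular x y) {n : ℤ} (hn : 1 ≤ n) :
    W.toJacobian.addXYZ (jacVal W x y n) (jacVal W x y (n + 1)) = jacVal W x y (2 * n + 1) := by
  have e := zsmul_jacVal_of_pos hψ h2 h hn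
  have e1 := zsmul_jacVal_of_pos hψ h2 h (n := n + 1) (by lia)
  have e2 := zsmul_jacVal_of_pos hψ h2 h (n := 2 * n + 1) (by lia)
  have hne : ¬ jacVal W x y n ≈ jacVal W x y (n + 1) := by
    intro H
    have H' := Quotient.sound H
    rw [← e, ← e1] at H'
    have := Jacobian.Point.ext H'
    rw [add_smul, one_smul, left_eq_add] at this
    exact Jacobian.Point.fromAffine_some_ne_zero _ this
  rw [show 2 * n + 1 = n + (n + 1) by ring, add_smul, Jacobian.Point.add_point, e, e1,
    Jacobian.addMap_eq, Jacobian.add_of_not_equiv hne] at e2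
  rw [show 2 * n + 1 = n + (n + 1) by ring]
  refine Jacobian_eq_of_equiv (Quotient.exact e2) ?_ (hψ _ (by lia))
  rw [show n + (n + 1) = 2 * n + 1 by ring]
  simp only [Jacobian.addXYZ, Jacobian.addZ, jacVal]
  simp [phiVal, psiVal_odd, show n + 1 + 1 = n + 2 by ring]
  ring

end Jacobian

end GenericCurve

end

noncomputable section

namespace GenericCurve

open WeierstrassCurve

/-! ### The invariant derivation and multiplication by `n` -/

section Derivation

variable {F : Type*} [Field F] {W : WeierstrassCurve F}

/-- The derivation `D` kills the coefficients of `W`. -/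
def KillsCoeffs (D : Derivation ℤ F F) (W : WeierstrassCurve F) : Prop :=
  D W.a₁ = 0 ∧ D W.a₂ = 0 ∧ D W.a₃ = 0 ∧ D W.a₄ = 0 ∧ D W.a₆ = 0

variable {D : Derivation ℤ F F} (hD : KillsCoeffs D W)
include hD

lemma deriv_equation {x y : F} (h : W.toAffine.Equation x y) :
    (2 * y + W.a₁ * x + W.a₃) * D y = (3 * x ^ 2 + 2 * W.a₂ * x + W.a₄ - W.a₁ * y) * D x := by
  obtain ⟨h1, h2, h3, h4, h6⟩ := hD
  rw [Affine.equation_iff] at h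
  have := congrArg D h
  simp only [map_add, Derivation.leibniz, Derivation.leibniz_pow, smul_eq_mul, h1, h2, h3, h4,
    h6, nsmul_eq_mul, Nat.cast_ofNat, Nat.reduceSub, pow_one] at this
  linear_combination this

lemma deriv_Y {x y c : F} (h : W.toAffine.Equation x y) (h0 : 2 * y + W.a₁ * x + W.a₃ ≠ 0)
    (hx : D x = c * (2 * y + W.a₁ * x + W.a₃)) :
    D y = c * (3 * x ^ 2 + 2 * W.a₂ * x + W.a₄ - W.a₁ * y) := by
  apply mul_left_cancel₀ h0
  rw [deriv_equation hD h, hx]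
  ring

/-- This is the additivity of the invariant differential: if `D` moves `P_i` with speed `c_i`
relative to the invariant vector field, then it moves `P₁ + P₂` with speed `c₁ + c₂`. -/
lemma deriv_addX {x₁ y₁ x₂ y₂ c₁ c₂ l : F} (h₁ : W.toAffine.Equation x₁ y₁)
    (h₂ : W.toAffine.Equation x₂ y₂) (hx : x₁ ≠ x₂) (hl : l * (x₁ - x₂) = y₁ - y₂)
    (hx₁ : D x₁ = c₁ * (2 * y₁ + W.a₁ * x₁ + W.a₃))
    (hy₁ : D y₁ = c₁ * (3 * x₁ ^ 2 + 2 * W.a₂ * x₁ + W.a₄ - W.a₁ * y₁))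
    (hx₂ : D x₂ = c₂ * (2 * y₂ + W.a₁ * x₂ + W.a₃))
    (hy₂ : D y₂ = c₂ * (3 * x₂ ^ 2 + 2 * W.a₂ * x₂ + W.a₄ - W.a₁ * y₂)) :
    D (W.toAffine.addX x₁ x₂ l) = (c₁ + c₂) * (2 * W.toAffine.addY x₁ x₂ y₁ l +
      W.a₁ * W.toAffine.addX x₁ x₂ l + W.a₃) := by
  obtain ⟨h1, h2, h3, h4, h6⟩ := hD
  have hl' := congrArg D hl
  simp only [map_sub, Derivation.leibniz, smul_eq_mul] at hl'
  have hd : x₁ - x₂ ≠ 0 := sub_ne_zero.mpr hx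
  rw [Affine.equation_iff] at h₁ h₂
  -- Restricted to the chord, the curve equation is a cubic whose roots are the three X-coordinates;
  -- its derivative at one root is the product of the differences with the other two. The same holds
  -- in `k₂`.
  have k₁ : 3 * x₁ ^ 2 + 2 * W.a₂ * x₁ + W.a₄ - W.a₁ * y₁ - l * (2 * y₁ + W.a₁ * x₁ + W.a₃) =
      -(x₁ - x₂) * (W.toAffine.addX x₁ x₂ l - x₁) := by
    apply mul_left_cancel₀ hd
    simp only [Affine.addX]
    linear_combination h₂ - h₁ + ((l * (x₁ - x₂) + y₁ - y₂) + W.a₁ * (x₁ - x₂)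
      - (2 * y₁ + W.a₁ * x₁ + W.a₃)) * hl
  have k₂ : 3 * x₂ ^ 2 + 2 * W.a₂ * x₂ + W.a₄ - W.a₁ * y₂ - l * (2 * y₂ + W.a₁ * x₂ + W.a₃) =
      (x₁ - x₂) * (W.toAffine.addX x₁ x₂ l - x₂) := by
    apply mul_left_cancel₀ hd
    simp only [Affine.addX]
    linear_combination h₂ - h₁ - ((l * (x₁ - x₂) + y₁ - y₂) + W.a₁ * (x₁ - x₂)
      + (2 * y₂ + W.a₁ * x₂ + W.a₃)) * hl
  have e : D (W.toAffine.addX x₁ x₂ l) = (2 * l + W.a₁) * D l - D x₁ - D x₂ := by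
    simp only [Affine.addX, map_add, map_sub, Derivation.leibniz, Derivation.leibniz_pow,
      smul_eq_mul, h1, h2]
    simp
    ring
  have e' : 2 * W.toAffine.addY x₁ x₂ y₁ l + W.a₁ * W.toAffine.addX x₁ x₂ l + W.a₃ =
      -(2 * l + W.a₁) * (W.toAffine.addX x₁ x₂ l - x₁) - (2 * y₁ + W.a₁ * x₁ + W.a₃) := by
    simp only [Affine.addY, Affine.negAddY, Affine.negY]
    ring
  rw [e, e']
  rw [hx₁, hx₂, hy₁, hy₂] at hl'
  rw [hx₁, hx₂]
  apply mul_left_cancel₀ hd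
  linear_combination (2 * l + W.a₁) * hl' + c₁ * (2 * l + W.a₁) * k₁ -
    c₂ * (2 * l + W.a₁) * k₂ - 2 * c₂ * (x₁ - x₂) * hl

/-- The tangent case of additivity. Differentiating the relation for the tangent slope gives `D l =
-2c(x(2P) - x)`, from which the rest follows. -/
lemma deriv_addX_self {x y c l : F} (h0 : 2 * y + W.a₁ * x + W.a₃ ≠ 0)
    (hl : l * (2 * y + W.a₁ * x + W.a₃) = 3 * x ^ 2 + 2 * W.a₂ * x + W.a₄ - W.a₁ * y)
    (hx : D x = c * (2 * y + W.a₁ * x + W.a₃))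
    (hy : D y = c * (3 * x ^ 2 + 2 * W.a₂ * x + W.a₄ - W.a₁ * y)) :
    D (W.toAffine.addX x x l) = 2 * c * (2 * W.toAffine.addY x x y l +
      W.a₁ * W.toAffine.addX x x l + W.a₃) := by
  obtain ⟨h1, h2, h3, h4, h6⟩ := hD
  have d2 : D (2 : F) = 0 := D.map_natCast 2
  have d3 : D (3 : F) = 0 := D.map_natCast 3
  have hl' := congrArg D hl
  simp only [map_add, map_sub, Derivation.leibniz, Derivation.leibniz_pow, smul_eq_mul, h1, h2,
    h3, h4, nsmul_eq_mul, Nat.cast_ofNat, Nat.reduceSub, pow_one, d2, d3] at hl'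
  have e : D (W.toAffine.addX x x l) = (2 * l + W.a₁) * D l - D x - D x := by
    simp only [Affine.addX, map_add, map_sub, Derivation.leibniz, Derivation.leibniz_pow,
      smul_eq_mul, h1, h2]
    simp
    ring
  have e' : 2 * W.toAffine.addY x x y l + W.a₁ * W.toAffine.addX x x l + W.a₃ =
      -(2 * l + W.a₁) * (W.toAffine.addX x x l - x) - (2 * y + W.a₁ * x + W.a₃) := by
    simp only [Affine.addY, Affine.negAddY, Affine.negY]
    ring
  have k : D l = -2 * c * (W.toAffine.addX x x l - x) := by
    apply mul_left_cancel₀ h0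
    rw [hx, hy] at hl'
    simp only [Affine.addX]
    linear_combination hl' + (2 * l * c + W.a₁ * c) * hl
  rw [e, e', k, hx]
  ring

variable [DecidableEq F] {x y : F} (hψ : ∀ n : ℤ, n ≠ 0 → psiVal W x y n ≠ 0)
  (hx : D x = 2 * y + W.a₁ * x + W.a₃)
include hψ hx

/-- The pullback of the invariant differential under `[n]` is `n` times itself; each addition of `P`
raises the speed by one. -/
lemma deriv_mulX (h : W.toAffine.Nonsingular x y) {n : ℤ} (hn : 1 ≤ n) (y' : F)
    (h' : W.toAffine.Nonsingular (mulX W x y n) y')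
    (e : n • Affine.Point.some x y h = .some (mulX W x y n) y' h') :
    D (mulX W x y n) = n * (2 * y' + W.a₁ * mulX W x y n + W.a₃) := by
  have hη := hψ 2 two_ne_zero
  rw [psiVal_two] at hη
  have hx' : D x = 1 * (2 * y + W.a₁ * x + W.a₃) := by rw [hx, one_mul]
  have hy := deriv_Y hD h.1 hη hx'
  induction n, hn using Int.leInduction generalizing y' with
  | base =>
    rw [one_smul] at e
    simp only [Affine.Point.some.injEq] at e
    rw [mulX_one, ← e.2, hx, Int.cast_one, one_mul]
  | succ n hn ih =>
    obtain rfl | hn2 : n = 1 ∨ 2 ≤ n := by lia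
    · rw [add_smul, one_smul, Affine.Point.add_self_of_Y_ne (ne_negY_self hψ)] at e
      simp only [Affine.Point.some.injEq] at e
      have hl : W.toAffine.slope x x y y * (2 * y + W.a₁ * x + W.a₃) =
          3 * x ^ 2 + 2 * W.a₂ * x + W.a₄ - W.a₁ * y := by
        rw [Affine.slope_of_Y_ne rfl (ne_negY_self hψ), sub_negY, div_mul_cancel₀ _ hη]
      rw [← e.1, ← e.2, deriv_addX_self hD hη hl hx' hy]
      norm_num
    · obtain ⟨y₀, h₀, e₀⟩ := mulXEq_of_pos hψ h hn
      have k := ih y₀ h₀ e₀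
      have kη := mulYEq_of_pos hψ h hn y₀ h₀ e₀
      rw [sub_negY] at kη
      have k' := deriv_Y hD h₀.1 (by
        rw [kη]; exact div_ne_zero (hψ _ (by lia)) (pow_ne_zero _ (hψ _ (by lia)))) k
      have hne := mulX_ne hψ hn2
      rw [add_smul, one_smul, e₀, Affine.Point.add_of_X_ne hne] at e
      simp only [Affine.Point.some.injEq] at e
      rw [← e.1, ← e.2]
      rw [deriv_addX hD h₀.1 h.1 hne (by
        rw [Affine.slope_of_X_ne hne, div_mul_cancel₀ _ (sub_ne_zero.mpr hne)]) k k' hx' hy]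
      push_cast
      ring

/-- Obtained by differentiating `Φ_n = x(nP)Ψ_n²`. At a zero of `Ψ_n` it reduces to `-2Φ_n DΨ_n =
2nΩ_n`, which will show that the zero is simple. -/
lemma deriv_psiVal (h2 : (2 : F) ≠ 0) (h : W.toAffine.Nonsingular x y) {n : ℤ} (hn : 1 ≤ n) :
    psiVal W x y n * D (phiVal W x y n) - 2 * phiVal W x y n * D (psiVal W x y n) =
      n * (2 * omegaVal W x y n + W.a₁ * phiVal W x y n * psiVal W x y n +
        W.a₃ * psiVal W x y n ^ 3) := by
  obtain ⟨h', e⟩ := zsmul_some_eq hψ h2 h hn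
  have h0 := hψ n (by lia)
  have ex : mulX W x y n = phiVal W x y n / psiVal W x y n ^ 2 := by
    rw [mulX, phiVal]
    field_simp
  have k := deriv_mulX hD hψ hx h hn _ (ex ▸ h') (by rw [e]; simp only [ex])
  have ex' : phiVal W x y n = mulX W x y n * psiVal W x y n ^ 2 := by
    rw [ex, div_mul_cancel₀ _ (pow_ne_zero 2 h0)]
  have k2 := congrArg D ex'
  simp only [Derivation.leibniz, Derivation.leibniz_pow, smul_eq_mul, nsmul_eq_mul,
    Nat.cast_ofNat, Nat.reduceSub, pow_one] at k2
  rw [k2, k]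
  rw [ex]
  field_simp
  ring

end Derivation

end GenericCurve

end

noncomputable section

namespace GenericCurve

open WeierstrassCurve

/-! ### The generic point in the affine coordinate ring -/

section CoordinateRing

variable {R : Type*} [CommRing R] (W : WeierstrassCurve R)

/-- The coordinate function `X` in the affine coordinate ring. -/
def coordX : W.toAffine.CoordinateRing :=
  Affine.CoordinateRing.mk W.toAffine (Polynomial.C Polynomial.X)

/-- The coordinate function `Y` in the affine coordinate ring. -/
def coordY : W.toAffine.CoordinateRing := Affine.CoordinateRing.mk W.toAffine Polynomial.X

/-- The base change of a Weierstrass curve to its affine coordinate ring. -/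
def coordCurve : WeierstrassCurve W.toAffine.CoordinateRing :=
  W.map (algebraMap R W.toAffine.CoordinateRing)

lemma mk_C_C (r : R) : Affine.CoordinateRing.mk W.toAffine (Polynomial.C (Polynomial.C r)) =
    algebraMap R W.toAffine.CoordinateRing r := rfl

lemma mk_C_eq_eval (p : Polynomial R) : Affine.CoordinateRing.mk W.toAffine (Polynomial.C p) =
    Polynomial.eval₂ (algebraMap R W.toAffine.CoordinateRing) (coordX W) p := by
  have : (Affine.CoordinateRing.mk W.toAffine).comp Polynomial.C =
      Polynomial.eval₂RingHom (algebraMap R W.toAffine.CoordinateRing) (coordX W) := by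
    ext
    · simp [← mk_C_C]
    · simp [coordX]
  exact congrArg (fun f ↦ f p) this

lemma equation_coord : (coordCurve W).toAffine.Equation (coordX W) (coordY W) := by
  rw [Affine.equation_iff', coordCurve]
  have e : W.toAffine.polynomial = Polynomial.X ^ 2 + Polynomial.C (Polynomial.C W.a₁ *
      Polynomial.X + Polynomial.C W.a₃) * Polynomial.X - Polynomial.C (Polynomial.X ^ 3 +
      Polynomial.C W.a₂ * Polynomial.X ^ 2 + Polynomial.C W.a₄ * Polynomial.X +
      Polynomial.C W.a₆) := by rw [Affine.polynomial]
  have := (congrArg (Affine.CoordinateRing.mk W.toAffine) e).symm.trans AdjoinRoot.mk_self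
  simp only [map_add, map_sub, map_mul, map_pow, mk_C_C] at this
  simp only [map_a₁, map_a₂, map_a₃, map_a₄, map_a₆, coordX, coordY]
  linear_combination this

lemma psiVal_coord (n : ℤ) : psiVal (coordCurve W) (coordX W) (coordY W) n =
    Affine.CoordinateRing.mk W.toAffine (W.ψ n) := by
  rw [WeierstrassCurve.ψ, map_normEDS, mk_C_eq_eval, mk_C_eq_eval, psiVal, coordCurve, map_Ψ₃,
    map_preΨ₄, Polynomial.eval_map, Polynomial.eval_map]
  congr 1
  rw [ψ₂, Affine.polynomialY]
  simp only [map_add, map_mul, mk_C_C, map_a₁, map_a₃, coordX, coordY, map_ofNat]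
  ring

lemma phiVal_coord (n : ℤ) : phiVal (coordCurve W) (coordX W) (coordY W) n =
    Affine.CoordinateRing.mk W.toAffine (W.φ n) := by
  rw [phiVal, WeierstrassCurve.φ]
  simp only [psiVal_coord, map_sub, map_mul, map_pow]
  rw [coordX, mul_comm (Affine.CoordinateRing.mk W.toAffine (W.ψ (n - 1)))]

omit W in
lemma coordRing_induction {W : WeierstrassCurve R} {P : W.toAffine.CoordinateRing → Prop}
    (hC : ∀ c : R, P (algebraMap R W.toAffine.CoordinateRing c))
    (hX : P (coordX W)) (hY : P (coordY W)) (hadd : ∀ a b, P a → P b → P (a + b))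
    (hmul : ∀ a b, P a → P b → P (a * b)) (a : W.toAffine.CoordinateRing) : P a := by
  obtain ⟨p, rfl⟩ := AdjoinRoot.mk_surjective a
  have hCX (q : Polynomial R) : P (Affine.CoordinateRing.mk W.toAffine (Polynomial.C q)) := by
    induction q using Polynomial.induction_on' with
    | add p q hp hq => rw [Polynomial.C_add, map_add]; exact hadd _ _ hp hq
    | monomial n c =>
      induction n with
      | zero => exact hC c
      | succ n ih =>
        rw [← Polynomial.monomial_mul_X, Polynomial.C_mul, map_mul]
        exact hmul _ _ ih hX
  change P (Affine.CoordinateRing.mk W.toAffine p)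
  induction p using Polynomial.induction_on' with
  | add p q hp hq => rw [map_add]; exact hadd _ _ hp hq
  | monomial n c =>
    induction n with
    | zero => exact hCX c
    | succ n ih =>
      rw [← Polynomial.monomial_mul_X, map_mul]
      exact hmul _ _ ih hY

end CoordinateRing

/-! ### Pole orders at infinity, as degrees of norms -/

section PoleOrder

variable {F : Type*} [Field F] {W : WeierstrassCurve F}

/-- The order of the pole at infinity of an element of the affine coordinate ring. -/
def poleOrder (a : W.toAffine.CoordinateRing) : WithBot ℕ :=
  (Algebra.norm (Polynomial F) a).degree

lemma poleOrder_mul (a b : W.toAffine.CoordinateRing) :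
    poleOrder (a * b) = poleOrder a + poleOrder b := by
  rw [poleOrder, map_mul, Polynomial.degree_mul, poleOrder, poleOrder]

/-- The two parts of `p + qY` have pole orders of different parity, so their leading terms cannot
cancel. -/
lemma poleOrder_smul_basis (p q : Polynomial F) :
    poleOrder (p • (1 : W.toAffine.CoordinateRing) + q • coordY W) =
      max (2 • p.degree) (2 • q.degree + 3) :=
  Affine.CoordinateRing.degree_norm_smul_basis p q

lemma poleOrder_mk_C (p : Polynomial F) :
    poleOrder (Affine.CoordinateRing.mk W.toAffine (Polynomial.C p)) = 2 • p.degree := by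
  have := poleOrder_smul_basis (W := W) p 0
  simpa [Affine.CoordinateRing.smul] using this

lemma poleOrder_coordX : poleOrder (coordX W) = 2 := by
  rw [coordX, poleOrder_mk_C]; simp

lemma poleOrder_coordY : poleOrder (coordY W) = 3 := by
  simpa using poleOrder_smul_basis (W := W) 0 1

lemma poleOrder_algebraMap {c : F} (hc : c ≠ 0) :
    poleOrder (algebraMap F W.toAffine.CoordinateRing c) = 0 := by
  rw [← mk_C_C, poleOrder_mk_C, Polynomial.degree_C hc]
  rfl

lemma poleOrder_eq_bot {a : W.toAffine.CoordinateRing} : poleOrder a = ⊥ ↔ a = 0 := by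
  rw [poleOrder, Polynomial.degree_eq_bot]
  constructor
  · intro h
    by_contra ha
    obtain ⟨p, q, rfl⟩ := Affine.CoordinateRing.exists_smul_basis_eq a
    have := poleOrder_smul_basis (W := W) p q
    rw [poleOrder, coordY, h, Polynomial.degree_zero] at this
    have h1 := max_eq_bot.mp this.symm
    have hp : p = 0 := by
      by_contra hp
      rw [Polynomial.degree_eq_natDegree hp] at h1
      exact absurd h1.1 (by rw [two_smul]; exact WithBot.coe_ne_bot)
    have hq : q = 0 := by
      by_contra hq
      rw [Polynomial.degree_eq_natDegree hq] at h1
      exact absurd h1.2 (by rw [two_smul]; exact WithBot.coe_ne_bot)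
    exact ha (by rw [hp, hq]; simp)
  · rintro rfl
    have := poleOrder_mk_C (W := W) 0
    simp only [map_zero, Polynomial.degree_zero] at this
    rw [← Polynomial.degree_eq_bot]
    exact this

lemma poleOrder_add_le (a b : W.toAffine.CoordinateRing) :
    poleOrder (a + b) ≤ max (poleOrder a) (poleOrder b) := by
  obtain ⟨p, q, rfl⟩ := Affine.CoordinateRing.exists_smul_basis_eq a
  obtain ⟨p', q', rfl⟩ := Affine.CoordinateRing.exists_smul_basis_eq b
  have e : p • (1 : W.toAffine.CoordinateRing) +
      q • Affine.CoordinateRing.mk W.toAffine Polynomial.X +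
      (p' • 1 + q' • Affine.CoordinateRing.mk W.toAffine Polynomial.X) =
      (p + p') • 1 + (q + q') • coordY W := by
    rw [add_smul, add_smul, coordY]; abel
  rw [e, poleOrder_smul_basis]
  have h1 := poleOrder_smul_basis (W := W) p q
  have h2 := poleOrder_smul_basis (W := W) p' q'
  rw [coordY] at h1 h2
  rw [h1, h2]
  have hp : 2 • (p + p').degree ≤ max (2 • p.degree) (2 • p'.degree) := by
    rcases le_total p.degree p'.degree with h | h
    · exact le_max_of_le_right (nsmul_le_nsmul_right ((Polynomial.degree_add_le _ _).trans
        (max_le h le_rfl)) 2)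
    · exact le_max_of_le_left (nsmul_le_nsmul_right ((Polynomial.degree_add_le _ _).trans
        (max_le le_rfl h)) 2)
  have hq : 2 • (q + q').degree + 3 ≤ max (2 • q.degree + 3) (2 • q'.degree + 3) := by
    rcases le_total q.degree q'.degree with h | h
    · exact le_max_of_le_right (add_le_add_left (nsmul_le_nsmul_right
        ((Polynomial.degree_add_le _ _).trans (max_le h le_rfl)) 2) 3)
    · exact le_max_of_le_left (add_le_add_left (nsmul_le_nsmul_right
        ((Polynomial.degree_add_le _ _).trans (max_le le_rfl h)) 2) 3)
  refine max_le (hp.trans (max_le ?_ ?_)) (hq.trans (max_le ?_ ?_))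
  · exact le_max_of_le_left (le_max_left _ _)
  · exact le_max_of_le_right (le_max_left _ _)
  · exact le_max_of_le_left (le_max_right _ _)
  · exact le_max_of_le_right (le_max_right _ _)

lemma poleOrder_neg (a : W.toAffine.CoordinateRing) : poleOrder (-a) = poleOrder a := by
  have := poleOrder_mul (algebraMap F W.toAffine.CoordinateRing (-1)) a
  rw [poleOrder_algebraMap (neg_ne_zero.mpr one_ne_zero), zero_add] at this
  simpa using this

lemma poleOrder_add_eq {a b : W.toAffine.CoordinateRing} (h : poleOrder b < poleOrder a) :
    poleOrder (a + b) = poleOrder a := by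
  refine le_antisymm ((poleOrder_add_le a b).trans (max_le le_rfl h.le)) ?_
  have := poleOrder_add_le (a + b) (-b)
  rw [add_neg_cancel_right, poleOrder_neg] at this
  rcases le_max_iff.mp this with h' | h'
  · exact h'
  · exact absurd h' (not_le.mpr h)

lemma poleOrder_sum_lt {ι : Type*} (s : Finset ι) (f : ι → W.toAffine.CoordinateRing)
    {m : WithBot ℕ} (hm : m ≠ ⊥) (h : ∀ i ∈ s, poleOrder (f i) < m) :
    poleOrder (∑ i ∈ s, f i) < m := by
  classical
  induction s using Finset.induction with
  | empty => rw [Finset.sum_empty, poleOrder_eq_bot.mpr rfl]; exact bot_lt_iff_ne_bot.mpr hm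
  | insert a s ha ih =>
    rw [Finset.sum_insert ha]
    exact (poleOrder_add_le _ _).trans_lt (max_lt (h a (Finset.mem_insert_self a s))
      (ih fun i hi ↦ h i (Finset.mem_insert_of_mem hi)))

/-- A term of strictly larger pole order than all the others dominates a sum. -/
lemma poleOrder_sum_eq {ι : Type*} {s : Finset ι} (f : ι → W.toAffine.CoordinateRing) {j : ι}
    (hj : j ∈ s) (h0 : f j ≠ 0) (h : ∀ i ∈ s, i ≠ j → poleOrder (f i) < poleOrder (f j)) :
    poleOrder (∑ i ∈ s, f i) = poleOrder (f j) := by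
  classical
  rw [← Finset.add_sum_erase s f hj]
  exact poleOrder_add_eq (poleOrder_sum_lt _ _ (mt poleOrder_eq_bot.mp h0) fun i hi ↦
    h i (Finset.mem_of_mem_erase hi) (Finset.ne_of_mem_erase hi))

lemma poleOrder_pow (a : W.toAffine.CoordinateRing) (k : ℕ) :
    poleOrder (a ^ k) = k • poleOrder a := by
  rw [poleOrder, map_pow, Polynomial.degree_pow, poleOrder]

lemma poleOrder_monomial {c : F} (hc : c ≠ 0) (i j : ℕ) :
    poleOrder (algebraMap F W.toAffine.CoordinateRing c * (coordX W ^ i * coordY W ^ j)) =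
      ((2 * i + 3 * j : ℕ) : WithBot ℕ) := by
  rw [poleOrder_mul, poleOrder_algebraMap hc, zero_add, poleOrder_mul, poleOrder_pow,
    poleOrder_pow, poleOrder_coordX, poleOrder_coordY, nsmul_eq_mul, nsmul_eq_mul]
  push_cast
  ring

variable [CharZero F]

/-- The square `Ψ_n²` is a polynomial in `X` of degree `n² - 1` (characteristic zero keeps its
leading coefficient `n²` nonzero), hence has pole order `2(n² - 1)`; halving gives the claim. -/
lemma poleOrder_psi {n : ℤ} (hn : n ≠ 0) :
    poleOrder (Affine.CoordinateRing.mk W.toAffine (W.ψ n)) =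
      ((n.natAbs ^ 2 - 1 : ℕ) : WithBot ℕ) := by
  have h : poleOrder (Affine.CoordinateRing.mk W.toAffine (W.ψ n) ^ 2) =
      2 • ((n.natAbs ^ 2 - 1 : ℕ) : WithBot ℕ) := by
    rw [Affine.CoordinateRing.mk_ψ, Affine.CoordinateRing.mk_Ψ_sq, poleOrder_mk_C,
      Polynomial.degree_eq_natDegree (W.ΨSq_ne_zero (Int.cast_ne_zero.mpr hn)),
      W.natDegree_ΨSq (Int.cast_ne_zero.mpr hn)]
  rw [poleOrder_pow] at h
  have h0 : poleOrder (Affine.CoordinateRing.mk W.toAffine (W.ψ n)) ≠ ⊥ := by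
    intro h'
    rw [h', two_smul, two_smul, ← Nat.cast_add] at h
    exact absurd h (WithBot.coe_ne_bot).symm
  obtain ⟨d, hd⟩ := WithBot.ne_bot_iff_exists.mp h0
  rw [← hd, two_smul, two_smul] at h
  rw [← hd]
  have h' : d + d = (n.natAbs ^ 2 - 1) + (n.natAbs ^ 2 - 1) := by
    apply Nat.cast_injective (R := WithBot ℕ)
    rw [Nat.cast_add, Nat.cast_add]
    exact h
  have : d = n.natAbs ^ 2 - 1 := by lia
  rw [this]
  rfl

lemma psi_ne_zero {n : ℤ} (hn : n ≠ 0) : Affine.CoordinateRing.mk W.toAffine (W.ψ n) ≠ 0 := by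
  intro h
  have := poleOrder_psi (W := W) hn
  rw [h, poleOrder_eq_bot.mpr rfl] at this
  exact absurd this.symm WithBot.coe_ne_bot

omit [CharZero F] in
lemma poleOrder_phi (n : ℤ) : poleOrder (Affine.CoordinateRing.mk W.toAffine (W.φ n)) =
    ((2 * n.natAbs ^ 2 : ℕ) : WithBot ℕ) := by
  rw [Affine.CoordinateRing.mk_φ, poleOrder_mk_C, Polynomial.degree_eq_natDegree (W.Φ_ne_zero n),
    W.natDegree_Φ n, two_smul, two_mul]
  rfl

end PoleOrder

end GenericCurve

end

noncomputable section

namespace GenericCurve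

open WeierstrassCurve

/-! ### The coordinate ring of the universal curve -/

/-- The coordinate ring of the universal curve. -/
abbrev UnivRing : Type := universalCurve.toAffine.CoordinateRing

/-- The polynomial ring `ℤ[a₁, a₂, a₃, a₄, X, Y]`. -/
abbrev FreeRing : Type := MvPolynomial (Fin 6) ℤ

/-- The values of `a₁, a₂, a₃, a₄, a₆` in `ℤ[a₁, a₂, a₃, a₄, X, Y]`, where `a₆` is determined by
the Weierstrass equation. -/
def coeffToFree : CoeffRing →+* FreeRing :=
  MvPolynomial.eval₂Hom (Int.castRingHom FreeRing)
    ![.X 0, .X 1, .X 2, .X 3, .X 5 ^ 2 + .X 0 * .X 4 * .X 5 + .X 2 * .X 5 -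
      (.X 4 ^ 3 + .X 1 * .X 4 ^ 2 + .X 3 * .X 4)]

lemma coeffToFree_X (i : Fin 5) : coeffToFree (.X i) =
    (![.X 0, .X 1, .X 2, .X 3, .X 5 ^ 2 + .X 0 * .X 4 * .X 5 + .X 2 * .X 5 -
      (.X 4 ^ 3 + .X 1 * .X 4 ^ 2 + .X 3 * .X 4)] : Fin 5 → FreeRing) i := by
  simp [coeffToFree]

/-- Elimination of `a₆` from the coordinate ring of the universal curve. -/
def univToFree : UnivRing →+* FreeRing :=
  AdjoinRoot.lift (Polynomial.eval₂RingHom coeffToFree (.X 4)) (.X 5) (by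
    rw [Affine.polynomial]
    simp only [universalCurve, Polynomial.eval₂_add, Polynomial.eval₂_sub, Polynomial.eval₂_mul,
      Polynomial.eval₂_pow, Polynomial.eval₂_X, Polynomial.eval₂_C, Polynomial.coe_eval₂RingHom,
      coeffToFree_X, Matrix.cons_val]
    ring)

/-- The inclusion of `ℤ[a₁, a₂, a₃, a₄, X, Y]` into the coordinate ring of the universal curve. -/
def freeToUniv : FreeRing →+* UnivRing :=
  MvPolynomial.eval₂Hom (Int.castRingHom UnivRing)
    ![algebraMap CoeffRing UnivRing (.X 0), algebraMap CoeffRing UnivRing (.X 1),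
      algebraMap CoeffRing UnivRing (.X 2), algebraMap CoeffRing UnivRing (.X 3),
      coordX universalCurve, coordY universalCurve]

lemma univToFree_algebraMap (r : CoeffRing) :
    univToFree (algebraMap CoeffRing UnivRing r) = coeffToFree r := by
  rw [← mk_C_C, univToFree, AdjoinRoot.lift_mk]
  simp

lemma univToFree_coordX : univToFree (coordX universalCurve) = .X 4 := by
  rw [coordX, univToFree, AdjoinRoot.lift_mk]
  simp

lemma univToFree_coordY : univToFree (coordY universalCurve) = .X 5 := by
  rw [coordY, univToFree, AdjoinRoot.lift_mk]
  simp

lemma univToFree_comp_freeToUniv : univToFree.comp freeToUniv = RingHom.id FreeRing := by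
  apply MvPolynomial.ringHom_ext
  · intro r; simp
  · intro i
    fin_cases i <;> simp [freeToUniv, univToFree_algebraMap, univToFree_coordX,
      univToFree_coordY, coeffToFree_X]

lemma freeToUniv_coeffToFree : freeToUniv.comp coeffToFree = algebraMap CoeffRing UnivRing := by
  apply MvPolynomial.ringHom_ext
  · intro r; simp
  · intro i
    have h := (Affine.equation_iff _ _).mp (equation_coord universalCurve)
    rw [show (coordCurve universalCurve).a₁ = algebraMap CoeffRing UnivRing (.X 0) from rfl,
      show (coordCurve universalCurve).a₂ = algebraMap CoeffRing UnivRing (.X 1) from rfl,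
      show (coordCurve universalCurve).a₃ = algebraMap CoeffRing UnivRing (.X 2) from rfl,
      show (coordCurve universalCurve).a₄ = algebraMap CoeffRing UnivRing (.X 3) from rfl,
      show (coordCurve universalCurve).a₆ = algebraMap CoeffRing UnivRing (.X 4) from rfl] at h
    rw [RingHom.comp_apply, coeffToFree_X]
    fin_cases i <;> simp [freeToUniv]
    linear_combination h

lemma freeToUniv_comp_univToFree : freeToUniv.comp univToFree = RingHom.id UnivRing := by
  apply RingHom.cancel_right (AdjoinRoot.mk_surjective (g := universalCurve.toAffine.polynomial))
    |>.mp
  apply Polynomial.ringHom_ext'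
  · apply Polynomial.ringHom_ext
    · intro r
      have := congrArg (fun f ↦ f r) freeToUniv_coeffToFree
      change freeToUniv (univToFree (algebraMap CoeffRing UnivRing r)) =
        algebraMap CoeffRing UnivRing r
      rw [univToFree_algebraMap]
      exact this
    · change freeToUniv (univToFree (coordX universalCurve)) = coordX universalCurve
      rw [univToFree_coordX]
      simp [freeToUniv]
  · change freeToUniv (univToFree (coordY universalCurve)) = coordY universalCurve
    rw [univToFree_coordY]
    simp [freeToUniv]

/-- Eliminating `a₆` turns the ring into a polynomial ring over `ℤ`, which is factorial. This will
allow the denominator of `Ω_n` to be removed. -/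
instance : IsIntegrallyClosed UnivRing :=
  IsIntegrallyClosed.of_equiv (RingEquiv.ofRingHom freeToUniv univToFree
    freeToUniv_comp_univToFree univToFree_comp_freeToUniv)

/-- The fraction `a / d` is a root of `T² + bT + c`, hence integral. -/
lemma dvd_of_monic_quadratic {S : Type*} [CommRing S] [IsDomain S] [IsIntegrallyClosed S]
    {a d b c : S} (hd : d ≠ 0) (h : a ^ 2 + b * d * a + c * d ^ 2 = 0) : d ∣ a := by
  let L := FractionRing S
  have hd' : algebraMap S L d ≠ 0 :=
    (map_ne_zero_iff _ (IsFractionRing.injective S L)).mpr hd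
  have hint : IsIntegral S (algebraMap S L a / algebraMap S L d) := by
    refine ⟨Polynomial.X ^ 2 + Polynomial.C b * Polynomial.X + Polynomial.C c, ?_, ?_⟩
    · rw [add_assoc]
      apply Polynomial.monic_X_pow_add
      compute_degree!
    · simp only [Polynomial.eval₂_add, Polynomial.eval₂_mul, Polynomial.eval₂_pow,
        Polynomial.eval₂_X, Polynomial.eval₂_C]
      have := congrArg (algebraMap S L) h
      simp only [map_add, map_mul, map_pow, map_zero] at this
      have hz := div_mul_cancel₀ (algebraMap S L a) hd'
      set z := algebraMap S L a / algebraMap S L d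
      rw [← hz] at this
      refine (mul_eq_zero.mp ?_).resolve_right (pow_ne_zero 2 hd')
      linear_combination this
  obtain ⟨s, hs⟩ := IsIntegrallyClosed.isIntegral_iff.mp hint
  rw [eq_div_iff hd', ← map_mul] at hs
  exact ⟨s, by rw [mul_comm]; exact (IsFractionRing.injective S L hs).symm⟩

/-! ### The generic point -/

section Map

variable {R S : Type*} [CommRing R] [CommRing S] (W : WeierstrassCurve R) (f : R →+* S)

lemma map_algebraMap (r : R) :
    Affine.CoordinateRing.map W f (algebraMap R W.toAffine.CoordinateRing r) =
      algebraMap S (W.map f).toAffine.CoordinateRing (f r) := by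
  rw [← mk_C_C, ← mk_C_C, Affine.CoordinateRing.map_mk]
  simp

lemma map_coordX : Affine.CoordinateRing.map W f (coordX W) = coordX (W.map f) := by
  rw [coordX, coordX, Affine.CoordinateRing.map_mk]
  simp

lemma map_coordY : Affine.CoordinateRing.map W f (coordY W) = coordY (W.map f) := by
  rw [coordY, coordY, Affine.CoordinateRing.map_mk]
  simp

lemma map_coordCurve :
    (coordCurve W).map (Affine.CoordinateRing.map W f) = coordCurve (W.map f) := by
  rw [coordCurve, coordCurve, map_map, map_map]
  exact congrArg W.map (RingHom.ext (map_algebraMap W f))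

end Map

/-- The map from the coordinate ring of the universal curve to that of the generic curve. -/
def toCoord : UnivRing →+* E.toAffine.CoordinateRing :=
  Affine.CoordinateRing.map universalCurve coeffHom

/-- The inclusion of the coordinate ring in the function field. -/
abbrev coordToFun : E.toAffine.CoordinateRing →+* FunField :=
  algebraMap E.toAffine.CoordinateRing FunField

lemma coordToFun_injective : Function.Injective coordToFun :=
  IsFractionRing.injective E.toAffine.CoordinateRing FunField

lemma toCoord_injective : Function.Injective toCoord :=
  Affine.CoordinateRing.map_injective coeffHom_injective

lemma toCoord_algebraMap (r : CoeffRing) : toCoord (algebraMap CoeffRing UnivRing r) =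
    algebraMap K E.toAffine.CoordinateRing (coeffHom r) :=
  map_algebraMap universalCurve coeffHom r

lemma toCoord_coordX : toCoord (coordX universalCurve) = coordX E :=
  map_coordX universalCurve coeffHom

lemma toCoord_coordY : toCoord (coordY universalCurve) = coordY E :=
  map_coordY universalCurve coeffHom

lemma map_toCoord : (coordCurve universalCurve).map toCoord = coordCurve E :=
  map_coordCurve universalCurve coeffHom

/-- The generic curve over its function field. -/
abbrev funCurve : WeierstrassCurve FunField := E.map const

lemma map_coordToFun : (coordCurve E).map coordToFun = funCurve := by
  rw [coordCurve, map_map]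
  rfl

/-- The inclusion of the coordinate ring of the universal curve in the function field. -/
def univToFun : UnivRing →+* FunField := coordToFun.comp toCoord

lemma univToFun_injective : Function.Injective univToFun := by
  rw [univToFun, RingHom.coe_comp]
  exact coordToFun_injective.comp toCoord_injective

lemma map_univToFun : (coordCurve universalCurve).map univToFun = funCurve := by
  rw [univToFun, ← map_map, map_toCoord, map_coordToFun]

lemma univToFun_coordX : univToFun (coordX universalCurve) = funX := by
  rw [univToFun, RingHom.comp_apply, toCoord_coordX, coordX, funX]

lemma univToFun_coordY : univToFun (coordY universalCurve) = funY := by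
  rw [univToFun, RingHom.comp_apply, toCoord_coordY, coordY, funY]

/-- The value of `Ψ_n` at the generic point. -/
abbrev psiF (n : ℤ) : FunField := psiVal funCurve funX funY n

/-- The value of `Φ_n` at the generic point. -/
abbrev phiF (n : ℤ) : FunField := phiVal funCurve funX funY n

/-- The value of `Ω_n` at the generic point. -/
abbrev omegaF (n : ℤ) : FunField := omegaVal funCurve funX funY n

/-- `Ψ_n` in the coordinate ring of the universal curve. -/
abbrev psiU (n : ℤ) : UnivRing :=
  psiVal (coordCurve universalCurve) (coordX universalCurve) (coordY universalCurve) n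

/-- `Φ_n` in the coordinate ring of the universal curve. -/
abbrev phiU (n : ℤ) : UnivRing :=
  phiVal (coordCurve universalCurve) (coordX universalCurve) (coordY universalCurve) n

lemma univToFun_psiU (n : ℤ) : univToFun (psiU n) = psiF n := by
  rw [psiU, ← map_psiVal, map_univToFun, univToFun_coordX, univToFun_coordY]

lemma univToFun_phiU (n : ℤ) : univToFun (phiU n) = phiF n := by
  rw [phiU, ← map_phiVal, map_univToFun, univToFun_coordX, univToFun_coordY]

lemma toCoord_psiU (n : ℤ) :
    toCoord (psiU n) = Affine.CoordinateRing.mk E.toAffine (E.ψ n) := by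
  rw [psiU, ← map_psiVal, map_toCoord, toCoord_coordX, toCoord_coordY, psiVal_coord]

lemma toCoord_phiU (n : ℤ) :
    toCoord (phiU n) = Affine.CoordinateRing.mk E.toAffine (E.φ n) := by
  rw [phiU, ← map_phiVal, map_toCoord, toCoord_coordX, toCoord_coordY, phiVal_coord]

instance : CharZero K := charZero_of_injective_algebraMap coeffHom_injective

instance : CharZero FunField := charZero_of_injective_ringHom const.injective

lemma psiU_ne_zero {n : ℤ} (hn : n ≠ 0) : psiU n ≠ 0 := by
  intro h
  have := toCoord_psiU n
  rw [h, map_zero] at this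
  exact psi_ne_zero hn this.symm

lemma psiF_ne_zero (n : ℤ) (hn : n ≠ 0) : psiF n ≠ 0 := by
  rw [← univToFun_psiU]
  exact (map_ne_zero_iff _ univToFun_injective).mpr (psiU_ne_zero hn)

lemma nonsingular_generic : funCurve.toAffine.Nonsingular funX funY := by
  apply (Affine.equation_iff_nonsingular_of_Δ_ne_zero ?_).mp
  · rw [← map_coordToFun]
    exact (equation_coord E).map coordToFun
  · change funCurve.Δ ≠ 0
    rw [map_Δ]
    exact (map_ne_zero_iff _ const.injective).mpr E_Δ_ne_zero

-- In Jacobian form the curve equation is a monic quadratic in `Ω_n` whose coefficients are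
-- polynomials in `Φ_n`, `Ψ_n` and the `a_i`. Multiplied by the square of the denominator `2Ψ_n`, it
-- has the shape required by `dvd_of_monic_quadratic`.
open scoped Classical in
lemma exists_omegaU_of_pos {n : ℤ} (hn : 1 ≤ n) : ∃ w : UnivRing, univToFun w = omegaF n := by
  have hψ := psiF_ne_zero n (by lia)
  have h := equation_jacVal psiF_ne_zero two_ne_zero nonsingular_generic hn
  rw [Jacobian.equation_iff] at h
  simp only [jacVal, Matrix.cons_val] at h
  set a := psiU (2 * n) - psiU n ^ 2 * ((coordCurve universalCurve).a₁ * phiU n +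
    (coordCurve universalCurve).a₃ * psiU n ^ 2) with ha
  have hd : 2 * psiU n ≠ 0 := mul_ne_zero
    (by intro h2; exact two_ne_zero (α := FunField) (by rw [← map_ofNat univToFun 2, h2, map_zero]))
    (psiU_ne_zero (by lia))
  have e₁ : univToFun (coordCurve universalCurve).a₁ = funCurve.a₁ := by
    rw [← map_univToFun, map_a₁]
  have e₂ : univToFun (coordCurve universalCurve).a₂ = funCurve.a₂ := by
    rw [← map_univToFun, map_a₂]
  have e₃ : univToFun (coordCurve universalCurve).a₃ = funCurve.a₃ := by
    rw [← map_univToFun, map_a₃]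
  have e₄ : univToFun (coordCurve universalCurve).a₄ = funCurve.a₄ := by
    rw [← map_univToFun, map_a₄]
  have e₆ : univToFun (coordCurve universalCurve).a₆ = funCurve.a₆ := by
    rw [← map_univToFun, map_a₆]
  have hw : univToFun a = omegaF n * univToFun (2 * psiU n) := by
    rw [ha, omegaF, omegaVal, if_neg (by lia)]
    simp only [map_sub, map_mul, map_add, map_pow, univToFun_psiU, univToFun_phiU, e₁, e₃,
      map_ofNat]
    field_simp
  have hdvd : 2 * psiU n ∣ a := by
    apply dvd_of_monic_quadratic hd
      (b := (coordCurve universalCurve).a₁ * phiU n * psiU n +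
        (coordCurve universalCurve).a₃ * psiU n ^ 3)
      (c := -(phiU n ^ 3 + (coordCurve universalCurve).a₂ * phiU n ^ 2 * psiU n ^ 2 +
        (coordCurve universalCurve).a₄ * phiU n * psiU n ^ 4 +
        (coordCurve universalCurve).a₆ * psiU n ^ 6))
    apply univToFun_injective
    simp only [map_add, map_mul, map_pow, map_neg, map_zero, hw, e₁, e₂, e₃, e₄, e₆,
      univToFun_psiU, univToFun_phiU, map_ofNat]
    linear_combination (2 * psiF n) ^ 2 * h
  obtain ⟨w, hw'⟩ := hdvd
  refine ⟨w, ?_⟩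
  rw [hw', map_mul, mul_comm] at hw
  exact mul_right_cancel₀ ((map_ne_zero_iff _ univToFun_injective).mpr hd) hw

/-- Up to the sign coming from `Ψ_{-n} = -Ψ_n`, this is the Y-coordinate of the negation law in
Jacobian coordinates. -/
lemma omegaVal_neg {F : Type*} [Field F] {W : WeierstrassCurve F} {x y : F} (h2 : (2 : F) ≠ 0)
    {n : ℤ} (hψ : psiVal W x y n ≠ 0) (hn : n ≠ 0) :
    omegaVal W x y (-n) = omegaVal W x y n + W.a₁ * phiVal W x y n * psiVal W x y n +
      W.a₃ * psiVal W x y n ^ 3 := by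
  rw [omegaVal, omegaVal, if_neg hn, if_neg (neg_ne_zero.mpr hn), phiVal_neg,
    show 2 * -n = -(2 * n) by ring, psiVal_neg, psiVal_neg]
  field_simp
  ring

lemma exists_omegaU (n : ℤ) : ∃ w : UnivRing, univToFun w = omegaF n := by
  obtain hn | rfl | hn : 1 ≤ n ∨ n = 0 ∨ 1 ≤ -n := by lia
  · exact exists_omegaU_of_pos hn
  · exact ⟨1, by rw [map_one, omegaF, omegaVal_zero]⟩
  · obtain ⟨w, hw⟩ := exists_omegaU_of_pos hn
    refine ⟨w + (coordCurve universalCurve).a₁ * phiU (-n) * psiU (-n) +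
      (coordCurve universalCurve).a₃ * psiU (-n) ^ 3, ?_⟩
    have := omegaVal_neg (W := funCurve) (x := funX) (y := funY) two_ne_zero
      (psiF_ne_zero (-n) (by lia)) (by lia)
    rw [neg_neg] at this
    rw [omegaF, this]
    simp only [map_add, map_mul, map_pow, hw, univToFun_psiU, univToFun_phiU]
    rw [show univToFun (coordCurve universalCurve).a₁ = funCurve.a₁ by rw [← map_univToFun, map_a₁],
      show univToFun (coordCurve universalCurve).a₃ = funCurve.a₃ by rw [← map_univToFun, map_a₃]]

/-- `Ω_n` in the coordinate ring of the universal curve. -/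
def omegaU (n : ℤ) : UnivRing := (exists_omegaU n).choose

lemma univToFun_omegaU (n : ℤ) : univToFun (omegaU n) = omegaF n := (exists_omegaU n).choose_spec

end GenericCurve

end

noncomputable section

namespace GenericCurve

open WeierstrassCurve

/-! ### Specialization of the multiplication formula to arbitrary points -/

section Specialization

open scoped Jacobian

/-- The Jacobian coordinates `(Φ_n, Ω_n, Ψ_n)` in the coordinate ring of the universal curve. -/
def jacU (n : ℤ) : Fin 3 → UnivRing := ![phiU n, omegaU n, psiU n]

lemma univToFun_comp_jacU (n : ℤ) : univToFun ∘ jacU n = jacVal funCurve funX funY n := by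
  ext i
  fin_cases i
  · exact univToFun_phiU n
  · exact univToFun_omegaU n
  · exact univToFun_psiU n

lemma eq_of_univToFun_comp_eq {u v : Fin 3 → UnivRing} (h : univToFun ∘ u = univToFun ∘ v) :
    u = v :=
  univToFun_injective.comp_left h

lemma jacU_zero : jacU 0 = ![1, 1, 0] := by
  apply eq_of_univToFun_comp_eq
  rw [univToFun_comp_jacU, jacVal_zero]
  ext i
  fin_cases i <;> simp

lemma jacU_one : jacU 1 = ![coordX universalCurve, coordY universalCurve, 1] := by
  apply eq_of_univToFun_comp_eq
  rw [univToFun_comp_jacU]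
  ext i
  fin_cases i
  · simp [jacVal, phiVal, psiVal_zero, psiVal_one, univToFun_coordX]
  · simp only [jacVal, omegaVal, phiVal, if_neg one_ne_zero, mul_one, psiVal_one, psiVal_two,
      sub_self, psiVal_zero, Fin.mk_one, Matrix.cons_val_one, Matrix.cons_val_zero,
      Function.comp_apply, univToFun_coordY]
    field_simp
    ring
  · simp [jacVal, psiVal_one]

-- The identity holds in the function field, into which the universal coordinate ring embeds.
open scoped Classical in
lemma dblXYZ_jacU {n : ℤ} (hn : 1 ≤ n) :
    (coordCurve universalCurve).toJacobian.dblXYZ (jacU n) = jacU (2 * n) := by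
  apply eq_of_univToFun_comp_eq
  have := Jacobian.map_dblXYZ univToFun (W' := (coordCurve universalCurve).toJacobian) (jacU n)
  rw [show (coordCurve universalCurve).toJacobian.map univToFun = funCurve.toJacobian from
    map_univToFun, univToFun_comp_jacU] at this
  rw [univToFun_comp_jacU, ← this]
  exact dblXYZ_jacVal psiF_ne_zero two_ne_zero nonsingular_generic hn

open scoped Classical in
lemma addXYZ_jacU {n : ℤ} (hn : 1 ≤ n) :
    (coordCurve universalCurve).toJacobian.addXYZ (jacU n) (jacU (n + 1)) = jacU (2 * n + 1) := by
  apply eq_of_univToFun_comp_eq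
  have := Jacobian.map_addXYZ univToFun (W' := (coordCurve universalCurve).toJacobian) (jacU n)
    (jacU (n + 1))
  rw [show (coordCurve universalCurve).toJacobian.map univToFun = funCurve.toJacobian from
    map_univToFun, univToFun_comp_jacU, univToFun_comp_jacU] at this
  rw [univToFun_comp_jacU, ← this]
  exact addXYZ_jacVal psiF_ne_zero two_ne_zero nonsingular_generic hn

/-- Scaling by `-1` with weights `2, 3, 1` fixes the first coordinate and changes the sign of the
other two. -/
lemma neg_jacU {n : ℤ} (hn : n ≠ 0) :
    (coordCurve universalCurve).toJacobian.neg (jacU n) = (-1 : UnivRing) • jacU (-n) := by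
  apply eq_of_univToFun_comp_eq
  have h := omegaVal_neg (W := funCurve) (x := funX) (y := funY) two_ne_zero
    (psiF_ne_zero n hn) hn
  have := Jacobian.map_neg univToFun (W' := (coordCurve universalCurve).toJacobian) (jacU n)
  rw [show (coordCurve universalCurve).toJacobian.map univToFun = funCurve.toJacobian from
    map_univToFun, univToFun_comp_jacU] at this
  rw [← this, Jacobian.neg, Jacobian.negY]
  ext i
  fin_cases i
  · simp [jacVal, jacU, Jacobian.smul_fin3, univToFun_phiU, phiVal_neg]
  · simp [jacVal, jacU, Jacobian.smul_fin3, univToFun_omegaU, omegaF, h]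
    ring
  · simp [jacVal, jacU, Jacobian.smul_fin3, univToFun_psiU, psiF, psiVal_neg]

variable {L : Type*} [Field L] {f : UnivRing →+* L}

/-- Some `Ψ_n` may vanish at the specialized point, so the affine induction is unavailable. The
identities `dblXYZ_jacU` and `addXYZ_jacU` still specialize, and the Jacobian group law needs no
nonvanishing of `Z`. -/
lemma zsmul_specialize_of_pos
    (h : ((coordCurve universalCurve).map f).toAffine.Nonsingular
      (f (coordX universalCurve)) (f (coordY universalCurve))) (n : ℕ) :
    (((n + 1 : ℕ) : ℤ) • Jacobian.Point.fromAffine (Affine.Point.some _ _ h)).point =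
      ⟦f ∘ jacU ((n + 1 : ℕ) : ℤ)⟧ := by
  induction n using Nat.strong_induction_on with
  | _ n ih =>
    obtain rfl | hn := Nat.eq_zero_or_pos n
    · rw [zero_add, Nat.cast_one, one_smul, jacU_one, Jacobian.Point.fromAffine_some]
      refine congrArg _ (funext fun i ↦ ?_)
      fin_cases i <;> simp
    -- The multiple is `n + 1`, so odd `n` is the doubling of `m + 1` and even `n` the sum of the
    -- multiples `m + 1` and `m + 2`.
    · obtain ⟨m, rfl | rfl⟩ : ∃ m, n = 2 * m + 1 ∨ n = 2 * m + 2 :=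
        ⟨(n - 1) / 2, by lia⟩
      · have e : ((2 * m + 1 + 1 : ℕ) : ℤ) = 2 * ((m + 1 : ℕ) : ℤ) := by push_cast; ring
        rw [e, mul_smul, two_zsmul, Jacobian.Point.add_point, ih m (by lia), Jacobian.addMap_eq,
          Jacobian.add_self, ← dblXYZ_jacU (by lia), ← Jacobian.map_dblXYZ]
      · have e : ((2 * m + 2 + 1 : ℕ) : ℤ) = 2 * ((m + 1 : ℕ) : ℤ) + 1 := by push_cast; ring
        have e' : 2 * ((m + 1 : ℕ) : ℤ) + 1 = ((m + 1 : ℕ) : ℤ) + (((m + 1) + 1 : ℕ) : ℤ) := by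
          push_cast; ring
        have e1 := ih m (by lia)
        have e2 := ih (m + 1) (by lia)
        -- Consecutive multiples always differ because `P` is affine, hence nonzero; so the addition
        -- formula applies even at torsion points.
        have hne : ¬ f ∘ jacU ((m + 1 : ℕ) : ℤ) ≈ f ∘ jacU ((m + 1 + 1 : ℕ) : ℤ) := by
          intro H
          have H' := Quotient.sound H
          rw [← e1, ← e2] at H'
          have := Jacobian.Point.ext H'
          rw [Nat.cast_succ (m + 1), add_smul, one_smul, left_eq_add] at this
          exact Jacobian.Point.fromAffine_some_ne_zero _ this
        rw [e, ← addXYZ_jacU (by lia), ← Jacobian.map_addXYZ, e', add_smul,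
          Jacobian.Point.add_point, e1, e2, Jacobian.addMap_eq, Jacobian.add_of_not_equiv hne]
        rfl

/-- The formula `n P = (Φ_n(P), Ω_n(P), Ψ_n(P))` in Jacobian coordinates. -/
theorem zsmul_specialize
    (h : ((coordCurve universalCurve).map f).toAffine.Nonsingular
      (f (coordX universalCurve)) (f (coordY universalCurve))) (n : ℤ) :
    (n • Jacobian.Point.fromAffine (Affine.Point.some _ _ h)).point = ⟦f ∘ jacU n⟧ := by
  obtain ⟨m, rfl | rfl⟩ := n.eq_nat_or_neg
  all_goals rcases m with _ | m
  · rw [Nat.cast_zero, zero_smul, jacU_zero, Jacobian.Point.zero_point]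
    congr 1
    refine funext fun i ↦ ?_
    fin_cases i <;> simp
  · exact zsmul_specialize_of_pos h m
  · rw [Nat.cast_zero, neg_zero, zero_smul, jacU_zero, Jacobian.Point.zero_point]
    congr 1
    refine funext fun i ↦ ?_
    fin_cases i <;> simp
  · rw [neg_smul, Jacobian.Point.neg_point, zsmul_specialize_of_pos h m, Jacobian.negMap_eq,
      Jacobian.map_neg, neg_jacU (by lia)]
    rw [show f ∘ ((-1 : UnivRing) • jacU (-(m + 1 : ℕ))) = (-1 : L) • (f ∘ jacU (-(m + 1 : ℕ))) by
      ext i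
      fin_cases i <;> simp [Jacobian.smul_fin3], Jacobian.smul_eq _ isUnit_one.neg]

end Specialization

end GenericCurve

end

noncomputable section

namespace GenericCurve

open WeierstrassCurve

/-! ### From Jacobian to projective coordinates -/

section Projective

variable {F : Type*} [Field F] {W : WeierstrassCurve F} {x y : F}

/-- The Jacobian triple with `Z ≠ 0` is the affine point `(X/Z², Y/Z³)`, and multiplying by `Z³`
gives the projective coordinates. For `Z = 0` nonsingularity makes `Y` nonzero, and the same
expression is a representative of the point at infinity. -/
lemma zsmul_projective (h : W.toAffine.Nonsingular x y) {n : ℤ} {Q : Fin 3 → F}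
    (hQ : (n • Jacobian.Point.fromAffine (Affine.Point.some x y h)).point =
      Quotient.mk _ Q) :
    (n • Projective.Point.fromAffine (Affine.Point.some x y h)).point =
      Quotient.mk (MulAction.orbitRel Fˣ (Fin 3 → F)) ![Q 0 * Q 2, Q 1, Q 2 ^ 3] ∧
    (n • Projective.Point.fromAffine (Affine.Point.some x y h) = 0 ↔ Q 2 = 0) ∧
    (Q 2 = 0 → Q 1 ≠ 0) := by
  classical
  have hns : W.toJacobian.Nonsingular Q := by
    have := (n • Jacobian.Point.fromAffine (Affine.Point.some x y h)).nonsingular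
    rw [hQ] at this
    exact this
  have e : n • Affine.Point.some x y h = Jacobian.Point.toAffine W.toJacobian Q := by
    have := map_zsmul (Jacobian.Point.toAffineAddEquiv W.toJacobian) n
      (Jacobian.Point.fromAffine (Affine.Point.some x y h))
    have e' : Jacobian.Point.toAffineAddEquiv W.toJacobian
        (Jacobian.Point.fromAffine (Affine.Point.some x y h)) = Affine.Point.some x y h :=
      (Jacobian.Point.toAffineAddEquiv W.toJacobian).apply_symm_apply _
    rw [e'] at this
    rw [← this, Jacobian.Point.toAffineAddEquiv_apply, Jacobian.Point.toAffineLift, hQ]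
    rfl
  have e2 : n • Projective.Point.fromAffine (Affine.Point.some x y h) =
      Projective.Point.fromAffine (n • Affine.Point.some x y h) :=
    (map_zsmul (Projective.Point.toAffineAddEquiv W.toProjective).symm n
      (Affine.Point.some x y h)).symm
  by_cases hz : Q 2 = 0
  · have hy : Q 1 ≠ 0 := (Jacobian.isUnit_Y_of_Z_eq_zero hns hz).ne_zero
    rw [Jacobian.Point.toAffine_of_Z_eq_zero hz] at e
    rw [e2, e, Projective.Point.fromAffine_zero, Projective.Point.zero_point]
    refine ⟨Quotient.sound ⟨Units.mk0 (Q 1)⁻¹ (inv_ne_zero hy), ?_⟩, by simp [hz], fun _ ↦ hy⟩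
    ext i
    fin_cases i <;> simp [hz, hy, Units.smul_def]
  · rw [Jacobian.Point.toAffine_of_Z_ne_zero hns hz] at e
    rw [e2, e]
    refine ⟨?_, by simp [hz, Projective.Point.fromAffine_some_ne_zero], fun h ↦ absurd h hz⟩
    rw [Projective.Point.fromAffine_some]
    refine Quotient.sound ⟨Units.mk0 (Q 2 ^ 3)⁻¹ (inv_ne_zero (pow_ne_zero 3 hz)), ?_⟩
    ext i
    fin_cases i
    · simp only [Units.smul_def, Units.val_mk0, Pi.smul_apply, smul_eq_mul, Fin.zero_eta,
        Matrix.cons_val_zero]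
      field_simp
    · simp only [Units.smul_def, Units.val_mk0, Pi.smul_apply, smul_eq_mul, Fin.mk_one,
        Matrix.cons_val_one, Matrix.cons_val_zero]
      field_simp
    · simp [hz, Units.smul_def]

end Projective

/-! ### Evaluation at affine points -/

/-- Evaluation at an affine point of the generic curve. -/
def evalAt {x y : K} (h : E.toAffine.Equation x y) : E.toAffine.CoordinateRing →+* K :=
  AdjoinRoot.evalEval h

section EvalAt

variable {x y : K} (h : E.toAffine.Equation x y)

lemma evalAt_mk (p : Polynomial (Polynomial K)) :
    evalAt h (Affine.CoordinateRing.mk E.toAffine p) = p.evalEval x y :=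
  AdjoinRoot.evalEval_mk h p

lemma evalAt_algebraMap (c : K) : evalAt h (algebraMap K E.toAffine.CoordinateRing c) = c := by
  rw [← mk_C_C, evalAt_mk]
  simp [Polynomial.evalEval]

lemma evalAt_coordX : evalAt h (coordX E) = x := by
  rw [coordX, evalAt_mk]
  simp [Polynomial.evalEval]

lemma evalAt_coordY : evalAt h (coordY E) = y := by
  rw [coordY, evalAt_mk]
  simp [Polynomial.evalEval]

/-- Evaluation of the universal coordinate ring at an affine point of the generic curve. -/
def specialize : UnivRing →+* K := (evalAt h).comp toCoord

lemma specialize_coordX : specialize h (coordX universalCurve) = x := by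
  rw [specialize, RingHom.comp_apply, toCoord_coordX, evalAt_coordX]

lemma specialize_coordY : specialize h (coordY universalCurve) = y := by
  rw [specialize, RingHom.comp_apply, toCoord_coordY, evalAt_coordY]

lemma map_specialize : (coordCurve universalCurve).map (specialize h) = E := by
  rw [specialize, ← map_map, map_toCoord, coordCurve, map_map]
  rw [show (evalAt h).comp (algebraMap K E.toAffine.CoordinateRing) = RingHom.id K from
    RingHom.ext (evalAt_algebraMap h), map_id]

lemma zsmul_jacobian (hn : E.toAffine.Nonsingular x y) (n : ℤ) :
    (n • Jacobian.Point.fromAffine (Affine.Point.some x y hn)).point =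
      Quotient.mk _ (specialize h ∘ jacU n) := by
  -- The specialized curve and coordinates equal `E`, `x`, `y` only propositionally, while the point
  -- depends on them; generalizing allows substitution.
  have key : ∀ (W : WeierstrassCurve K) (a b : K) (hW : W = E) (ha : a = x) (hb : b = y)
      (H : ∀ h' : W.toAffine.Nonsingular a b,
        (n • Jacobian.Point.fromAffine (Affine.Point.some a b h')).point =
          Quotient.mk _ (specialize h ∘ jacU n)),
      (n • Jacobian.Point.fromAffine (Affine.Point.some x y hn)).point =
        Quotient.mk _ (specialize h ∘ jacU n) := by
    rintro W a b rfl rfl rfl H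
    exact H hn
  exact key _ _ _ (map_specialize h) (specialize_coordX h) (specialize_coordY h)
    fun h' ↦ zsmul_specialize h' n

end EvalAt

lemma equation_affine {v : Fin 3 → K} (hz : v 2 ≠ 0) (h : E.toProjective.Equation v) :
    E.toAffine.Equation (v 0 / v 2) (v 1 / v 2) :=
  (Projective.equation_of_Z_ne_zero hz).mp h

lemma point_eq_fromAffine {v : Fin 3 → K} (hv : v ≠ 0) (hz : v 2 ≠ 0)
    (h : E.toProjective.Equation v) : point v hv h = Projective.Point.fromAffine
      (Affine.Point.some _ _ ((Affine.equation_iff_nonsingular_of_Δ_ne_zero E_Δ_ne_zero).mp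
        (equation_affine hz h))) := by
  rw [Projective.Point.fromAffine_some, point, Projective.Point.mk.injEq]
  exact Quotient.sound (Projective.equiv_some_of_Z_ne_zero hz)

lemma point_eq_zero {v : Fin 3 → K} (hv : v ≠ 0) (hz : v 2 = 0)
    (h : E.toProjective.Equation v) : point v hv h = 0 := by
  rw [Projective.Point.zero_def, point, Projective.Point.mk.injEq]
  exact Quotient.sound (Projective.equiv_zero_of_Z_eq_zero (nonsingular_of_equation hv h) hz)

lemma point_ne_zero {v : Fin 3 → K} (hv : v ≠ 0) (hz : v 2 ≠ 0)
    (h : E.toProjective.Equation v) : point v hv h ≠ 0 := by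
  rw [point_eq_fromAffine hv hz]
  exact Projective.Point.fromAffine_some_ne_zero _

section

variable {v : Fin 3 → K} (hv : v ≠ 0) (hz : v 2 ≠ 0) (h : E.toProjective.Equation v) (n : ℤ)

lemma zsmul_point_eq : (n • point v hv h).point =
    projClass ![specialize (equation_affine hz h) (phiU n) *
      specialize (equation_affine hz h) (psiU n),
      specialize (equation_affine hz h) (omegaU n),
      specialize (equation_affine hz h) (psiU n) ^ 3] := by
  rw [point_eq_fromAffine hv hz h]
  exact (zsmul_projective _ (zsmul_jacobian (equation_affine hz h) _ n)).1

lemma zsmul_point_eq_zero_iff :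
    n • point v hv h = 0 ↔ specialize (equation_affine hz h) (psiU n) = 0 := by
  rw [point_eq_fromAffine hv hz h]
  exact (zsmul_projective _ (zsmul_jacobian (equation_affine hz h) _ n)).2.1

lemma specialize_omegaU_ne_zero (h0 : specialize (equation_affine hz h) (psiU n) = 0) :
    specialize (equation_affine hz h) (omegaU n) ≠ 0 :=
  (zsmul_projective ((Affine.equation_iff_nonsingular_of_Δ_ne_zero E_Δ_ne_zero).mp
        (equation_affine hz h)) (zsmul_jacobian (equation_affine hz h) _ n)).2.2 h0

end

end GenericCurve

end

noncomputable section

namespace GenericCurve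

open WeierstrassCurve MvPolynomial

/-! ### Regular functions and their values -/

/-- The affine coordinate ring of the generic curve. -/
abbrev CoordRing : Type := E.toAffine.CoordinateRing

/-- The polynomial function `F(X, Y, 1)` in the affine coordinate ring. -/
def dehomCoord : MvPolynomial (Fin 3) K →+* CoordRing :=
  eval₂Hom (algebraMap K CoordRing) ![coordX E, coordY E, 1]

lemma dehomCoord_apply (F : MvPolynomial (Fin 3) K) : dehomCoord F =
    ∑ m ∈ F.support, algebraMap K CoordRing (F.coeff m) * (coordX E ^ m 0 * coordY E ^ m 1) := by
  rw [dehomCoord, coe_eval₂Hom, eval₂_eq']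
  simp [Fin.prod_univ_three]

lemma coordToFun_coordX : coordToFun (coordX E) = funX := by rw [coordX, funX]

lemma coordToFun_coordY : coordToFun (coordY E) = funY := by rw [coordY, funY]

lemma coordToFun_algebraMap (c : K) : coordToFun (algebraMap K CoordRing c) = const c := rfl

lemma dehomogenize_eq (F : MvPolynomial (Fin 3) K) :
    dehomogenize F = coordToFun (dehomCoord F) := by
  have : eval₂Hom const ![funX, funY, 1] = coordToFun.comp dehomCoord := by
    apply MvPolynomial.ringHom_ext
    · intro c
      simp [dehomCoord, coordToFun_algebraMap]
    · intro i
      fin_cases i <;> simp [dehomCoord, coordToFun_coordX, coordToFun_coordY]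
  exact congrArg (fun f ↦ f F) this

lemma dehomogenize_add (F G : MvPolynomial (Fin 3) K) :
    dehomogenize (F + G) = dehomogenize F + dehomogenize G := eval₂_add _ _

lemma dehomogenize_mul (F G : MvPolynomial (Fin 3) K) :
    dehomogenize (F * G) = dehomogenize F * dehomogenize G := eval₂_mul _ _

lemma dehomogenize_C (c : K) : dehomogenize (C c) = const c := eval₂_C _ _ _

lemma degree_eq_three {m : Fin 3 →₀ ℕ} {F : MvPolynomial (Fin 3) K} {d : ℕ}
    (hF : F.IsHomogeneous d) (hm : m ∈ F.support) : m 0 + m 1 + m 2 = d := by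
  have := hF.degree_eq_sum_deg_support hm
  rw [this, ← Fin.sum_univ_three (fun i ↦ m i)]
  exact (Finset.sum_subset (Finset.subset_univ _) fun i _ hi ↦
    Finsupp.notMem_support_iff.mp hi).symm

lemma eval_eq_evalAt {v : Fin 3 → K} (hz : v 2 ≠ 0) (h : E.toProjective.Equation v)
    {F : MvPolynomial (Fin 3) K} {d : ℕ} (hF : F.IsHomogeneous d) :
    eval v F = v 2 ^ d * evalAt (equation_affine hz h) (dehomCoord F) := by
  rw [dehomCoord_apply, map_sum, Finset.mul_sum, eval_eq']
  refine Finset.sum_congr rfl fun m hm ↦ ?_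
  rw [← degree_eq_three hF hm, Fin.prod_univ_three]
  simp only [map_mul, map_pow, evalAt_algebraMap, evalAt_coordX, evalAt_coordY, div_pow]
  field_simp
  ring

/-- The exponent of `y ^ d`. -/
abbrev expY (d : ℕ) : Fin 3 →₀ ℕ := Finsupp.single 1 d

lemma eq_expY {m : Fin 3 →₀ ℕ} {d : ℕ} (h0 : m 0 = 0) (h2 : m 2 = 0) (hd : m 0 + m 1 + m 2 = d) :
    m = expY d := by
  ext i
  fin_cases i
  · simpa using h0
  · simp; lia
  · simpa using h2

lemma eval_infinity {v : Fin 3 → K} (hx : v 0 = 0) (hz : v 2 = 0) {F : MvPolynomial (Fin 3) K}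
    {d : ℕ} (hF : F.IsHomogeneous d) : eval v F = F.coeff (expY d) * v 1 ^ d := by
  rw [eval_eq', Finset.sum_eq_single (expY d)]
  · simp [Fin.prod_univ_three, expY]
  · intro m hm hne
    rw [Fin.prod_univ_three, hx, hz]
    have hd := degree_eq_three hF hm
    by_cases h0 : m 0 = 0
    · have h2 : m 2 ≠ 0 := fun h2 ↦ hne (eq_expY h0 h2 hd)
      simp [h2]
    · simp [h0]
  · intro h
    rw [notMem_support_iff.mp h, zero_mul]

/-- Among monomials of degree `d`, `y ^ d` alone has pole order `3d`; the others have smaller order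
and cannot cancel it. This makes values at infinity independent of the chosen homogeneous
polynomials. -/
lemma coeff_expY_eq_zero {F : MvPolynomial (Fin 3) K} {d : ℕ} (hF : F.IsHomogeneous d)
    (h : dehomCoord F = 0) : F.coeff (expY d) = 0 := by
  by_contra h0
  rw [dehomCoord_apply] at h
  have hm : poleOrder (algebraMap K CoordRing (F.coeff (expY d)) *
      (coordX E ^ (expY d 0) * coordY E ^ (expY d 1))) = ((3 * d : ℕ) : WithBot ℕ) := by
    rw [poleOrder_monomial h0]
    simp [expY]
  have := poleOrder_sum_eq (fun m ↦ algebraMap K CoordRing (F.coeff m) *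
    (coordX E ^ m 0 * coordY E ^ m 1)) (mem_support_iff.mpr h0) ?_ ?_
  · rw [h, hm, poleOrder_eq_bot.mpr rfl] at this
    exact absurd this.symm WithBot.coe_ne_bot
  · intro h'
    rw [h', poleOrder_eq_bot.mpr rfl] at hm
    exact absurd hm.symm WithBot.coe_ne_bot
  · intro m hm' hne
    have hd := degree_eq_three hF hm'
    rw [hm, poleOrder_monomial (mem_support_iff.mp hm'), Nat.cast_lt]
    by_contra hlt
    exact hne (eq_expY (by lia) (by lia) hd)

lemma X_eq_zero_of_equation {v : Fin 3 → K} (h : E.toProjective.Equation v) (hz : v 2 = 0) :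
    v 0 = 0 := by
  simpa using (Projective.equation_of_Z_eq_zero hz).mp h

lemma eval_eq_zero_of_dehomogenize {v : Fin 3 → K} (h : E.toProjective.Equation v)
    {F : MvPolynomial (Fin 3) K} {d : ℕ} (hF : F.IsHomogeneous d) (h0 : dehomogenize F = 0) :
    eval v F = 0 := by
  rw [dehomogenize_eq, map_eq_zero_iff _ coordToFun_injective] at h0
  by_cases hz : v 2 = 0
  · rw [eval_infinity (X_eq_zero_of_equation h hz) hz hF, coeff_expY_eq_zero hF h0, zero_mul]
  · rw [eval_eq_evalAt hz h hF, h0, map_zero, mul_zero]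

section HasValueAt

variable {v : Fin 3 → K} (h : E.toProjective.Equation v) {f g : FunField} {a b : K}

include h in
lemma dehomogenize_ne_zero {F : MvPolynomial (Fin 3) K} {d : ℕ} (hF : F.IsHomogeneous d)
    (h0 : eval v F ≠ 0) : dehomogenize F ≠ 0 :=
  fun h' ↦ h0 (eval_eq_zero_of_dehomogenize h hF h')

lemma hasValueAt_const (v : Fin 3 → K) (c : K) : HasValueAt v (const c) c :=
  ⟨0, C c, C 1, isHomogeneous_C _ _, isHomogeneous_C _ _, by simp,
    by rw [dehomogenize_C, dehomogenize_C, map_one, div_one], by simp⟩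

include h in
lemma HasValueAt.add (hf : HasValueAt v f a) (hg : HasValueAt v g b) :
    HasValueAt v (f + g) (a + b) := by
  obtain ⟨d, F, G, hF, hG, h0, rfl, rfl⟩ := hf
  obtain ⟨e, F', G', hF', hG', h0', rfl, rfl⟩ := hg
  refine ⟨d + e, F * G' + G * F', G * G', (hF.mul hG').add (hG.mul hF'), hG.mul hG', ?_, ?_, ?_⟩
  · rw [map_mul]; exact mul_ne_zero h0 h0'
  · have := dehomogenize_ne_zero h hG h0
    have := dehomogenize_ne_zero h hG' h0'
    rw [dehomogenize_add, dehomogenize_mul, dehomogenize_mul, dehomogenize_mul]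
    field_simp
  · rw [map_add, map_mul, map_mul, map_mul]
    field_simp

lemma HasValueAt.mul (hf : HasValueAt v f a) (hg : HasValueAt v g b) :
    HasValueAt v (f * g) (a * b) := by
  obtain ⟨d, F, G, hF, hG, h0, rfl, rfl⟩ := hf
  obtain ⟨e, F', G', hF', hG', h0', rfl, rfl⟩ := hg
  refine ⟨d + e, F * F', G * G', hF.mul hF', hG.mul hG', ?_, ?_, ?_⟩
  · rw [map_mul]; exact mul_ne_zero h0 h0'
  · rw [dehomogenize_mul, dehomogenize_mul, mul_div_mul_comm]
  · rw [map_mul, map_mul, mul_div_mul_comm]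

lemma HasValueAt.inv (hf : HasValueAt v f a) (ha : a ≠ 0) : HasValueAt v f⁻¹ a⁻¹ := by
  obtain ⟨d, F, G, hF, hG, h0, rfl, rfl⟩ := hf
  exact ⟨d, G, F, hG, hF, (div_ne_zero_iff.mp ha).1, inv_div _ _, inv_div _ _⟩

lemma HasValueAt.neg (hf : HasValueAt v f a) : HasValueAt v (-f) (-a) := by
  have := (hasValueAt_const v (-1)).mul hf
  simpa using this

include h in
lemma HasValueAt.sub (hf : HasValueAt v f a) (hg : HasValueAt v g b) :
    HasValueAt v (f - g) (a - b) := by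
  rw [sub_eq_add_neg, sub_eq_add_neg]
  exact hf.add h hg.neg

lemma HasValueAt.div (hf : HasValueAt v f a) (hg : HasValueAt v g b) (hb : b ≠ 0) :
    HasValueAt v (f / g) (a / b) := by
  rw [div_eq_mul_inv, div_eq_mul_inv]
  exact hf.mul (hg.inv hb)

lemma HasValueAt.pow (hf : HasValueAt v f a) (n : ℕ) : HasValueAt v (f ^ n) (a ^ n) := by
  induction n with
  | zero => simpa using hasValueAt_const v 1
  | succ n ih =>
    rw [pow_succ, pow_succ]
    exact ih.mul hf

lemma HasValueAt.zpow (hf : HasValueAt v f a) (ha : a ≠ 0) (n : ℤ) :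
    HasValueAt v (f ^ n) (a ^ n) := by
  obtain ⟨m, rfl | rfl⟩ := n.eq_nat_or_neg
  · simpa using hf.pow m
  · simpa using (hf.pow m).inv (pow_ne_zero m ha)

include h in
lemma HasValueAt.unique (hf : HasValueAt v f a) (hf' : HasValueAt v f b) : a = b := by
  obtain ⟨d, F, G, hF, hG, h0, rfl, rfl⟩ := hf
  obtain ⟨e, F', G', hF', hG', h0', e', rfl⟩ := hf'
  have h1 := dehomogenize_ne_zero h hG h0
  have h1' := dehomogenize_ne_zero h hG' h0'
  rw [div_eq_div_iff h1 h1'] at e'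
  have := eval_eq_zero_of_dehomogenize h (F := F * G' + C (-1) * (F' * G))
    ((hF.mul hG').add ((add_comm e d ▸ hF'.mul hG).C_mul _)) (by
      rw [dehomogenize_add, dehomogenize_mul, dehomogenize_mul, dehomogenize_mul, dehomogenize_C,
        e', map_neg, map_one]
      ring)
  rw [div_eq_div_iff h0 h0']
  simp only [map_add, map_mul, eval_C] at this
  linear_combination this

include h in
lemma HasValueAt.ne_zero (hf : HasValueAt v f a) (ha : a ≠ 0) : f ≠ 0 := by
  rintro rfl
  exact ha (hf.unique h (by simpa using hasValueAt_const v 0))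

end HasValueAt

/-! ### Affine points -/

section AffinePoint

variable {v : Fin 3 → K} (h : E.toProjective.Equation v) (hz : v 2 ≠ 0)

include hz in
lemma hasValueAt_funX : HasValueAt v funX (v 0 / v 2) :=
  ⟨1, X 0, X 2, isHomogeneous_X _ _, isHomogeneous_X _ _, by simpa using hz,
    by simp [dehomogenize], by simp⟩

include hz in
lemma hasValueAt_funY : HasValueAt v funY (v 1 / v 2) :=
  ⟨1, X 1, X 2, isHomogeneous_X _ _, isHomogeneous_X _ _, by simpa using hz,
    by simp [dehomogenize], by simp⟩

lemma hasValueAt_coordToFun (a : CoordRing) :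
    HasValueAt v (coordToFun a) (evalAt (equation_affine hz h) a) := by
  induction a using coordRing_induction with
  | hC c =>
    rw [evalAt_algebraMap]
    exact hasValueAt_const v c
  | hX =>
    rw [evalAt_coordX, coordToFun_coordX]
    exact hasValueAt_funX hz
  | hY =>
    rw [evalAt_coordY, coordToFun_coordY]
    exact hasValueAt_funY hz
  | hadd a b ha hb =>
    rw [map_add, map_add]
    exact ha.add h hb
  | hmul a b ha hb =>
    rw [map_mul, map_mul]
    exact ha.mul hb

lemma HasValueAt.exists_div {f : FunField} {c : K} (hf : HasValueAt v f c) :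
    ∃ a b : CoordRing, evalAt (equation_affine hz h) b ≠ 0 ∧
      f = coordToFun a / coordToFun b := by
  obtain ⟨d, F, G, hF, hG, h0, rfl, rfl⟩ := hf
  refine ⟨dehomCoord F, dehomCoord G, ?_, by rw [dehomogenize_eq, dehomogenize_eq]⟩
  rw [eval_eq_evalAt hz h hG] at h0
  exact right_ne_zero_of_mul h0

end AffinePoint

end GenericCurve

end

noncomputable section

namespace GenericCurve

open WeierstrassCurve MvPolynomial

/-! ### Uniformizers at affine points -/

section AffineUniformizer

/-- First-order Taylor expansion at `(x, y)`: the functions vanishing there form the ideal generated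
by `X - x` and `Y - y`. -/
lemma exists_eq_add_mul_add_mul {x y : K} (h : E.toAffine.Equation x y) (a : CoordRing) :
    ∃ b c : CoordRing, a = algebraMap K CoordRing (evalAt h a) +
      (coordX E - algebraMap K CoordRing x) * b + (coordY E - algebraMap K CoordRing y) * c := by
  induction a using coordRing_induction with
  | hC c => exact ⟨0, 0, by rw [evalAt_algebraMap]; ring⟩
  | hX => exact ⟨1, 0, by rw [evalAt_coordX]; ring⟩
  | hY => exact ⟨0, 1, by rw [evalAt_coordY]; ring⟩
  | hadd a b ha hb =>
    obtain ⟨a₁, a₂, ha⟩ := ha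
    obtain ⟨b₁, b₂, hb⟩ := hb
    refine ⟨a₁ + b₁, a₂ + b₂, ?_⟩
    rw [map_add, map_add]
    linear_combination ha + hb
  | hmul a b ha hb =>
    obtain ⟨a₁, a₂, ha⟩ := ha
    obtain ⟨b₁, b₂, hb⟩ := hb
    refine ⟨a₁ * b + algebraMap K CoordRing (evalAt h a) * b₁,
      a₂ * b + algebraMap K CoordRing (evalAt h a) * b₂, ?_⟩
    rw [map_mul, map_mul]
    linear_combination b * ha + algebraMap K CoordRing (evalAt h a) * hb

lemma equation_fun : funCurve.toAffine.Equation funX funY := nonsingular_generic.1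

variable {v : Fin 3 → K} (h : E.toProjective.Equation v) (hz : v 2 ≠ 0)

include h hz

/-- Sufficient condition for a combination `X - x` and `Y - y` to generate the maximal ideal. -/
lemma isUniformizerAt_of_dvd {t p q : FunField} {c d : K} (ht : HasValueAt v t 0)
    (hp : HasValueAt v p c) (hq : HasValueAt v q d) (hX : funX - const (v 0 / v 2) = t * p)
    (hY : funY - const (v 1 / v 2) = t * q) : IsUniformizerAt v t := by
  refine ⟨ht, fun g hg ↦ ?_⟩
  obtain ⟨a, b, hb, rfl⟩ := hg.exists_div h hz
  obtain ⟨a₁, a₂, ha⟩ := exists_eq_add_mul_add_mul (equation_affine hz h) a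
  have hb' := hasValueAt_coordToFun h hz b
  have h0 : evalAt (equation_affine hz h) a = 0 := by
    have h1 := ((hasValueAt_coordToFun h hz a).div hb' hb).unique h hg
    exact (div_eq_zero_iff.mp h1).resolve_right hb
  rw [h0, map_zero, zero_add] at ha
  have ha' : coordToFun a = t * (p * coordToFun a₁ + q * coordToFun a₂) := by
    rw [ha]
    simp only [map_add, map_mul, map_sub, coordToFun_coordX, coordToFun_coordY]
    rw [coordToFun_algebraMap, coordToFun_algebraMap, hX, hY]
    ring
  refine ⟨_, _, ((hp.mul (hasValueAt_coordToFun h hz a₁)).add h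
    (hq.mul (hasValueAt_coordToFun h hz a₂))).div hb' hb, ?_⟩
  rw [ha', mul_div_assoc]

/-- Expanding the curve equation at the point gives `(Y - y)A = (X - x)B`, where the values of `A`
and `B` are, up to sign, the two partial derivatives. Smoothness makes one of them a local unit, and
then one of `X - x`, `Y - y` is a multiple of the other. -/
lemma exists_isUniformizerAt_affine : ∃ t : FunField, IsUniformizerAt v t ∧
    (t = funX - const (v 0 / v 2) ∨ t = funY - const (v 1 / v 2)) := by
  have hns := (Affine.equation_iff_nonsingular_of_Δ_ne_zero E_Δ_ne_zero).mp (equation_affine hz h)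
  rw [Affine.nonsingular_iff', Affine.equation_iff'] at hns
  obtain ⟨he, hne⟩ := hns
  have hgen := (Affine.equation_iff' _ _).mp equation_fun
  simp only [funCurve, map_a₁, map_a₂, map_a₃, map_a₄, map_a₆] at hgen
  have he' := congrArg const he
  simp only [map_add, map_sub, map_mul, map_pow, map_zero] at he'
  set x := v 0 / v 2 with hx
  set y := v 1 / v 2 with hy
  have vX := hasValueAt_funX hz
  have vY := hasValueAt_funY hz
  rw [← hx] at vX
  rw [← hy] at vY
  have vc := hasValueAt_const v
  have vu : HasValueAt v (funX - const x) 0 := by simpa using vX.sub h (vc x)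
  have vw : HasValueAt v (funY - const y) 0 := by simpa using vY.sub h (vc y)
  set u := funX - const x with hu
  set w := funY - const y with hw
  have vA : HasValueAt v (w + const (2 * y + E.a₁ * x + E.a₃) + const E.a₁ * u)
      (2 * y + E.a₁ * x + E.a₃) := by
    have := (vw.add h (vc (2 * y + E.a₁ * x + E.a₃))).add h ((vc E.a₁).mul vu)
    simpa using this
  have vB : HasValueAt v (u ^ 2 + const (3 * x + E.a₂) * u +
      const (3 * x ^ 2 + 2 * E.a₂ * x + E.a₄ - E.a₁ * y))
      (3 * x ^ 2 + 2 * E.a₂ * x + E.a₄ - E.a₁ * y) := by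
    have := ((vu.pow 2).add h ((vc (3 * x + E.a₂)).mul vu)).add h
      (vc (3 * x ^ 2 + 2 * E.a₂ * x + E.a₄ - E.a₁ * y))
    simpa using this
  have key : w * (w + const (2 * y + E.a₁ * x + E.a₃) + const E.a₁ * u) =
      u * (u ^ 2 + const (3 * x + E.a₂) * u +
        const (3 * x ^ 2 + 2 * E.a₂ * x + E.a₄ - E.a₁ * y)) := by
    simp only [map_add, map_sub, map_mul, map_pow, map_ofNat, hu, hw]
    linear_combination hgen - he'
  by_cases hA : 2 * y + E.a₁ * x + E.a₃ = 0
  · have hB : 3 * x ^ 2 + 2 * E.a₂ * x + E.a₄ - E.a₁ * y ≠ 0 := by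
      rcases hne with hne | hne
      · intro h0
        exact hne (by linear_combination -h0)
      · exact absurd hA hne
    refine ⟨w, isUniformizerAt_of_dvd h hz (p := _ / _) (q := 1) vw (vA.div vB hB)
      (by simpa using vc 1) ?_ (by rw [mul_one]), Or.inr rfl⟩
    rw [← mul_div_assoc, eq_div_iff (vB.ne_zero h hB)]
    exact key.symm
  · refine ⟨u, isUniformizerAt_of_dvd h hz (p := 1) (q := _ / _) vu (by simpa using vc 1)
      (vB.div vA hA) (by rw [mul_one]) ?_, Or.inl rfl⟩
    rw [← mul_div_assoc, eq_div_iff (vA.ne_zero h hA)]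
    exact key

end AffineUniformizer

/-! ### The invariant derivation -/

section Derivation

open scoped DualNumber

/-- The derivative of `X` along the invariant derivation. -/
abbrev derivX : FunField := 2 * funY + const E.a₁ * funX + const E.a₃

/-- The derivative of `Y` along the invariant derivation. -/
abbrev derivY : FunField :=
  3 * funX ^ 2 + 2 * const E.a₂ * funX + const E.a₄ - const E.a₁ * funY

/-- The ring homomorphism `f ↦ f + D f ε` on the affine coordinate ring. -/
def dualCoord : CoordRing →+* FunField[ε] :=
  AdjoinRoot.lift (Polynomial.eval₂RingHom ((TrivSqZeroExt.inlHom FunField FunField).comp const)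
    (TrivSqZeroExt.inl funX + TrivSqZeroExt.inr derivX))
    (TrivSqZeroExt.inl funY + TrivSqZeroExt.inr derivY) (by
      have hgen := (Affine.equation_iff' _ _).mp equation_fun
      simp only [funCurve, map_a₁, map_a₂, map_a₃, map_a₄, map_a₆] at hgen
      have e : E.toAffine.polynomial = Polynomial.X ^ 2 + Polynomial.C (Polynomial.C E.a₁ *
          Polynomial.X + Polynomial.C E.a₃) * Polynomial.X - Polynomial.C (Polynomial.X ^ 3 +
          Polynomial.C E.a₂ * Polynomial.X ^ 2 + Polynomial.C E.a₄ * Polynomial.X +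
          Polynomial.C E.a₆) := by rw [Affine.polynomial]
      refine (congrArg (Polynomial.eval₂ _ _) e).trans ?_
      simp only [Polynomial.eval₂_add, Polynomial.eval₂_sub, Polynomial.eval₂_mul,
        Polynomial.eval₂_pow, Polynomial.eval₂_X, Polynomial.eval₂_C, Polynomial.coe_eval₂RingHom,
        RingHom.comp_apply, TrivSqZeroExt.inlHom_apply]
      ext
      · simp only [TrivSqZeroExt.fst_add, TrivSqZeroExt.fst_sub, TrivSqZeroExt.fst_mul,
          TrivSqZeroExt.fst_pow, TrivSqZeroExt.fst_inl, TrivSqZeroExt.fst_inr,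
          TrivSqZeroExt.fst_zero]
        linear_combination hgen
      -- With `F` the curve equation, `derivX = ∂F/∂Y` and `derivY = -∂F/∂X`, so the `ε`-part
      -- cancels identically.
      · simp only [pow_succ, pow_zero, one_mul, TrivSqZeroExt.fst_add, TrivSqZeroExt.fst_mul,
          TrivSqZeroExt.fst_inl, TrivSqZeroExt.fst_inr,
          TrivSqZeroExt.snd_add, TrivSqZeroExt.snd_sub, TrivSqZeroExt.snd_mul,
          TrivSqZeroExt.snd_inl, TrivSqZeroExt.snd_inr, TrivSqZeroExt.snd_zero, smul_eq_mul,
          op_smul_eq_smul]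
        ring)

lemma dualCoord_algebraMap (c : K) :
    dualCoord (algebraMap K CoordRing c) = TrivSqZeroExt.inl (const c) := by
  rw [← mk_C_C]
  refine (AdjoinRoot.lift_mk _ _).trans ?_
  simp

lemma dualCoord_coordX :
    dualCoord (coordX E) = TrivSqZeroExt.inl funX + TrivSqZeroExt.inr derivX := by
  refine (AdjoinRoot.lift_mk _ _).trans ?_
  simp

lemma dualCoord_coordY :
    dualCoord (coordY E) = TrivSqZeroExt.inl funY + TrivSqZeroExt.inr derivY := by
  refine (AdjoinRoot.lift_mk _ _).trans ?_
  simp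

lemma fst_dualCoord (a : CoordRing) : (dualCoord a).fst = coordToFun a := by
  induction a using coordRing_induction with
  | hC c => rw [dualCoord_algebraMap, coordToFun_algebraMap]; simp
  | hX => rw [dualCoord_coordX, coordToFun_coordX]; simp
  | hY => rw [dualCoord_coordY, coordToFun_coordY]; simp
  | hadd a b ha hb => rw [map_add, map_add, TrivSqZeroExt.fst_add, ha, hb]
  | hmul a b ha hb => rw [map_mul, map_mul, TrivSqZeroExt.fst_mul, ha, hb]

/-- The ring homomorphism `f ↦ f + D f ε` on the function field. -/
def dualFun : FunField →+* FunField[ε] :=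
  IsLocalization.lift (M := nonZeroDivisors CoordRing) (g := dualCoord) (by
    intro s
    rw [TrivSqZeroExt.isUnit_iff_isUnit_fst, fst_dualCoord, isUnit_iff_ne_zero]
    exact (map_ne_zero_iff _ coordToFun_injective).mpr (nonZeroDivisors.ne_zero s.2))

lemma dualFun_coordToFun (a : CoordRing) : dualFun (coordToFun a) = dualCoord a :=
  IsLocalization.lift_eq _ a

lemma fst_dualFun (f : FunField) : (dualFun f).fst = f := by
  obtain ⟨a, b, hb, rfl⟩ := IsFractionRing.div_surjective (A := CoordRing) f
  have hb' : coordToFun b ≠ 0 :=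
    (map_ne_zero_iff _ coordToFun_injective).mpr (nonZeroDivisors.ne_zero hb)
  have := congrArg TrivSqZeroExt.fst
    (congrArg dualFun (div_mul_cancel₀ (coordToFun a) hb'))
  rw [map_mul, dualFun_coordToFun, dualFun_coordToFun, TrivSqZeroExt.fst_mul, fst_dualCoord,
    fst_dualCoord] at this
  exact eq_div_of_mul_eq hb' this

/-- The derivation attached to a section of the dual numbers. -/
def derivationOfDual {F : Type*} [Field F] (φ : F →+* F[ε]) (hφ : ∀ f, (φ f).fst = f) :
    Derivation ℤ F F :=
  Derivation.mk' (AddMonoidHom.toIntLinearMap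
    { toFun := fun f ↦ (φ f).snd
      map_zero' := by rw [map_zero, TrivSqZeroExt.snd_zero]
      map_add' := fun f g ↦ by rw [map_add, TrivSqZeroExt.snd_add] }) (by
    intro f g
    change (φ (f * g)).snd = f • (φ g).snd + g • (φ f).snd
    rw [map_mul, TrivSqZeroExt.snd_mul, hφ, hφ, op_smul_eq_smul])

lemma derivationOfDual_apply {F : Type*} [Field F] (φ : F →+* F[ε]) (hφ : ∀ f, (φ f).fst = f)
    (f : F) : derivationOfDual φ hφ f = (φ f).snd := rfl

/-- The derivation of the function field over the constants dual to the invariant differential. -/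
def invDeriv := derivationOfDual dualFun fst_dualFun

lemma invDeriv_apply (f : FunField) : invDeriv f = (dualFun f).snd :=
  derivationOfDual_apply dualFun fst_dualFun f

lemma invDeriv_add (f g : FunField) : invDeriv (f + g) = invDeriv f + invDeriv g := by
  simp only [invDeriv_apply, map_add]

lemma invDeriv_mul (f g : FunField) : invDeriv (f * g) = f * invDeriv g + g * invDeriv f := by
  simp only [invDeriv_apply, map_mul, TrivSqZeroExt.snd_mul, fst_dualFun, op_smul_eq_smul,
    smul_eq_mul]

lemma invDeriv_coordToFun (a : CoordRing) : invDeriv (coordToFun a) = (dualCoord a).snd := by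
  rw [invDeriv_apply, dualFun_coordToFun]

lemma invDeriv_const (c : K) : invDeriv (const c) = 0 := by
  rw [← coordToFun_algebraMap, invDeriv_coordToFun, dualCoord_algebraMap, TrivSqZeroExt.snd_inl]

lemma invDeriv_funX : invDeriv funX = derivX := by
  rw [← coordToFun_coordX, invDeriv_coordToFun, dualCoord_coordX]
  simp

lemma invDeriv_funY : invDeriv funY = derivY := by
  rw [← coordToFun_coordY, invDeriv_coordToFun, dualCoord_coordY]
  simp

variable {v : Fin 3 → K} (h : E.toProjective.Equation v) (hz : v 2 ≠ 0)

include h hz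

lemma exists_hasValueAt_invDeriv_coordToFun (a : CoordRing) :
    ∃ c, HasValueAt v (invDeriv (coordToFun a)) c := by
  have vX := hasValueAt_funX hz
  have vY := hasValueAt_funY hz
  have vc := hasValueAt_const v
  induction a using coordRing_induction with
  | hC c =>
    rw [coordToFun_algebraMap, invDeriv_const]
    exact ⟨0, by simpa using vc 0⟩
  | hX =>
    rw [coordToFun_coordX, invDeriv_funX]
    have := (((vc 2).mul vY).add h ((vc E.a₁).mul vX)).add h (vc E.a₃)
    rw [map_ofNat] at this
    exact ⟨_, this⟩
  | hY =>
    rw [coordToFun_coordY, invDeriv_funY]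
    have := ((((vc 3).mul (vX.pow 2)).add h (((vc 2).mul (vc E.a₂)).mul vX)).add h
      (vc E.a₄)).sub h ((vc E.a₁).mul vY)
    rw [map_ofNat, map_ofNat] at this
    exact ⟨_, this⟩
  | hadd a b ha hb =>
    obtain ⟨c, hc⟩ := ha
    obtain ⟨d, hd⟩ := hb
    rw [map_add, invDeriv_add]
    exact ⟨_, hc.add h hd⟩
  | hmul a b ha hb =>
    obtain ⟨c, hc⟩ := ha
    obtain ⟨d, hd⟩ := hb
    rw [map_mul, invDeriv_mul]
    exact ⟨_, ((hasValueAt_coordToFun h hz a).mul hd).add h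
      ((hasValueAt_coordToFun h hz b).mul hc)⟩

/-- The derivation sends `X` and `Y` to polynomials, so it preserves the affine coordinate ring and,
by the quotient rule, every local ring at an affine point. -/
lemma HasValueAt.exists_invDeriv {f : FunField} {c : K} (hf : HasValueAt v f c) :
    ∃ d, HasValueAt v (invDeriv f) d := by
  obtain ⟨a, b, hb, rfl⟩ := hf.exists_div h hz
  obtain ⟨c, hc⟩ := exists_hasValueAt_invDeriv_coordToFun h hz a
  obtain ⟨d, hd⟩ := exists_hasValueAt_invDeriv_coordToFun h hz b
  have hb' := hasValueAt_coordToFun h hz b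
  have hb0 := hb'.ne_zero h hb
  have e : invDeriv (coordToFun a / coordToFun b) =
      (invDeriv (coordToFun a) - coordToFun a / coordToFun b * invDeriv (coordToFun b)) /
        coordToFun b := by
    have := invDeriv_mul (coordToFun a / coordToFun b) (coordToFun b)
    rw [div_mul_cancel₀ _ hb0] at this
    rw [eq_div_iff hb0]
    linear_combination -this
  rw [e]
  exact ⟨_, (hc.sub h (hf.mul hd)).div hb' hb⟩

end Derivation

end GenericCurve

end

noncomputable section

namespace GenericCurve

open WeierstrassCurve MvPolynomial

/-! ### The orders of the division polynomials at affine points -/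

section AffineOrder

variable {v : Fin 3 → K} (h : E.toProjective.Equation v) (hz : v 2 ≠ 0)

lemma hasValueAt_univToFun (a : UnivRing) :
    HasValueAt v (univToFun a) (specialize (equation_affine hz h) a) :=
  hasValueAt_coordToFun h hz (toCoord a)

lemma hasValueAt_psiF (n : ℤ) :
    HasValueAt v (psiF n) (specialize (equation_affine hz h) (psiU n)) := by
  rw [← univToFun_psiU]
  exact hasValueAt_univToFun h hz _

lemma hasValueAt_phiF (n : ℤ) :
    HasValueAt v (phiF n) (specialize (equation_affine hz h) (phiU n)) := by
  rw [← univToFun_phiU]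
  exact hasValueAt_univToFun h hz _

lemma hasValueAt_omegaF (n : ℤ) :
    HasValueAt v (omegaF n) (specialize (equation_affine hz h) (omegaU n)) := by
  rw [← univToFun_omegaU]
  exact hasValueAt_univToFun h hz _

lemma killsCoeffs_invDeriv : KillsCoeffs invDeriv funCurve :=
  ⟨invDeriv_const _, invDeriv_const _, invDeriv_const _, invDeriv_const _, invDeriv_const _⟩

open scoped Classical in
lemma invDeriv_psiF {n : ℤ} (hn : 1 ≤ n) :
    psiF n * invDeriv (phiF n) - 2 * phiF n * invDeriv (psiF n) =
      n * (2 * omegaF n + const E.a₁ * phiF n * psiF n + const E.a₃ * psiF n ^ 3) :=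
  deriv_psiVal killsCoeffs_invDeriv psiF_ne_zero invDeriv_funX two_ne_zero nonsingular_generic hn

include h hz in
lemma hasOrderAt_zero_of_ne {f : FunField} {c : K} (hf : HasValueAt v f c) (hc : c ≠ 0) :
    HasOrderAt v f 0 := by
  obtain ⟨t, ht, -⟩ := exists_isUniformizerAt_affine h hz
  exact ⟨t, f, c, ht, hf, hc, by rw [zpow_zero, one_mul]⟩

/-- Write `Ψ_n = t u` with a uniformizer `t`. If `u` vanished at the point too, so would `DΨ_n = t
Du + u Dt`, and `invDeriv_psiF` would give `2nΩ_n = 0` there; but `Ψ_n` and `Ω_n` have no common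
zero. -/
lemma hasOrderAt_psiF_one_of_pos {n : ℤ} (hn : 1 ≤ n)
    (h0 : specialize (equation_affine hz h) (psiU n) = 0) : HasOrderAt v (psiF n) 1 := by
  obtain ⟨t, ht, -⟩ := exists_isUniformizerAt_affine h hz
  have vψ := hasValueAt_psiF h hz n
  rw [h0] at vψ
  have vφ := hasValueAt_phiF h hz n
  have vω := hasValueAt_omegaF h hz n
  have vc := hasValueAt_const v
  obtain ⟨d, hd⟩ := vφ.exists_invDeriv h hz
  obtain ⟨e, he⟩ := vψ.exists_invDeriv h hz
  obtain ⟨u, c, hu, hψ⟩ := ht.2 _ vψ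
  obtain ⟨t', ht'⟩ := ht.1.exists_invDeriv h hz
  obtain ⟨u', hu'⟩ := hu.exists_invDeriv h hz
  refine ⟨t, u, c, ht, hu, ?_, by rw [zpow_one, hψ]⟩
  rintro rfl
  have he0 : e = 0 := by
    have := (ht.1.mul hu').add h (hu.mul ht')
    rw [← invDeriv_mul, ← hψ] at this
    simpa using he.unique h this
  rw [he0] at he
  have v2 := vc 2
  rw [map_ofNat] at v2
  have vn := vc n
  rw [map_intCast] at vn
  have hl := (vψ.mul hd).sub h ((v2.mul vφ).mul he)
  have hr := vn.mul (((v2.mul vω).add h (((vc E.a₁).mul vφ).mul vψ)).add h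
    ((vc E.a₃).mul (vψ.pow 3)))
  rw [invDeriv_psiF hn] at hl
  have := hl.unique h hr
  simp only [zero_mul, mul_zero, sub_zero, ne_eq, OfNat.ofNat_ne_zero, not_false_eq_true,
    zero_pow, add_zero, zero_eq_mul, Int.cast_eq_zero] at this
  rcases this with this | this
  · lia
  · exact specialize_omegaU_ne_zero hz h n h0 ((mul_eq_zero.mp this).resolve_left two_ne_zero)

lemma psiF_neg (n : ℤ) : psiF (-n) = -psiF n := psiVal_neg n

lemma psiU_neg (n : ℤ) : psiU (-n) = -psiU n := by
  apply univToFun_injective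
  rw [map_neg, univToFun_psiU, univToFun_psiU, psiF_neg]

lemma HasOrderAt.neg {f : FunField} {k : ℤ} (hf : HasOrderAt v f k) : HasOrderAt v (-f) k := by
  obtain ⟨t, u, c, ht, hu, hc, rfl⟩ := hf
  exact ⟨t, -u, -c, ht, hu.neg, neg_ne_zero.mpr hc, by rw [mul_neg]⟩

lemma hasOrderAt_psiF_one {n : ℤ} (hn : n ≠ 0)
    (h0 : specialize (equation_affine hz h) (psiU n) = 0) : HasOrderAt v (psiF n) 1 := by
  obtain hn | hn : 1 ≤ n ∨ 1 ≤ -n := by lia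
  · exact hasOrderAt_psiF_one_of_pos h hz hn h0
  · have := (hasOrderAt_psiF_one_of_pos h hz hn (by rw [psiU_neg, map_neg, h0, neg_zero])).neg
    rwa [psiF_neg, neg_neg] at this

end AffineOrder

/-! ### The point at infinity -/

section Infinity

variable {v : Fin 3 → K} (h : E.toProjective.Equation v) (hy : v 1 ≠ 0) (hz : v 2 = 0)

lemma funX_ne_zero : funX ≠ 0 := by
  rw [← coordToFun_coordX]
  refine (map_ne_zero_iff _ coordToFun_injective).mpr fun h' ↦ ?_
  have := poleOrder_coordX (W := E)
  rw [h', poleOrder_eq_bot.mpr rfl] at this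
  exact absurd this.symm WithBot.coe_ne_bot

lemma funY_ne_zero : funY ≠ 0 := by
  rw [← coordToFun_coordY]
  refine (map_ne_zero_iff _ coordToFun_injective).mpr fun h' ↦ ?_
  have := poleOrder_coordY (W := E)
  rw [h', poleOrder_eq_bot.mpr rfl] at this
  exact absurd this.symm WithBot.coe_ne_bot

lemma dehomogenize_X (i : Fin 3) : dehomogenize (X i) = ![funX, funY, 1] i := eval₂_X _ _ _

include h hy hz

lemma hasValueAt_funX_div_funY : HasValueAt v (funX / funY) 0 :=
  ⟨1, X 0, X 1, isHomogeneous_X _ _, isHomogeneous_X _ _, by simpa using hy,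
    by simp [dehomogenize_X], by simp [X_eq_zero_of_equation h hz]⟩

omit h in
lemma hasValueAt_funY_inv : HasValueAt v funY⁻¹ 0 :=
  ⟨1, X 2, X 1, isHomogeneous_X _ _, isHomogeneous_X _ _, by simpa using hy,
    by simp [dehomogenize_X], by simp [hz]⟩

/-- Divided by `Y²`, the curve equation expresses `X³/Y²` as `1` plus terms that vanish at infinity.
-/
lemma hasValueAt_funX_cube_div_funY_sq : HasValueAt v (funX ^ 3 / funY ^ 2) 1 := by
  have vt := hasValueAt_funX_div_funY h hy hz
  have vi := hasValueAt_funY_inv hy hz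
  have vc := hasValueAt_const v
  have hgen := (Affine.equation_iff' _ _).mp equation_fun
  simp only [funCurve, map_a₁, map_a₂, map_a₃, map_a₄, map_a₆] at hgen
  have := ((((((vc 1).add h ((vc E.a₁).mul vt)).add h ((vc E.a₃).mul vi)).sub h
    ((vc E.a₂).mul (vt.pow 2))).sub h ((vc E.a₄).mul (vt.mul vi))).sub h
      ((vc E.a₆).mul (vi.pow 2)))
  have e : funX ^ 3 / funY ^ 2 = const 1 + const E.a₁ * (funX / funY) + const E.a₃ * funY⁻¹ -
      const E.a₂ * (funX / funY) ^ 2 - const E.a₄ * (funX / funY * funY⁻¹) -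
      const E.a₆ * funY⁻¹ ^ 2 := by
    have := funY_ne_zero
    rw [map_one]
    field_simp
    linear_combination -hgen
  rw [e]
  simpa using this

lemma hasValueAt_funX_inv : HasValueAt v funX⁻¹ 0 := by
  have := ((hasValueAt_funX_div_funY h hy hz).pow 2).div
    (hasValueAt_funX_cube_div_funY_sq h hy hz) one_ne_zero
  have e : (funX / funY) ^ 2 / (funX ^ 3 / funY ^ 2) = funX⁻¹ := by
    have := funX_ne_zero
    have := funY_ne_zero
    field_simp
  rw [e] at this
  simpa using this

/-- A monomial other than `y ^ d` contains `x` or `z`. Trading that factor for `y` extracts `x/y =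
X/Y` in the first case and `z/y = (X/Y)X⁻¹` in the second, where `X⁻¹` is regular at infinity. -/
lemma exists_monomial_eq_mul {G : MvPolynomial (Fin 3) K} {d : ℕ} (hG : G.IsHomogeneous d)
    (h0 : eval v G ≠ 0) {m : Fin 3 →₀ ℕ} (hm : m.degree = d) (hne : m ≠ expY d) (c : K) :
    ∃ (u : FunField) (b : K), HasValueAt v u b ∧
      dehomogenize (monomial m c) / dehomogenize G = funX / funY * u := by
  have key (i : Fin 3) (hi : m i ≠ 0) : ∃ b, HasValueAt v
      (dehomogenize (X 1 * monomial (m - Finsupp.single i 1) c) / dehomogenize G) b ∧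
      dehomogenize (monomial m c) =
        ![funX, funY, 1] i * dehomogenize (monomial (m - Finsupp.single i 1) c) := by
    have hle : Finsupp.single i 1 ≤ m := by
      rw [Finsupp.single_le_iff]; lia
    have hdeg : (m - Finsupp.single i 1).degree + 1 = d := by
      have := congrArg Finsupp.degree (tsub_add_cancel_of_le hle)
      rw [map_add, Finsupp.degree_single, hm] at this
      exact this
    refine ⟨_, ⟨d, _, G, ?_, hG, h0, rfl, rfl⟩, ?_⟩
    · have := (isHomogeneous_X K (1 : Fin 3)).mul
        (isHomogeneous_monomial c (d := m - Finsupp.single i 1) rfl)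
      rwa [add_comm, hdeg] at this
    · rw [← dehomogenize_X, ← dehomogenize_mul]
      congr 1
      rw [X, monomial_mul, one_mul, add_tsub_cancel_of_le hle]
  have hX := funX_ne_zero
  have hY := funY_ne_zero
  by_cases hm0 : m 0 = 0
  · have hm2 : m 2 ≠ 0 := fun hm2 ↦ hne (eq_expY hm0 hm2 (by
      rw [← hm, Finsupp.degree_eq_sum, Fin.sum_univ_three]))
    obtain ⟨b, hb, e⟩ := key 2 hm2
    refine ⟨_, _, hb.mul (hasValueAt_funX_inv h hy hz), ?_⟩
    rw [e, dehomogenize_mul, dehomogenize_X]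
    simp only [Matrix.cons_val]
    field_simp
  · obtain ⟨b, hb, e⟩ := key 0 hm0
    refine ⟨_, _, hb, ?_⟩
    rw [e, dehomogenize_mul, dehomogenize_X]
    simp only [Matrix.cons_val]
    field_simp

/-- The function `X / Y` is a uniformizer at infinity. -/
lemma isUniformizerAt_infinity : IsUniformizerAt v (funX / funY) := by
  refine ⟨hasValueAt_funX_div_funY h hy hz, ?_⟩
  rintro g ⟨d, F, G, hF, hG, h0, rfl, hv⟩
  have hF0 : F.coeff (expY d) = 0 := by
    have := (div_eq_zero_iff.mp hv.symm).resolve_right h0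
    rw [eval_infinity (X_eq_zero_of_equation h hz) hz hF] at this
    exact (mul_eq_zero.mp this).resolve_right (pow_ne_zero d hy)
  have key (s : Finset (Fin 3 →₀ ℕ)) (hs : s ⊆ F.support) : ∃ (u : FunField) (b : K),
      HasValueAt v u b ∧ dehomogenize (∑ m ∈ s, monomial m (F.coeff m)) / dehomogenize G =
        funX / funY * u := by
    classical
    induction s using Finset.induction with
    | empty =>
      refine ⟨0, 0, by simpa using hasValueAt_const v 0, ?_⟩
      rw [Finset.sum_empty, dehomogenize, eval₂_zero, zero_div, mul_zero]
    | insert a s ha ih =>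
      obtain ⟨u, b, hu, e⟩ := ih ((Finset.subset_insert a s).trans hs)
      have ha' := hs (Finset.mem_insert_self a s)
      obtain ⟨u', b', hu', e'⟩ := exists_monomial_eq_mul h hy hz hG h0 (m := a)
        (by rw [Finsupp.degree_eq_sum, Fin.sum_univ_three, degree_eq_three hF ha'])
        (by rintro rfl; exact mem_support_iff.mp ha' hF0) (F.coeff a)
      refine ⟨u' + u, b' + b, hu'.add h hu, ?_⟩
      rw [Finset.sum_insert ha, dehomogenize_add, add_div, e, e', mul_add]
  obtain ⟨u, b, hu, e⟩ := key _ subset_rfl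
  refine ⟨u, b, hu, ?_⟩
  rwa [← F.as_sum] at e

omit hy hz in
lemma HasValueAt.sum {ι : Type*} (s : Finset ι) {f : ι → FunField} {c : ι → K}
    (hf : ∀ i ∈ s, HasValueAt v (f i) (c i)) : HasValueAt v (∑ i ∈ s, f i) (∑ i ∈ s, c i) := by
  classical
  induction s using Finset.induction with
  | empty => simpa using hasValueAt_const v 0
  | insert a s ha ih =>
    rw [Finset.sum_insert ha, Finset.sum_insert ha]
    exact (hf a (Finset.mem_insert_self a s)).add h
      (ih fun i hi ↦ hf i (Finset.mem_insert_of_mem hi))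

lemma hasValueAt_eval₂_funX (p : Polynomial K) :
    HasValueAt v (funX⁻¹ ^ p.natDegree * Polynomial.eval₂ const funX p) p.leadingCoeff := by
  have vi := hasValueAt_funX_inv h hy hz
  have := HasValueAt.sum h (Finset.range (p.natDegree + 1))
    (f := fun i ↦ const (p.coeff i) * funX⁻¹ ^ (p.natDegree - i))
    (c := fun i ↦ p.coeff i * 0 ^ (p.natDegree - i))
    fun i _ ↦ (hasValueAt_const v _).mul (vi.pow _)
  have hs : ∑ i ∈ Finset.range (p.natDegree + 1), p.coeff i * 0 ^ (p.natDegree - i) =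
      p.leadingCoeff := by
    rw [Finset.sum_range_succ, Finset.sum_eq_zero, zero_add, tsub_self, pow_zero, mul_one,
      Polynomial.leadingCoeff]
    intro i hi
    rw [zero_pow (Nat.sub_ne_zero_of_lt (Finset.mem_range.mp hi)), mul_zero]
  rw [hs] at this
  convert this using 1
  rw [Polynomial.eval₂_eq_sum_range, Finset.mul_sum]
  refine Finset.sum_congr rfl fun i hi ↦ ?_
  obtain ⟨j, hj⟩ := Nat.exists_eq_add_of_le (Nat.lt_succ_iff.mp (Finset.mem_range.mp hi))
  rw [hj, add_tsub_cancel_left, pow_add, inv_pow, inv_pow]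
  have := pow_ne_zero i funX_ne_zero
  field_simp

omit h hy hz in
lemma psiF_eq (n : ℤ) : psiF n = Polynomial.eval₂ const funX (E.preΨ n) *
    if Even n then 2 * funY + const E.a₁ * funX + const E.a₃ else 1 := by
  have e (p : Polynomial K) : coordToFun (Affine.CoordinateRing.mk E.toAffine (Polynomial.C p)) =
      Polynomial.eval₂ const funX p := by
    rw [mk_C_eq_eval, Polynomial.hom_eval₂, coordToFun_coordX]
    rfl
  have e2 : coordToFun (Affine.CoordinateRing.mk E.toAffine E.ψ₂) =
      2 * funY + const E.a₁ * funX + const E.a₃ := by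
    rw [ψ₂, Affine.polynomialY]
    simp only [map_add, map_mul, mk_C_C]
    rw [← coordY, ← coordX, coordToFun_coordX, coordToFun_coordY]
    simp only [coordToFun_algebraMap, map_ofNat]
    ring
  rw [← univToFun_psiU, univToFun, RingHom.comp_apply, toCoord_psiU,
    Affine.CoordinateRing.mk_ψ, WeierstrassCurve.Ψ, map_mul, map_mul, e]
  split_ifs
  · rw [e2]
  · rw [map_one, map_one]

/-- Since `(X/Y)² = (X³/Y²)X⁻¹` and `X³/Y²` has value `1`, an even power of `X/Y` acts as half that
power of `X⁻¹`. It thus normalizes `preΨ` to its leading coefficient, which is `n` for odd `n` and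
`n/2` for even `n`; the remaining factor for even `n` supplies the `2`. -/
lemma hasValueAt_infinity_psiF {n : ℤ} (hn : n ≠ 0) :
    HasValueAt v ((funX / funY) ^ (n ^ 2 - 1) * psiF n) n := by
  have hX := funX_ne_zero
  have hY := funY_ne_zero
  have hn' : (n : K) ≠ 0 := Int.cast_ne_zero.mpr hn
  have vs := hasValueAt_funX_cube_div_funY_sq h hy hz
  have vp := hasValueAt_eval₂_funX h hy hz (E.preΨ n)
  rw [E.natDegree_preΨ hn', E.leadingCoeff_preΨ hn'] at vp
  rw [psiF_eq]
  have hpow (j : ℕ) : (funX / funY) ^ (2 * j) = (funX ^ 3 / funY ^ 2) ^ j * funX⁻¹ ^ j := by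
    rw [pow_mul, ← mul_pow]
    congr 1
    field_simp
  have hsq : n ^ 2 = ((n.natAbs ^ 2 : ℕ) : ℤ) := by rw [Nat.cast_pow, Int.natCast_natAbs, sq_abs]
  by_cases hev : Even n
  · rw [if_pos hev] at vp ⊢
    rw [if_pos hev] at vp
    obtain ⟨k, hk⟩ := hev
    -- Here `j = (n² - 4)/2` is the degree of `preΨ` for even `n`.
    obtain ⟨j, hj⟩ : ∃ j, n.natAbs ^ 2 = 2 * j + 4 := by
      refine ⟨2 * (k.natAbs ^ 2 - 1), ?_⟩
      have h1 : 1 ≤ k.natAbs ^ 2 := Nat.one_le_pow _ _ (Int.natAbs_pos.mpr (by lia))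
      have h2 : n.natAbs = 2 * k.natAbs := by lia
      rw [h2, mul_pow]
      lia
    rw [hj, show (2 * j + 4 - 4) / 2 = j by lia] at vp
    have vt := hasValueAt_funX_div_funY h hy hz
    have vi := hasValueAt_funY_inv hy hz
    have vc := hasValueAt_const v
    -- The exponent is `n² - 1 = 2j + 3`. The extra cube gives `(X/Y)³(2Y + a₁X + a₃) = (X³/Y²)(2 +
    -- a₁X/Y + a₃/Y)`.
    have := (((vs.pow j).mul vp).mul vs).mul
      (((vc 2).add h ((vc E.a₁).mul vt)).add h ((vc E.a₃).mul vi))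
    have e1 : n ^ 2 - 1 = ((2 * j + 3 : ℕ) : ℤ) := by rw [hsq, hj]; push_cast; ring
    rw [e1, zpow_natCast]
    convert this using 1
    · rw [map_ofNat, pow_add, hpow]
      field_simp
    · rw [hk, show (k + k) / 2 = k by lia]
      push_cast
      ring
  · rw [if_neg hev] at vp ⊢
    rw [if_neg hev] at vp
    obtain ⟨j, hj⟩ : ∃ j, n.natAbs ^ 2 = 2 * j + 1 := by
      rw [Int.not_even_iff_odd, ← Int.natAbs_odd] at hev
      exact hev.pow
    rw [hj, show (2 * j + 1 - 1) / 2 = j by lia] at vp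
    have := (vs.pow j).mul vp
    have e1 : n ^ 2 - 1 = ((2 * j : ℕ) : ℤ) := by rw [hsq, hj]; push_cast; ring
    rw [e1, zpow_natCast]
    rw [hpow, mul_one, mul_assoc]
    simpa using this

lemma hasOrderAt_infinity_psiF {n : ℤ} (hn : n ≠ 0) :
    HasOrderAt v (psiF n) (-(n ^ 2 - 1)) := by
  refine ⟨_, _, _, isUniformizerAt_infinity h hy hz, hasValueAt_infinity_psiF h hy hz hn,
    Int.cast_ne_zero.mpr hn, ?_⟩
  have : funX / funY ≠ 0 := div_ne_zero funX_ne_zero funY_ne_zero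
  rw [← mul_assoc, ← zpow_add₀ this, neg_add_cancel, zpow_zero, one_mul]

end Infinity

lemma Y_ne_zero_of_equation {v : Fin 3 → K} (hv : v ≠ 0) (h : E.toProjective.Equation v)
    (hz : v 2 = 0) : v 1 ≠ 0 := by
  intro hy
  apply hv
  ext i
  fin_cases i
  · exact X_eq_zero_of_equation h hz
  · exact hy
  · exact hz

lemma equation_infinity : E.toProjective.Equation ![0, 1, 0] := by
  rw [Projective.equation_iff]
  simp

lemma isDivisionPolynomial_psiF (n : ℤ) : IsDivisionPolynomial n (psiF n) := by
  refine ⟨?_, fun hn ↦ ⟨fun v hv h ↦ ?_, ?_⟩⟩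
  · rintro rfl
    exact psiVal_zero
  · rw [divisionDivisor]
    by_cases hz : v 2 = 0
    · rw [if_pos (point_eq_zero hv hz h)]
      exact hasOrderAt_infinity_psiF h (Y_ne_zero_of_equation hv h hz) hz hn
    · rw [if_neg (point_ne_zero hv hz h), zsmul_point_eq_zero_iff hv hz h]
      split_ifs with h0
      · exact hasOrderAt_psiF_one h hz hn h0
      · exact hasOrderAt_zero_of_ne h hz (hasValueAt_psiF h hz n) h0
  · refine ⟨-(n ^ 2 - 1), hasOrderAt_infinity_psiF equation_infinity (by simp) (by simp) hn, ?_⟩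
    rw [neg_neg]
    exact hasValueAt_infinity_psiF equation_infinity (by simp) (by simp) hn

end GenericCurve

end

noncomputable section

namespace GenericCurve

open WeierstrassCurve MvPolynomial

/-! ### Uniqueness of functions with a given divisor -/

section Uniqueness

lemma exists_isUniformizerAt_ne_zero {v : Fin 3 → K} (hv : v ≠ 0)
    (h : E.toProjective.Equation v) : ∃ t : FunField, IsUniformizerAt v t ∧ t ≠ 0 := by
  by_cases hz : v 2 = 0
  · exact ⟨_, isUniformizerAt_infinity h (Y_ne_zero_of_equation hv h hz) hz,
      div_ne_zero funX_ne_zero funY_ne_zero⟩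
  · obtain ⟨t, ht, e⟩ := exists_isUniformizerAt_affine h hz
    refine ⟨t, ht, ?_⟩
    have key {a : CoordRing} {m : ℕ} (ha : poleOrder a = ((m + 1 : ℕ) : WithBot ℕ)) (c : K) :
        coordToFun a - const c ≠ 0 := by
      intro h0
      rw [← coordToFun_algebraMap, sub_eq_zero] at h0
      have h1 := coordToFun_injective h0
      by_cases hc : c = 0
      · rw [h1, hc, map_zero, poleOrder_eq_bot.mpr rfl] at ha
        exact absurd ha.symm WithBot.coe_ne_bot
      · rw [h1, poleOrder_algebraMap hc] at ha
        exact absurd (Nat.cast_injective (R := WithBot ℕ) (by simpa using ha))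
          (Nat.succ_ne_zero m).symm
    rcases e with rfl | rfl
    · rw [← coordToFun_coordX]
      exact key (m := 1) poleOrder_coordX _
    · rw [← coordToFun_coordY]
      exact key (m := 2) poleOrder_coordY _

lemma IsUniformizerAt.ne_zero {v : Fin 3 → K} (hv : v ≠ 0) (h : E.toProjective.Equation v)
    {t : FunField} (ht : IsUniformizerAt v t) : t ≠ 0 := by
  rintro rfl
  obtain ⟨s, hs, h0⟩ := exists_isUniformizerAt_ne_zero hv h
  obtain ⟨u, -, -, e⟩ := ht.2 s hs.1
  exact h0 (by rw [e, zero_mul])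

lemma HasOrderAt.ne_zero {v : Fin 3 → K} (hv : v ≠ 0) (h : E.toProjective.Equation v)
    {f : FunField} {k : ℤ} (hf : HasOrderAt v f k) : f ≠ 0 := by
  obtain ⟨t, u, c, ht, hu, hc, rfl⟩ := hf
  exact mul_ne_zero (zpow_ne_zero k (ht.ne_zero hv h)) (hu.ne_zero h hc)

/-- Each of two uniformizers divides the other in the local ring, so their ratio is a local unit and
the `k`-th powers cancel up to a unit. -/
lemma HasOrderAt.exists_hasValueAt_div {v : Fin 3 → K} (hv : v ≠ 0)
    (h : E.toProjective.Equation v) {f g : FunField} {k : ℤ} (hf : HasOrderAt v f k)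
    (hg : HasOrderAt v g k) : ∃ c, HasValueAt v (f / g) c := by
  obtain ⟨t, u, c, ht, hu, hc, rfl⟩ := hf
  obtain ⟨s, w, d, hs, hw, hd, rfl⟩ := hg
  obtain ⟨p, a, hp, e⟩ := hs.2 t ht.1
  obtain ⟨q, b, hq, e'⟩ := ht.2 s hs.1
  have ht0 := ht.ne_zero hv h
  have hs0 := hs.ne_zero hv h
  have hpq : q * p = 1 := by
    apply mul_left_cancel₀ ht0
    rw [← mul_assoc, ← e', ← e, mul_one]
  have hab : b * a ≠ 0 := by
    have h1 := hq.mul hp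
    rw [hpq] at h1
    rw [h1.unique h (by simpa using hasValueAt_const v 1)]
    exact one_ne_zero
  have ep : t ^ k * u / (s ^ k * w) = p ^ k * u / w := by
    have hw0 := hw.ne_zero h hd
    have : t ^ k = s ^ k * p ^ k := by rw [← mul_zpow, ← e]
    rw [this]
    have := zpow_ne_zero k hs0
    field_simp
  rw [ep]
  exact ⟨_, ((hp.zpow (right_ne_zero_of_mul hab) k).mul hu).div hw hd⟩

instance : Algebra.FiniteType K CoordRing := by
  have : Algebra.FiniteType K (Polynomial (Polynomial K)) :=
    Algebra.FiniteType.trans (S := Polynomial K) inferInstance inferInstance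
  exact Algebra.FiniteType.of_surjective
    ({ Affine.CoordinateRing.mk E.toAffine with commutes' := fun _ ↦ rfl } :
      Polynomial (Polynomial K) →ₐ[K] CoordRing) AdjoinRoot.mk_surjective

/-- Maximal ideals of the affine coordinate ring are points of the curve. -/
lemma exists_point_of_isMaximal {I : Ideal CoordRing} (hI : I.IsMaximal) :
    ∃ (x y : K) (h : E.toAffine.Equation x y), ∀ a, a ∈ I ↔ evalAt h a = 0 := by
  let := Ideal.Quotient.field I
  have : Module.Finite K (CoordRing ⧸ I) :=
    finite_of_finite_type_of_isJacobsonRing K (CoordRing ⧸ I)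
  have hbij := IsAlgClosed.algebraMap_bijective_of_isIntegral (k := K) (K := CoordRing ⧸ I)
  let e := RingEquiv.ofBijective (algebraMap K (CoordRing ⧸ I)) hbij
  let f : CoordRing →+* K := (e.symm : (CoordRing ⧸ I) →+* K).comp (Ideal.Quotient.mk I)
  have hf (c : K) : f (algebraMap K CoordRing c) = c := e.symm_apply_apply c
  have h : E.toAffine.Equation (f (coordX E)) (f (coordY E)) := by
    have hW : (coordCurve E).map f = E := by
      rw [coordCurve, WeierstrassCurve.map_map,
        show f.comp (algebraMap K E.toAffine.CoordinateRing) = RingHom.id K from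
          RingHom.ext hf, WeierstrassCurve.map_id]
    have := (equation_coord E).map f
    rw [show (coordCurve E).toAffine.map f = E from hW] at this
    exact this
  refine ⟨_, _, h, fun a ↦ ?_⟩
  have hfe : f a = evalAt h a := by
    induction a using coordRing_induction with
    | hC c => rw [hf, evalAt_algebraMap]
    | hX => rw [evalAt_coordX]
    | hY => rw [evalAt_coordY]
    | hadd a b ha hb => rw [map_add, map_add, ha, hb]
    | hmul a b ha hb => rw [map_mul, map_mul, ha, hb]
  rw [← hfe, ← Ideal.Quotient.eq_zero_iff_mem]
  exact (map_eq_zero_iff _ e.symm.injective).symm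

/-- A function regular at every affine point lies in the affine coordinate ring. -/
lemma exists_coordToFun_eq {f : FunField}
    (hf : ∀ (v : Fin 3 → K), v 2 ≠ 0 → E.toProjective.Equation v → ∃ c, HasValueAt v f c) :
    ∃ a, coordToFun a = f := by
  -- The ideal of denominators of `f`. If proper, it would lie in the maximal ideal of some point of
  -- the curve, but regularity there provides a denominator not vanishing at that point.
  let I : Ideal CoordRing :=
    { carrier := {s | ∃ a, coordToFun a = coordToFun s * f}
      add_mem' := by
        rintro s t ⟨a, ha⟩ ⟨b, hb⟩
        exact ⟨a + b, by rw [map_add, map_add, ha, hb, add_mul]⟩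
      zero_mem' := ⟨0, by rw [map_zero, zero_mul]⟩
      smul_mem' := by
        rintro s t ⟨a, ha⟩
        exact ⟨s * a, by rw [smul_eq_mul, map_mul, map_mul, ha, mul_assoc]⟩ }
  have hI : I = ⊤ := by
    by_contra hI
    obtain ⟨M, hM, hle⟩ := I.exists_le_maximal hI
    obtain ⟨x, y, h, hmem⟩ := exists_point_of_isMaximal hM
    have hz : (![x, y, 1] : Fin 3 → K) 2 ≠ 0 := one_ne_zero
    have hv : E.toProjective.Equation ![x, y, 1] := (Projective.equation_some x y).mpr h
    obtain ⟨c, hc⟩ := hf _ hz hv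
    obtain ⟨a, b, hb, rfl⟩ := hc.exists_div hv hz
    have hb' : evalAt h b ≠ 0 := by
      have key : ∀ (x' y' : K) (h' : E.toAffine.Equation x' y') (_ : x' = x) (_ : y' = y)
          (_ : evalAt h' b ≠ 0), evalAt h b ≠ 0 := by
        rintro _ _ _ rfl rfl H
        exact H
      exact key _ _ _ (by simp) (by simp) hb
    apply hb'
    rw [← hmem]
    apply hle
    refine ⟨a, ?_⟩
    have hb0 : coordToFun b ≠ 0 := (map_ne_zero_iff _ coordToFun_injective).mpr (by
      rintro rfl
      exact hb' (map_zero _))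
    rw [mul_div_cancel₀ _ hb0]
  have h1 : (1 : CoordRing) ∈ I := hI ▸ Submodule.mem_top
  obtain ⟨a, ha⟩ := h1
  exact ⟨a, by rw [ha, map_one, one_mul]⟩

lemma exists_algebraMap_eq {a : CoordRing} (ha : poleOrder a ≤ 0) :
    ∃ c : K, algebraMap K CoordRing c = a := by
  obtain ⟨p, q, rfl⟩ := Affine.CoordinateRing.exists_smul_basis_eq a
  rw [← coordY, poleOrder_smul_basis] at ha
  have hq : q = 0 := by
    by_contra hq
    rw [Polynomial.degree_eq_natDegree hq] at ha
    have h3 : ((q.natDegree + q.natDegree + 3 : ℕ) : WithBot ℕ) ≤ ((0 : ℕ) : WithBot ℕ) := by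
      refine le_trans (le_of_eq ?_) ((le_max_right _ _).trans ha)
      rw [two_smul]
      push_cast
      rfl
    have := Nat.cast_le.mp h3
    lia
  have hp : p.degree ≤ 0 := by
    by_contra hp
    have hp0 : p ≠ 0 := by
      rintro rfl
      exact hp (by rw [Polynomial.degree_zero]; exact bot_le)
    rw [Polynomial.degree_eq_natDegree hp0] at ha hp
    have h3 : ((p.natDegree + p.natDegree : ℕ) : WithBot ℕ) ≤ ((0 : ℕ) : WithBot ℕ) := by
      refine le_trans (le_of_eq ?_) ((le_max_left _ _).trans ha)
      rw [two_smul]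
      push_cast
      rfl
    have h4 := Nat.cast_le.mp h3
    have h5 : p.natDegree = 0 := by lia
    exact hp (by rw [h5]; rfl)
  refine ⟨p.coeff 0, ?_⟩
  rw [hq, zero_smul, add_zero, Polynomial.eq_C_of_degree_le_zero hp, Polynomial.coeff_C_zero,
    Affine.CoordinateRing.smul, mul_one]
  exact (mk_C_C E _).symm

lemma poleOrder_eq_zero_of_mul_eq_one {a b : CoordRing} (h : a * b = 1) : poleOrder a ≤ 0 := by
  have h1 : poleOrder (1 : CoordRing) = 0 := by
    have := poleOrder_algebraMap (W := E) (one_ne_zero (α := K))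
    rwa [map_one] at this
  have hab := poleOrder_mul a b
  rw [h, h1] at hab
  have ha : poleOrder a ≠ ⊥ := by
    intro h'
    rw [poleOrder_eq_bot.mp h', zero_mul] at h
    exact zero_ne_one h
  have hb : poleOrder b ≠ ⊥ := by
    intro h'
    rw [poleOrder_eq_bot.mp h', mul_zero] at h
    exact zero_ne_one h
  obtain ⟨m, hm⟩ := WithBot.ne_bot_iff_exists.mp ha
  obtain ⟨k, hk⟩ := WithBot.ne_bot_iff_exists.mp hb
  rw [← hm, ← hk, ← WithBot.coe_add] at hab
  have : 0 = m + k := WithBot.coe_injective hab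
  rw [← hm]
  have : m = 0 := by lia
  rw [this]
  rfl

/-- Both `f / g` and `g / f` are regular at all affine points, so they are mutually inverse units of
the coordinate ring; pole orders add and are nonnegative, hence vanish, and only constants have pole
order zero. The point at infinity serves only to show `f, g ≠ 0`. -/
lemma exists_const_of_hasOrderAt {f g : FunField} {k : (Fin 3 → K) → ℤ}
    (hf : ∀ v, v ≠ 0 → E.toProjective.Equation v → HasOrderAt v f (k v))
    (hg : ∀ v, v ≠ 0 → E.toProjective.Equation v → HasOrderAt v g (k v)) :
    ∃ c : K, f = const c * g := by
  have hi : (![0, 1, 0] : Fin 3 → K) ≠ 0 := fun h ↦ one_ne_zero (congrFun h 1)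
  have hf0 := (hf _ hi equation_infinity).ne_zero hi equation_infinity
  have hg0 := (hg _ hi equation_infinity).ne_zero hi equation_infinity
  have hne {v : Fin 3 → K} (hz : v 2 ≠ 0) : v ≠ 0 := fun h ↦ hz (congrFun h 2)
  obtain ⟨a, ha⟩ := exists_coordToFun_eq (f := f / g) fun v hz h ↦
    (hf v (hne hz) h).exists_hasValueAt_div (hne hz) h (hg v (hne hz) h)
  obtain ⟨b, hb⟩ := exists_coordToFun_eq (f := g / f) fun v hz h ↦
    (hg v (hne hz) h).exists_hasValueAt_div (hne hz) h (hf v (hne hz) h)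
  have hab : a * b = 1 := by
    apply coordToFun_injective
    rw [map_mul, ha, hb, map_one]
    field_simp
  obtain ⟨c, rfl⟩ := exists_algebraMap_eq (poleOrder_eq_zero_of_mul_eq_one hab)
  refine ⟨c, ?_⟩
  rw [← coordToFun_algebraMap, ha, div_mul_cancel₀ _ hg0]

/-- The two normalizing exponents are not assumed equal. The quotient `c (X/Y)^(k - l)` has value
`1` at infinity, and for `k ≠ l` it or its inverse would vanish there. -/
lemma HasLeadingCoeff.eq_one {f : FunField} {c d : K} (hd : d ≠ 0) (hf : HasLeadingCoeff f d)
    (hcf : HasLeadingCoeff (const c * f) d) : c = 1 := by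
  obtain ⟨k, -, hk⟩ := hf
  obtain ⟨l, -, hl⟩ := hcf
  have ht0 : funX / funY ≠ 0 := div_ne_zero funX_ne_zero funY_ne_zero
  have ht := hasValueAt_funX_div_funY (v := ![0, 1, 0]) equation_infinity (by simp) (by simp)
  have heq := equation_infinity
  have hf0 : f ≠ 0 := right_ne_zero_of_mul (hk.ne_zero heq hd)
  have hq := hl.div hk hd
  rw [div_self hd] at hq
  have e : (funX / funY) ^ (-l) * (const c * f) / ((funX / funY) ^ (-k) * f) =
      const c * (funX / funY) ^ (k - l) := by
    rw [show k - l = -l - -k by ring, zpow_sub₀ ht0]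
    have := zpow_ne_zero (-k) ht0
    field_simp
  rw [e] at hq
  have vc := hasValueAt_const ![0, 1, 0]
  have hc0 : c ≠ 0 := by
    rintro rfl
    rw [map_zero, zero_mul] at hq
    exact one_ne_zero (hq.unique heq (by simpa using vc 0))
  obtain hkl | hkl | hkl := lt_trichotomy (k - l) 0
  · obtain ⟨m, hm⟩ : ∃ m : ℕ, k - l = -((m + 1 : ℕ) : ℤ) := ⟨(l - k - 1).toNat, by lia⟩
    have h1 := (hq.inv one_ne_zero)
    rw [hm, zpow_neg, mul_inv, inv_inv, zpow_natCast, ← map_inv₀] at h1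
    have h2 := h1.unique heq ((vc c⁻¹).mul (ht.pow (m + 1)))
    simp at h2
  · rw [hkl, zpow_zero, mul_one] at hq
    exact (vc c).unique heq hq
  · obtain ⟨m, hm⟩ : ∃ m : ℕ, k - l = ((m + 1 : ℕ) : ℤ) := ⟨(k - l - 1).toNat, by lia⟩
    rw [hm, zpow_natCast] at hq
    have h2 := hq.unique heq ((vc c).mul (ht.pow (m + 1)))
    simp at h2

lemma IsDivisionPolynomial.eq_psiF {n : ℤ} {f : FunField} (hf : IsDivisionPolynomial n f) :
    f = psiF n := by
  by_cases hn : n = 0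
  · rw [hf.1 hn, (isDivisionPolynomial_psiF n).1 hn]
  · obtain ⟨ho, hl⟩ := hf.2 hn
    obtain ⟨ho', hl'⟩ := (isDivisionPolynomial_psiF n).2 hn
    classical
    obtain ⟨c, rfl⟩ := exists_const_of_hasOrderAt
      -- The prescribed order needs a proof that `v` defines a point; the value `0` elsewhere is
      -- never used.
      (k := fun v ↦ if hv : v ≠ 0 ∧ E.toProjective.Equation v then
        divisionDivisor n (point v hv.1 hv.2) else 0)
      (fun v hv h ↦ by rw [dif_pos ⟨hv, h⟩]; exact ho v hv h)
      (fun v hv h ↦ by rw [dif_pos ⟨hv, h⟩]; exact ho' v hv h)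
    rw [hl'.eq_one (Int.cast_ne_zero.mpr hn) hl, map_one, one_mul]

lemma existsUnique_isDivisionPolynomial (n : ℤ) : ∃! f, IsDivisionPolynomial n f :=
  ⟨psiF n, isDivisionPolynomial_psiF n, fun _ hf ↦ hf.eq_psiF⟩

lemma Psi_eq (n : ℤ) : Psi n = psiF n :=
  (Classical.epsilon_spec (p := IsDivisionPolynomial n) ⟨_, isDivisionPolynomial_psiF n⟩).eq_psiF

lemma Phi_eq (n : ℤ) : Phi n = phiF n := by
  rw [Phi, Psi_eq, Psi_eq, Psi_eq, phiF, phiVal]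

lemma Omega_eq (n : ℤ) : Omega n = omegaF n := by
  rw [Omega, Phi_eq, Psi_eq, Psi_eq, omegaF, omegaVal]
  rfl

end Uniqueness

end GenericCurve

end

noncomputable section

namespace GenericCurve

open WeierstrassCurve MvPolynomial

/-! ### Reduced representatives -/

section Reduced

/-- Evaluation of polynomials in two variables in the coordinate ring of the universal curve. -/
def evalUniv : MvPolynomial (Fin 2) CoeffRing →+* UnivRing :=
  eval₂Hom (algebraMap CoeffRing UnivRing) ![coordX universalCurve, coordY universalCurve]

lemma univToFun_algebraMap (c : CoeffRing) :
    univToFun (algebraMap CoeffRing UnivRing c) = const (coeffHom c) := by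
  rw [univToFun, RingHom.comp_apply, toCoord_algebraMap, coordToFun_algebraMap]

lemma univToFun_evalUniv (A : MvPolynomial (Fin 2) CoeffRing) :
    univToFun (evalUniv A) = eval₂ (const.comp coeffHom) ![funX, funY] A := by
  have : univToFun.comp evalUniv = eval₂Hom (const.comp coeffHom) ![funX, funY] := by
    apply MvPolynomial.ringHom_ext
    · intro c
      simp [evalUniv, univToFun_algebraMap]
    · intro i
      fin_cases i <;> simp [evalUniv, univToFun_coordX, univToFun_coordY]
  exact congrArg (fun f ↦ f A) this

lemma evalUniv_eq_sum (A : MvPolynomial (Fin 2) CoeffRing) : evalUniv A =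
    ∑ m ∈ A.support, algebraMap CoeffRing UnivRing (A.coeff m) *
      (coordX universalCurve ^ m 0 * coordY universalCurve ^ m 1) := by
  rw [evalUniv, coe_eval₂Hom, eval₂_eq']
  simp [Fin.prod_univ_two]

lemma toCoord_evalUniv (A : MvPolynomial (Fin 2) CoeffRing) : toCoord (evalUniv A) =
    ∑ m ∈ A.support, algebraMap K CoordRing (coeffHom (A.coeff m)) *
      (coordX E ^ m 0 * coordY E ^ m 1) := by
  rw [evalUniv_eq_sum, map_sum]
  simp only [map_mul, map_pow, toCoord_algebraMap, toCoord_coordX, toCoord_coordY]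

/-- The elements of the coordinate ring represented by a polynomial of degree at most `2` in `X`. -/
def reducedSubmonoid : AddSubmonoid UnivRing where
  carrier := {a | ∃ A : MvPolynomial (Fin 2) CoeffRing, A.degreeOf 0 ≤ 2 ∧ evalUniv A = a}
  add_mem' := by
    rintro a b ⟨A, hA, rfl⟩ ⟨B, hB, rfl⟩
    exact ⟨A + B, (degreeOf_add_le 0 A B).trans (max_le hA hB), map_add _ _ _⟩
  zero_mem' := ⟨0, by simp, map_zero _⟩

lemma monomial_mem_reduced (c : CoeffRing) {i : ℕ} (hi : i ≤ 2) (j : ℕ) :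
    algebraMap CoeffRing UnivRing c *
      (coordX universalCurve ^ i * coordY universalCurve ^ j) ∈ reducedSubmonoid := by
  refine ⟨C c * (X 0 ^ i * X 1 ^ j), ?_, by simp [evalUniv]⟩
  refine (degreeOf_C_mul_le _ _ _).trans ((degreeOf_mul_le _ _ _).trans ?_)
  refine (add_le_add (degreeOf_pow_le _ _ _) (degreeOf_pow_le _ _ _)).trans ?_
  rw [degreeOf_X, degreeOf_X]
  simpa using hi

lemma coordX_cube_eq : coordX universalCurve ^ 3 = coordY universalCurve ^ 2 +
    algebraMap CoeffRing UnivRing universalCurve.a₁ * coordX universalCurve *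
      coordY universalCurve +
    algebraMap CoeffRing UnivRing universalCurve.a₃ * coordY universalCurve -
    (algebraMap CoeffRing UnivRing universalCurve.a₂ * coordX universalCurve ^ 2 +
      algebraMap CoeffRing UnivRing universalCurve.a₄ * coordX universalCurve +
      algebraMap CoeffRing UnivRing universalCurve.a₆) := by
  have h := (Affine.equation_iff _ _).mp (equation_coord universalCurve)
  simp only [coordCurve, map_a₁, map_a₂, map_a₃, map_a₄, map_a₆] at h
  linear_combination -h

/-- Only the exponent `2` needs work: the `X³` that appears is replaced through the curve equation
by terms of degree at most `2` in `X`. -/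
lemma coordX_mul_monomial_mem (c : CoeffRing) {i : ℕ} (hi : i ≤ 2) (j : ℕ) :
    coordX universalCurve * (algebraMap CoeffRing UnivRing c *
      (coordX universalCurve ^ i * coordY universalCurve ^ j)) ∈ reducedSubmonoid := by
  obtain hi | rfl := Nat.lt_or_eq_of_le hi
  · have := monomial_mem_reduced c (i := i + 1) hi j
    rw [pow_succ] at this
    convert this using 1
    ring
  · have h := add_mem (add_mem (add_mem (add_mem (add_mem
      (monomial_mem_reduced c (Nat.zero_le 2) (j + 2))
      (monomial_mem_reduced (c * universalCurve.a₁) (by lia : 1 ≤ 2) (j + 1)))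
      (monomial_mem_reduced (c * universalCurve.a₃) (Nat.zero_le 2) (j + 1)))
      (monomial_mem_reduced (-(c * universalCurve.a₂)) le_rfl j))
      (monomial_mem_reduced (-(c * universalCurve.a₄)) (by lia : 1 ≤ 2) j))
      (monomial_mem_reduced (-(c * universalCurve.a₆)) (Nat.zero_le 2) j)
    convert h using 1
    simp only [map_neg, map_mul]
    linear_combination algebraMap CoeffRing UnivRing c * coordY universalCurve ^ j * coordX_cube_eq

lemma mul_mem_reduced {a r : UnivRing} (hr : r ∈ reducedSubmonoid)
    (ha : ∀ (c : CoeffRing) (i j : ℕ), i ≤ 2 → a * (algebraMap CoeffRing UnivRing c *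
      (coordX universalCurve ^ i * coordY universalCurve ^ j)) ∈ reducedSubmonoid) :
    a * r ∈ reducedSubmonoid := by
  obtain ⟨A, hA, rfl⟩ := hr
  rw [evalUniv_eq_sum, Finset.mul_sum]
  exact sum_mem fun m hm ↦ ha _ _ _ (degreeOf_le_iff.mp hA m hm)

/-- Reducedness is not visibly preserved by products, so the induction proves that multiplication by
`a` preserves reduced elements; applied to `1` this gives the claim. -/
lemma mem_reducedSubmonoid (a : UnivRing) : a ∈ reducedSubmonoid := by
  have key : ∀ r ∈ reducedSubmonoid, a * r ∈ reducedSubmonoid := by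
    induction a using coordRing_induction with
    | hC c =>
      refine fun r hr ↦ mul_mem_reduced hr fun d i j hi ↦ ?_
      rw [← mul_assoc, ← map_mul]
      exact monomial_mem_reduced _ hi j
    | hX => exact fun r hr ↦ mul_mem_reduced hr fun d i j hi ↦ coordX_mul_monomial_mem d hi j
    | hY =>
      refine fun r hr ↦ mul_mem_reduced hr fun d i j hi ↦ ?_
      have := monomial_mem_reduced d hi (j + 1)
      convert this using 1
      ring
    | hadd a b ha hb =>
      intro r hr
      rw [add_mul]
      exact add_mem (ha r hr) (hb r hr)
    | hmul a b ha hb =>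
      intro r hr
      rw [mul_assoc]
      exact ha _ (hb r hr)
  have h1 : (1 : UnivRing) ∈ reducedSubmonoid := by
    simpa using monomial_mem_reduced 1 (Nat.zero_le 2) 0
  simpa using key 1 h1

lemma exists_isReducedRepresentative (a : UnivRing) :
    ∃ A, IsReducedRepresentative (univToFun a) A := by
  obtain ⟨A, hA, rfl⟩ := mem_reducedSubmonoid a
  exact ⟨A, hA, (univToFun_evalUniv A).symm⟩

lemma IsReducedRepresentative.evalUniv_eq {a : UnivRing} {A : MvPolynomial (Fin 2) CoeffRing}
    (hA : IsReducedRepresentative (univToFun a) A) : evalUniv A = a := by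
  apply univToFun_injective
  rw [univToFun_evalUniv, hA.2]

lemma coeffHom_ne_zero {c : CoeffRing} (hc : c ≠ 0) : coeffHom c ≠ 0 :=
  (map_ne_zero_iff _ coeffHom_injective).mpr hc

/-- For `i ≤ 2` the weight `2i + 3j` determines `i` modulo `3`, hence `i` and `j`. The monomials
have distinct pole orders, so the one of largest weight cannot be cancelled. -/
lemma exists_weight_eq {A : MvPolynomial (Fin 2) CoeffRing} (hA : A.degreeOf 0 ≤ 2)
    (h0 : A ≠ 0) : ∃ m ∈ A.support, poleOrder (toCoord (evalUniv A)) =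
      ((2 * m 0 + 3 * m 1 : ℕ) : WithBot ℕ) ∧
      ∀ m' ∈ A.support, 2 * m' 0 + 3 * m' 1 ≤ 2 * m 0 + 3 * m 1 := by
  obtain ⟨m, hm, hmax⟩ := A.support.exists_max_image (fun m ↦ 2 * m 0 + 3 * m 1)
    (support_nonempty.mpr h0)
  have hp (m' : Fin 2 →₀ ℕ) (hm' : m' ∈ A.support) :
      poleOrder (algebraMap K CoordRing (coeffHom (A.coeff m')) *
        (coordX E ^ m' 0 * coordY E ^ m' 1)) = ((2 * m' 0 + 3 * m' 1 : ℕ) : WithBot ℕ) :=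
    poleOrder_monomial (coeffHom_ne_zero (mem_support_iff.mp hm')) _ _
  refine ⟨m, hm, ?_, hmax⟩
  rw [toCoord_evalUniv, poleOrder_sum_eq (fun m ↦ algebraMap K CoordRing (coeffHom (A.coeff m)) *
    (coordX E ^ m 0 * coordY E ^ m 1)) hm, hp m hm]
  · intro h
    have := hp m hm
    rw [h, poleOrder_eq_bot.mpr rfl] at this
    exact absurd this.symm WithBot.coe_ne_bot
  · intro m' hm' hne
    rw [hp m hm, hp m' hm', Nat.cast_lt]
    refine lt_of_le_of_ne (hmax m' hm') fun heq ↦ hne ?_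
    have h1 := degreeOf_le_iff.mp hA m hm
    have h2 := degreeOf_le_iff.mp hA m' hm'
    ext i
    fin_cases i
    · simp only [Fin.zero_eta]; lia
    · simp only [Fin.mk_one]; lia

lemma IsReducedRepresentative.unique {f : FunField} {A B : MvPolynomial (Fin 2) CoeffRing}
    (hA : IsReducedRepresentative f A) (hB : IsReducedRepresentative f B) : A = B := by
  by_contra hne
  obtain ⟨m, -, h, -⟩ := exists_weight_eq
    ((degreeOf_sub_le 0 A B).trans (max_le hA.1 hB.1)) (sub_ne_zero.mpr hne)
  have h0 : evalUniv (A - B) = 0 := by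
    apply univToFun_injective
    rw [map_sub, map_sub, univToFun_evalUniv, univToFun_evalUniv, hA.2, hB.2, sub_self, map_zero]
  rw [h0, map_zero, poleOrder_eq_bot.mpr rfl] at h
  exact absurd h.symm WithBot.coe_ne_bot

variable {a : UnivRing} {N : ℕ}

lemma isReducedRepresentative_reducedRepresentative (a : UnivRing) :
    IsReducedRepresentative (univToFun a) (reducedRepresentative (univToFun a)) :=
  Classical.epsilon_spec (exists_isReducedRepresentative a)

lemma existsUnique_isReducedRepresentative (a : UnivRing) :
    ∃! A, IsReducedRepresentative (univToFun a) A :=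
  ⟨_, isReducedRepresentative_reducedRepresentative a,
    fun _ hB ↦ hB.unique (isReducedRepresentative_reducedRepresentative a)⟩

lemma evalUniv_reducedRepresentative (a : UnivRing) :
    evalUniv (reducedRepresentative (univToFun a)) = a :=
  (isReducedRepresentative_reducedRepresentative a).evalUniv_eq

lemma weight_le_of_mem_support (ha : poleOrder (toCoord a) ≤ ((3 * N : ℕ) : WithBot ℕ))
    {m : Fin 2 →₀ ℕ} (hm : m ∈ (reducedRepresentative (univToFun a)).support) :
    m 0 ≤ 2 ∧ 2 * m 0 + 3 * m 1 ≤ 3 * N := by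
  have hA := (isReducedRepresentative_reducedRepresentative a).1
  refine ⟨degreeOf_le_iff.mp hA m hm, ?_⟩
  obtain ⟨m', -, h, hmax⟩ := exists_weight_eq hA (by rintro h; rw [h] at hm; simp at hm)
  rw [evalUniv_reducedRepresentative] at h
  rw [h, Nat.cast_le] at ha
  exact (hmax m hm).trans ha

/-- From `2i + 3j ≤ 3N` and `i ≤ 2` follows `3(i + j) ≤ 3N + 2`. -/
lemma degree_le_of_mem_support (ha : poleOrder (toCoord a) ≤ ((3 * N : ℕ) : WithBot ℕ))
    {m : Fin 2 →₀ ℕ} (hm : m ∈ (reducedRepresentative (univToFun a)).support) :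
    m 0 + m 1 ≤ N := by
  obtain ⟨h1, h2⟩ := weight_le_of_mem_support ha hm
  lia

lemma totalDegree_reducedRepresentative_le
    (ha : poleOrder (toCoord a) ≤ ((3 * N : ℕ) : WithBot ℕ)) :
    (reducedRepresentative (univToFun a)).totalDegree ≤ N := by
  refine Finset.sup_le fun m hm ↦ ?_
  rw [Finsupp.sum_fintype _ _ fun _ ↦ rfl, Fin.sum_univ_two]
  exact degree_le_of_mem_support ha hm

/-- The exponent of `Y ^ N`. -/
abbrev expTop (N : ℕ) : Fin 2 →₀ ℕ := Finsupp.single 1 N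

lemma coeff_expTop_eq_zero (ha : poleOrder (toCoord a) < ((3 * N : ℕ) : WithBot ℕ)) :
    (reducedRepresentative (univToFun a)).coeff (expTop N) = 0 := by
  by_contra h0
  have hm := mem_support_iff.mpr h0
  obtain ⟨m', -, h, hmax⟩ := exists_weight_eq
    (isReducedRepresentative_reducedRepresentative a).1 (by rintro h; rw [h] at hm; simp at hm)
  rw [evalUniv_reducedRepresentative] at h
  rw [h, Nat.cast_lt] at ha
  have := hmax _ hm
  simp [expTop] at this
  lia

/-- A monomial of weight `3N` with `i ≤ 2` has `i` divisible by `3`, so it is `Y ^ N`. -/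
lemma coeff_expTop_ne_zero (ha : poleOrder (toCoord a) = ((3 * N : ℕ) : WithBot ℕ)) :
    (reducedRepresentative (univToFun a)).coeff (expTop N) ≠ 0 := by
  have hr := isReducedRepresentative_reducedRepresentative a
  obtain ⟨m, hm, h, -⟩ := exists_weight_eq hr.1 (by
    intro h
    have := evalUniv_reducedRepresentative a
    rw [h, map_zero] at this
    rw [← this, map_zero, poleOrder_eq_bot.mpr rfl] at ha
    exact absurd ha.symm WithBot.coe_ne_bot)
  rw [evalUniv_reducedRepresentative, ha] at h
  have h' : 3 * N = 2 * m 0 + 3 * m 1 := Nat.cast_injective h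
  have h2 := degreeOf_le_iff.mp hr.1 m hm
  have hme : m = expTop N := by
    ext i
    fin_cases i
    · simp; lia
    · simp; lia
  rw [← hme]
  exact mem_support_iff.mp hm

lemma eval₂_homogenize (v : Fin 3 → K) (A : MvPolynomial (Fin 2) CoeffRing) :
    eval₂ coeffHom v (homogenize N A) = ∑ m ∈ A.support, coeffHom (A.coeff m) *
      (v 0 ^ m 0 * v 1 ^ m 1 * v 2 ^ (N - (m 0 + m 1))) := by
  rw [homogenize, ← coe_eval₂Hom, map_sum]
  simp

lemma eval₂_homogenize_affine {v : Fin 3 → K} (hz : v 2 ≠ 0) (h : E.toProjective.Equation v)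
    (ha : poleOrder (toCoord a) ≤ ((3 * N : ℕ) : WithBot ℕ)) :
    eval₂ coeffHom v (homogenize N (reducedRepresentative (univToFun a))) =
      v 2 ^ N * specialize (equation_affine hz h) a := by
  rw [eval₂_homogenize]
  nth_rw 3 [← evalUniv_reducedRepresentative a]
  rw [specialize, RingHom.comp_apply, toCoord_evalUniv, map_sum, Finset.mul_sum]
  refine Finset.sum_congr rfl fun m hm ↦ ?_
  obtain ⟨k, hk⟩ := Nat.exists_eq_add_of_le (degree_le_of_mem_support ha hm)
  rw [hk, add_tsub_cancel_left]
  simp only [map_mul, map_pow, evalAt_algebraMap, evalAt_coordX, evalAt_coordY, div_pow]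
  field_simp
  ring

lemma eval₂_homogenize_infinity {v : Fin 3 → K} (hx : v 0 = 0) (hz : v 2 = 0)
    (ha : poleOrder (toCoord a) ≤ ((3 * N : ℕ) : WithBot ℕ)) :
    eval₂ coeffHom v (homogenize N (reducedRepresentative (univToFun a))) =
      coeffHom ((reducedRepresentative (univToFun a)).coeff (expTop N)) * v 1 ^ N := by
  rw [eval₂_homogenize, Finset.sum_eq_single (expTop N)]
  · simp [expTop]
  · intro m hm hne
    rw [hx, hz]
    by_cases h0 : m 0 = 0
    · have h1 : N - (m 0 + m 1) ≠ 0 := by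
        intro h1
        have := degree_le_of_mem_support ha hm
        apply hne
        ext i
        fin_cases i
        · simpa using h0
        · simp; lia
      rw [zero_pow h1, mul_zero, mul_zero]
    · rw [zero_pow h0, zero_mul, zero_mul, mul_zero]
  · intro hm
    rw [notMem_support_iff.mp hm, map_zero, zero_mul]

end Reduced

end GenericCurve

end

noncomputable section

namespace GenericCurve

open WeierstrassCurve MvPolynomial

/-! ### The orders at infinity of the coordinates of the multiplication map -/

section PoleOrder

lemma poleOrder_mul_le {a b : CoordRing} {i j : ℕ} (ha : poleOrder a ≤ (i : WithBot ℕ))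
    (hb : poleOrder b ≤ (j : WithBot ℕ)) : poleOrder (a * b) ≤ ((i + j : ℕ) : WithBot ℕ) := by
  rw [poleOrder_mul, Nat.cast_add]
  exact add_le_add ha hb

lemma poleOrder_pow_le {a : CoordRing} {i : ℕ} (ha : poleOrder a ≤ (i : WithBot ℕ)) (k : ℕ) :
    poleOrder (a ^ k) ≤ ((k * i : ℕ) : WithBot ℕ) := by
  rw [poleOrder_pow, Nat.cast_mul, ← nsmul_eq_mul]
  exact nsmul_le_nsmul_right ha k

lemma poleOrder_algebraMap_le (c : K) :
    poleOrder (algebraMap K CoordRing c) ≤ ((0 : ℕ) : WithBot ℕ) := by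
  by_cases hc : c = 0
  · rw [hc, map_zero, poleOrder_eq_bot.mpr rfl]
    exact bot_le
  · rw [poleOrder_algebraMap hc]
    exact le_rfl

lemma poleOrder_psiU {n : ℤ} (hn : n ≠ 0) :
    poleOrder (toCoord (psiU n)) = ((n.natAbs ^ 2 - 1 : ℕ) : WithBot ℕ) := by
  rw [toCoord_psiU, poleOrder_psi hn]

lemma poleOrder_phiU (n : ℤ) :
    poleOrder (toCoord (phiU n)) = ((2 * n.natAbs ^ 2 : ℕ) : WithBot ℕ) := by
  rw [toCoord_phiU, poleOrder_phi]

lemma psiU_zero : psiU 0 = 0 := by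
  apply univToFun_injective
  rw [univToFun_psiU, map_zero]
  exact psiVal_zero

lemma one_le_natAbs_sq {n : ℤ} (hn : n ≠ 0) : 1 ≤ n.natAbs ^ 2 :=
  Nat.one_le_pow _ _ (Int.natAbs_pos.mpr hn)

lemma poleOrder_psiU_mul_phiU_lt (n : ℤ) :
    poleOrder (toCoord (psiU n * phiU n)) < ((3 * n.natAbs ^ 2 : ℕ) : WithBot ℕ) := by
  by_cases hn : n = 0
  · rw [hn, psiU_zero, zero_mul, map_zero, poleOrder_eq_bot.mpr rfl]
    exact WithBot.bot_lt_coe _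
  · have := one_le_natAbs_sq hn
    rw [map_mul]
    refine (poleOrder_mul_le (poleOrder_psiU hn).le (poleOrder_phiU n).le).trans_lt ?_
    rw [Nat.cast_lt]
    lia

lemma poleOrder_psiU_cube_lt (n : ℤ) :
    poleOrder (toCoord (psiU n ^ 3)) < ((3 * n.natAbs ^ 2 : ℕ) : WithBot ℕ) := by
  by_cases hn : n = 0
  · rw [hn, psiU_zero, zero_pow three_ne_zero, map_zero, poleOrder_eq_bot.mpr rfl]
    exact WithBot.bot_lt_coe _
  · have := one_le_natAbs_sq hn
    rw [map_pow]
    refine (poleOrder_pow_le (poleOrder_psiU hn).le 3).trans_lt ?_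
    rw [Nat.cast_lt]
    lia

/-- The difference between the coordinates `Ω_{-n}` and `Ω_n`. -/
abbrev omegaDiff (n : ℤ) : UnivRing :=
  algebraMap CoeffRing UnivRing universalCurve.a₁ * (psiU n * phiU n) +
    algebraMap CoeffRing UnivRing universalCurve.a₃ * psiU n ^ 3

lemma poleOrder_omegaDiff_lt (n : ℤ) :
    poleOrder (toCoord (omegaDiff n)) < ((3 * n.natAbs ^ 2 : ℕ) : WithBot ℕ) := by
  rw [map_add]
  have key (c : CoeffRing) {a : UnivRing} {m : ℕ} (ha : poleOrder (toCoord a) < (m : WithBot ℕ)) :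
      poleOrder (toCoord (algebraMap CoeffRing UnivRing c * a)) < (m : WithBot ℕ) := by
    rw [map_mul, toCoord_algebraMap, poleOrder_mul]
    refine lt_of_le_of_lt ?_ ha
    refine (add_le_add (poleOrder_algebraMap_le _) le_rfl).trans ?_
    rw [Nat.cast_zero, zero_add]
  exact (poleOrder_add_le _ _).trans_lt (max_lt (key _ (poleOrder_psiU_mul_phiU_lt n))
    (key _ (poleOrder_psiU_cube_lt n)))

open scoped Classical in
lemma omegaU_equation {n : ℤ} (hn : 1 ≤ n) : omegaU n * (omegaU n + omegaDiff n) = phiU n ^ 3 +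
    (algebraMap CoeffRing UnivRing universalCurve.a₂ * (phiU n ^ 2 * psiU n ^ 2) +
      algebraMap CoeffRing UnivRing universalCurve.a₄ * (phiU n * psiU n ^ 4) +
      algebraMap CoeffRing UnivRing universalCurve.a₆ * psiU n ^ 6) := by
  apply univToFun_injective
  have h := equation_jacVal psiF_ne_zero two_ne_zero nonsingular_generic hn
  rw [Jacobian.equation_iff] at h
  simp only [jacVal, Matrix.cons_val] at h
  rw [show funCurve.a₁ = const (coeffHom universalCurve.a₁) from rfl,
    show funCurve.a₂ = const (coeffHom universalCurve.a₂) from rfl,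
    show funCurve.a₃ = const (coeffHom universalCurve.a₃) from rfl,
    show funCurve.a₄ = const (coeffHom universalCurve.a₄) from rfl,
    show funCurve.a₆ = const (coeffHom universalCurve.a₆) from rfl] at h
  simp only [map_add, map_mul, map_pow, univToFun_psiU, univToFun_phiU, univToFun_omegaU,
    univToFun_algebraMap]
  linear_combination h

/-- On the right of `omegaU_equation` the term `Φ_n³` dominates, with pole order `6n²`. On the left,
`omegaDiff` has order below `3n²`, so `Ω_n` must dominate it and carries half of `6n²`. -/
lemma poleOrder_omegaU_of_pos {n : ℤ} (hn : 1 ≤ n) :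
    poleOrder (toCoord (omegaU n)) = ((3 * n.natAbs ^ 2 : ℕ) : WithBot ℕ) := by
  have hn0 : n ≠ 0 := by lia
  have hN := one_le_natAbs_sq hn0
  have hψ := poleOrder_psiU hn0
  have hφ := poleOrder_phiU n
  have hB := poleOrder_omegaDiff_lt n
  have h := congrArg toCoord (omegaU_equation hn)
  simp only [map_mul, map_add toCoord (phiU n ^ 3), map_add toCoord (omegaU n)] at h
  set N := n.natAbs ^ 2
  have hlead : poleOrder (toCoord (phiU n ^ 3)) = ((6 * N : ℕ) : WithBot ℕ) := by
    rw [map_pow, poleOrder_pow, hφ, nsmul_eq_mul, ← Nat.cast_mul]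
    congr 1
    lia
  have hrest : poleOrder (toCoord
      (algebraMap CoeffRing UnivRing universalCurve.a₂ * (phiU n ^ 2 * psiU n ^ 2) +
      algebraMap CoeffRing UnivRing universalCurve.a₄ * (phiU n * psiU n ^ 4) +
      algebraMap CoeffRing UnivRing universalCurve.a₆ * psiU n ^ 6)) <
        ((6 * N : ℕ) : WithBot ℕ) := by
    simp only [map_add, map_mul, map_pow, toCoord_algebraMap]
    refine (poleOrder_add_le _ _).trans_lt (max_lt ((poleOrder_add_le _ _).trans_lt
      (max_lt ?_ ?_)) ?_)
    · refine (poleOrder_mul_le (poleOrder_algebraMap_le _) (poleOrder_mul_le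
        (poleOrder_pow_le hφ.le 2) (poleOrder_pow_le hψ.le 2))).trans_lt ?_
      rw [Nat.cast_lt]
      lia
    · refine (poleOrder_mul_le (poleOrder_algebraMap_le _) (poleOrder_mul_le
        hφ.le (poleOrder_pow_le hψ.le 4))).trans_lt ?_
      rw [Nat.cast_lt]
      lia
    · refine (poleOrder_mul_le (poleOrder_algebraMap_le _) (poleOrder_pow_le hψ.le 6)).trans_lt ?_
      rw [Nat.cast_lt]
      lia
  have hR := congrArg poleOrder h
  have hsum := poleOrder_add_eq (hrest.trans_eq hlead.symm)
  rw [poleOrder_mul, hsum, hlead] at hR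
  obtain hlt | hle := lt_or_ge (poleOrder (toCoord (omegaDiff n))) (poleOrder (toCoord (omegaU n)))
  · rw [poleOrder_add_eq hlt] at hR
    obtain ⟨w, hw⟩ := WithBot.ne_bot_iff_exists.mp (ne_bot_of_gt hlt)
    rw [← hw] at hR ⊢
    have h2 : w + w = 6 * N := WithBot.coe_injective hR
    have : w = 3 * N := by lia
    rw [this]
    rfl
  -- Were `Ω_n` dominated by `omegaDiff`, the left side would have order at most `(3n² - 1) + 3n² <
  -- 6n²`.
  · exfalso
    have h1 : poleOrder (toCoord (omegaU n)) ≤ ((3 * N - 1 : ℕ) : WithBot ℕ) := by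
      refine hle.trans ?_
      cases hp : poleOrder (toCoord (omegaDiff n)) with
      | bot => exact bot_le
      | coe m =>
        rw [hp] at hB
        have : m < 3 * N := WithBot.coe_lt_coe.mp hB
        exact WithBot.coe_le_coe.mpr (by lia)
    have h2 : poleOrder (toCoord (omegaU n) + toCoord (omegaDiff n)) ≤ ((3 * N : ℕ) : WithBot ℕ) :=
      (poleOrder_add_le _ _).trans (max_le (hle.trans hB.le) hB.le)
    have h3 := add_le_add h1 h2
    rw [hR, ← Nat.cast_add, Nat.cast_le] at h3
    lia

lemma omegaU_zero : omegaU 0 = 1 := by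
  apply univToFun_injective
  rw [univToFun_omegaU, map_one]
  exact omegaVal_zero

lemma omegaU_neg {n : ℤ} (hn : n ≠ 0) : omegaU (-n) = omegaU n + omegaDiff n := by
  apply univToFun_injective
  simp only [map_add, map_mul, map_pow, univToFun_psiU, univToFun_phiU, univToFun_omegaU,
    univToFun_algebraMap]
  have h := omegaVal_neg (W := funCurve) (x := funX) (y := funY) two_ne_zero
    (psiF_ne_zero n hn) hn
  rw [show funCurve.a₁ = const (coeffHom universalCurve.a₁) from rfl,
    show funCurve.a₃ = const (coeffHom universalCurve.a₃) from rfl] at h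
  linear_combination h

lemma poleOrder_omegaU (n : ℤ) :
    poleOrder (toCoord (omegaU n)) = ((3 * n.natAbs ^ 2 : ℕ) : WithBot ℕ) := by
  obtain hn | rfl | hn : 1 ≤ n ∨ n = 0 ∨ 1 ≤ -n := by lia
  · exact poleOrder_omegaU_of_pos hn
  · rw [omegaU_zero, map_one, ← map_one (algebraMap K CoordRing), poleOrder_algebraMap one_ne_zero]
    rfl
  · have h := poleOrder_omegaU_of_pos hn
    have hB := poleOrder_omegaDiff_lt (-n)
    rw [← neg_neg n, omegaU_neg (by lia), map_add, poleOrder_add_eq (by rw [h]; exact hB), h,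
      Int.natAbs_neg, neg_neg]

end PoleOrder

/-! ### The multiplication map in homogeneous coordinates -/

section Main

lemma Psi_mul_Phi_eq (n : ℤ) : Psi n * Phi n = univToFun (psiU n * phiU n) := by
  rw [Psi_eq, Phi_eq, map_mul, univToFun_psiU, univToFun_phiU]

lemma Omega_eq_univToFun (n : ℤ) : Omega n = univToFun (omegaU n) := by
  rw [Omega_eq, univToFun_omegaU]

lemma Psi_cube_eq (n : ℤ) : Psi n ^ 3 = univToFun (psiU n ^ 3) := by
  rw [Psi_eq, map_pow, univToFun_psiU]

theorem wellDefined (n : ℤ) : WellDefined n := by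
  refine ⟨existsUnique_isDivisionPolynomial n, ⟨?_, ?_⟩, ⟨?_, ?_⟩, ?_, ?_⟩
  · rw [Psi_mul_Phi_eq]
    exact existsUnique_isReducedRepresentative _
  · rw [polyA, Psi_mul_Phi_eq]
    exact totalDegree_reducedRepresentative_le (poleOrder_psiU_mul_phiU_lt n).le
  · rw [Omega_eq_univToFun]
    exact existsUnique_isReducedRepresentative _
  · rw [polyB, Omega_eq_univToFun]
    exact totalDegree_reducedRepresentative_le (poleOrder_omegaU n).le
  · rw [Psi_cube_eq]
    exact existsUnique_isReducedRepresentative _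
  · rw [polyC, Psi_cube_eq]
    exact totalDegree_reducedRepresentative_le (poleOrder_psiU_cube_lt n).le

lemma projClass_smul {v w : Fin 3 → K} {c : K} (hc : c ≠ 0) (h : v = c • w) :
    projClass v = projClass w :=
  Quotient.sound ⟨Units.mk0 c hc, h.symm⟩

/-- At an affine point the three forms are `z^(n²)` times the values in `zsmul_point_eq`. At
infinity only the coefficient of `Y^(n²)` matters: it is nonzero for `Ω_n` and zero for `Ψ_nΦ_n` and
`Ψ_n³`, by their pole orders. -/
theorem zsmul_point (n : ℤ) {v : Fin 3 → K} (hv : v ≠ 0) (h : E.toProjective.Equation v) :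
    (n • point v hv h).point = projClass ![eval₂ coeffHom v (alpha n),
      eval₂ coeffHom v (beta n), eval₂ coeffHom v (gamma n)] := by
  rw [alpha, beta, gamma, polyA, polyB, polyC, Psi_mul_Phi_eq, Omega_eq_univToFun, Psi_cube_eq]
  by_cases hz : v 2 = 0
  · have hx := X_eq_zero_of_equation h hz
    rw [eval₂_homogenize_infinity hx hz (poleOrder_psiU_mul_phiU_lt n).le,
      eval₂_homogenize_infinity hx hz (poleOrder_omegaU n).le,
      eval₂_homogenize_infinity hx hz (poleOrder_psiU_cube_lt n).le,
      coeff_expTop_eq_zero (poleOrder_psiU_mul_phiU_lt n),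
      coeff_expTop_eq_zero (poleOrder_psiU_cube_lt n), point_eq_zero hv hz, zsmul_zero]
    refine (projClass_smul (w := ![0, 1, 0]) (mul_ne_zero (coeffHom_ne_zero
      (coeff_expTop_ne_zero (poleOrder_omegaU n)))
      (pow_ne_zero (n.natAbs ^ 2) (Y_ne_zero_of_equation hv h hz))) ?_).symm
    ext i
    fin_cases i <;> simp
  · rw [eval₂_homogenize_affine hz h (poleOrder_psiU_mul_phiU_lt n).le,
      eval₂_homogenize_affine hz h (poleOrder_omegaU n).le,
      eval₂_homogenize_affine hz h (poleOrder_psiU_cube_lt n).le, zsmul_point_eq hv hz h]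
    refine (projClass_smul (pow_ne_zero (n.natAbs ^ 2) hz) ?_).symm
    ext i
    fin_cases i
    · simp [mul_comm]
    · simp
    · simp

end Main

end GenericCurve

end

theorem mainTheorem8 (n : ℤ) :
    GenericCurve.WellDefined n ∧
    ∀ (v : Fin 3 → GenericCurve.K) (hv : v ≠ 0)
      (h : GenericCurve.E.toProjective.Equation v),
      (n • GenericCurve.point v hv h).point =
        GenericCurve.projClass
          ![MvPolynomial.eval₂ GenericCurve.coeffHom v (GenericCurve.alpha n),
            MvPolynomial.eval₂ GenericCurve.coeffHom v (GenericCurve.beta n),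
            MvPolynomial.eval₂ GenericCurve.coeffHom v (GenericCurve.gamma n)] :=
  ⟨GenericCurve.wellDefined n, fun _ hv h ↦ GenericCurve.zsmul_point n hv h⟩
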